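/- Conventions. A rational matrix is a matrix of rational functions of $s$ with complex coefficients; $\Pi^+=\{s\in\mathbb C:\operatorname{Re}s>0\}$; $M^T$ is the transpose and $M^*$ the conjugate transpose of a complex matrix $M$. A rational matrix $S$ is a *Schur function* if it is holomorphic in $\Pi^+$ and $S(s)S(s)^*\le I$ for all $s\in\Pi^+$. A square Schur function is *inner* if moreover $S(i\omega)S(i\omega)^*=I$ for all $\omega\in\mathbb R$. A square rational matrix is *symmetric* if it equals its transpose. It is *strictly contractive at infinity* if it is finite at infinity and $\|S(\infty)\|<1$ in the operator norm. A *realization* of $S$ consists of complex matrices $(A,B,C,D)$ with $S(s)=C(sI-A)^{-1}B+D$; it is *minimal* if the size of $A$ is the least possible, and this least size is the *McMillan degree* of $S$; it is *symmetric* if $A=A^T$, $C=B^T$ and $D=D^T$. A *symmetric inner extension* of a $p\times p$ rational matrix $S$ is a symmetric inner $2p\times 2p$ rational matrix of the form $$\mathcal S=\begin{pmatrix}S_{11}&S_{12}\\ S_{21}&S\end{pmatrix}.$$ **Theorem.** Let $S$ be a $p\times p$ symmetric rational Schur function of McMillan degree $n$ that is strictly contractive at infinity. Then $S$ has a minimal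 realization that is symmetric. Let $(A,B,C,D)$ be any such realization, put $$\hat A=A+BD^*(I_p-DD^*)^{-1}C,\qquad \hat B=B(I_p-D^*D)^{-1/2},\qquad \hat C=(I_p-DD^*)^{-1/2}C,$$ $$H=\begin{pmatrix}-\hat A^*&-\hat C^*\hat C\\ \hat B\hat B^*&\hat A\end{pmatrix},$$ and let $\kappa$ be the number of distinct roots in $\Pi^+$, of odd algebraic multiplicity, of the characteristic polynomial of $H$. Then $S$ has a symmetric inner extension of McMillan degree $n+\kappa$, and every symmetric inner extension of $S$ has McMillan degree at least $n+\kappa$. -/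

import Mathlib

open Filter Topology
open scoped Polynomial ComplexOrder

/-- A matrix of rational functions of one complex variable. Row and column index sets are
arbitrary, so that both `p × p` matrices and `2p × 2p` block matrices are covered. -/
abbrev RationalMatrix (m k : Type*) := Matrix m k (RatFunc ℂ)

namespace RationalMatrix

/-- The value `S(s)`, entry by entry (meaningful when `s` is not a pole of `S`). -/
noncomputable def eval {m k : Type*} (S : RationalMatrix m k) (s : ℂ) : Matrix m k ℂ :=
  Matrix.of fun i j => RatFunc.eval (RingHom.id ℂ) s (S i j)

/-- `s` is a pole of `S`: the reduced denominator of some entry vanishes at `s`. -/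
def IsPole {m k : Type*} (S : RationalMatrix m k) (s : ℂ) : Prop :=
  ∃ i j, (S i j).denom.eval s = 0

/-- A Schur function: a rational matrix, holomorphic in the open right half-plane, with
`S(s) S(s)^* ≤ I` there. -/
structure IsSchur {m k : Type*} [Fintype k] [DecidableEq m] (S : RationalMatrix m k) :
    Prop where
  holomorphic : ∀ s : ℂ, 0 < s.re → ¬ S.IsPole s
  contractive : ∀ s : ℂ, 0 < s.re → (1 - S.eval s * (S.eval s).conjTranspose).PosSemidef

/-- An inner (lossless) function: a square Schur function that is unitary on the imaginary
axis. (Being bounded in the right half-plane, a Schur function has no pole on that axis.) -/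
structure IsInner {m : Type*} [Fintype m] [DecidableEq m] (S : RationalMatrix m m) : Prop where
  schur : S.IsSchur
  unitary : ∀ ω : ℝ,
    S.eval (Complex.I * (ω : ℂ)) * (S.eval (Complex.I * (ω : ℂ))).conjTranspose = 1

/-- `S` is finite at infinity and its value `S(∞)` satisfies `‖S(∞)‖ < 1` in the operator norm
between Euclidean spaces. -/
def IsStrictlyContractiveAtInfinity {m : Type*} [Fintype m] [DecidableEq m]
    (S : RationalMatrix m m) : Prop :=
  ∃ D : Matrix m m ℂ, Tendsto S.eval (cocompact ℂ) (𝓝 D) ∧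
    ‖Matrix.toEuclideanCLM (n := m) (𝕜 := ℂ) D‖ < 1

/-- `(A, B, C, D)` is a realization of `S`: `S = C (s I - A)⁻¹ B + D`, as an identity between
matrices of rational functions. -/
def IsRealization {m k : Type*} (S : RationalMatrix m k) {n : ℕ}
    (A : Matrix (Fin n) (Fin n) ℂ) (B : Matrix (Fin n) k ℂ)
    (C : Matrix m (Fin n) ℂ) (D : Matrix m k ℂ) : Prop :=
  S = C.map RatFunc.C * (Matrix.scalar (Fin n) RatFunc.X - A.map RatFunc.C)⁻¹ * B.map RatFunc.C
    + D.map RatFunc.C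

/-- `S` has a realization whose dynamics matrix is of size `n`. -/
def HasRealizationOfSize {m k : Type*} (S : RationalMatrix m k) (n : ℕ) : Prop :=
  ∃ (A : Matrix (Fin n) (Fin n) ℂ) (B : Matrix (Fin n) k ℂ)
    (C : Matrix m (Fin n) ℂ) (D : Matrix m k ℂ), S.IsRealization A B C D

/-- The McMillan degree: the least size of (the dynamics matrix of) a realization. It is a
natural number exactly when `S` has a realization, and `⊤` otherwise. -/
noncomputable def mcMillanDegree {m k : Type*} (S : RationalMatrix m k) : ℕ∞ :=
  ⨅ (n : ℕ) (_ : S.HasRealizationOfSize n), (n : ℕ∞)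

/-- A minimal realization: one whose dynamics matrix has the least possible size. -/
def IsMinimalRealization {m k : Type*} (S : RationalMatrix m k) {n : ℕ}
    (A : Matrix (Fin n) (Fin n) ℂ) (B : Matrix (Fin n) k ℂ)
    (C : Matrix m (Fin n) ℂ) (D : Matrix m k ℂ) : Prop :=
  S.IsRealization A B C D ∧ ∀ l : ℕ, S.HasRealizationOfSize l → n ≤ l

/-- `T` is a symmetric inner extension of the `p × p` matrix `S`: it is a `2p × 2p` inner
function, equal to its transpose, whose lower right `p × p` block is `S`. -/
structure IsSymmetricInnerExtension {p : ℕ} (S : RationalMatrix (Fin p) (Fin p))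
    (T : RationalMatrix (Fin p ⊕ Fin p) (Fin p ⊕ Fin p)) : Prop where
  inner : T.IsInner
  symm : T.IsSymm
  extends_block : T.toBlocks₂₂ = S

end RationalMatrix

/-- A symmetric realization: `A = Aᵀ`, `C = Bᵀ`, `D = Dᵀ`. -/
def IsSymmetricRealization {n : ℕ} {m : Type*} (A : Matrix (Fin n) (Fin n) ℂ)
    (B : Matrix (Fin n) m ℂ) (C : Matrix m (Fin n) ℂ) (D : Matrix m m ℂ) : Prop :=
  A.IsSymm ∧ C = B.transpose ∧ D.IsSymm

section Hamiltonian

open Matrix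

variable {n : ℕ} {m : Type*} [Fintype m] [DecidableEq m]

/-- `Â = A + B D^* (I - D D^*)⁻¹ C`. -/
noncomputable def hatA (A : Matrix (Fin n) (Fin n) ℂ) (B : Matrix (Fin n) m ℂ)
    (C : Matrix m (Fin n) ℂ) (D : Matrix m m ℂ) : Matrix (Fin n) (Fin n) ℂ :=
  A + B * Dᴴ * (1 - D * Dᴴ)⁻¹ * C

/-- The Hamiltonian matrix `H = [[-Â^*, -Ĉ^* Ĉ], [B̂ B̂^*, Â]]` of a realization, where
`B̂ = B (I - D^* D)^{-1/2}` and `Ĉ = (I - D D^*)^{-1/2} C`, that is,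
`B̂ B̂^* = B (I - D^* D)⁻¹ B^*` and `Ĉ^* Ĉ = C^* (I - D D^*)⁻¹ C`. -/
noncomputable def hamiltonianMatrix (A : Matrix (Fin n) (Fin n) ℂ) (B : Matrix (Fin n) m ℂ)
    (C : Matrix m (Fin n) ℂ) (D : Matrix m m ℂ) :
    Matrix (Fin n ⊕ Fin n) (Fin n ⊕ Fin n) ℂ :=
  Matrix.fromBlocks
    (-(hatA A B C D)ᴴ) (-(Cᴴ * (1 - D * Dᴴ)⁻¹ * C))
    (B * (1 - Dᴴ * D)⁻¹ * Bᴴ) (hatA A B C D)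

end Hamiltonian

/-- The number of distinct roots of `f` in the open right half-plane whose multiplicity is
odd. -/
noncomputable def numOddRootsRightHalfPlane (f : ℂ[X]) : ℕ :=
  Set.ncard {s : ℂ | f.IsRoot s ∧ 0 < s.re ∧ Odd (f.rootMultiplicity s)}

/-!
A symmetric inner extension `T` of `S` has a complex symmetric minimal realization `(A, B, Bᵀ,
D)`, of some size `N`, whose last `p` outputs realize `S`. Call an eigenvector `w` of `A`
invisible if these outputs vanish on it, and isotropic if `wᵀ w = 0`. Two facts give the theorem.

* If `w` is invisible and isotropic, then `T` can be divided on both sides by a Blaschke–Potapov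
  factor: `F T Fᵀ` is again a symmetric inner extension of `S`, and it has a realization on the
  same state space for which `w` is unobservable. So the degree drops
  (`RationalMatrix.IsSymmetricInnerExtension.exists_smaller`). This uses that the similarity
  between the realizations of `T⁻¹` and of `T^*` is complex orthogonal
  (`lossless_intertwiner_transpose_mul_self`).
* If there is no such `w`, then `N = n + κ` (`RationalMatrix.IsSymmetricInnerExtension.size_eq`).
  Indeed, by symmetry every state is then a sum of a reachable and an unobservable one, so the
  minimal state space of `S` is a quotient of that of `T`, and the characteristic polynomial of
  `A` is `q` times that of the state matrix of `S`. Here `q` has degree `N - n`, its roots lie in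
  the left half-plane, and they are simple, because two independent eigenvectors have an isotropic
  combination and because the bottom of a Jordan chain is isotropic. Write `f^*(s) = conj (f
  (-conj s))`. Then `T T^* = I` and `T₁₂ = T₂₁ᵀ` give `± det T · det (I - S S^*) = (det T₂₁)²`.
  The two determinants on the left are, up to constants, the quotient of the conjugated
  characteristic polynomial of `A` by that polynomial itself, and the characteristic polynomial
  `χ_H` of the Hamiltonian matrix divided by that of the state matrix of `S` and its conjugate. So
  `q^* q χ_H` is a constant times a square, and the roots of odd multiplicity of `χ_H` in the
  right half-plane are the mirror images of the roots of `q`.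

Hence a symmetric inner extension of least degree has degree `n + κ`. That one exists at all is
Darlington synthesis (`exists_isSymmetricInnerExtension`): `I - S S^*` is positive semidefinite on
the imaginary axis and its determinant is not identically zero, so it has a spectral factor
(`RationalMatrix.exists_eq_mul_conjTranspose`); complete it to a symmetric matrix that is unitary
on the axis, and remove its poles in the right half-plane by a scalar Blaschke product. The
maximum principle shows that the result is contractive there
(`isInner_of_mul_conjTranspose_eq_one`).

Throughout, `RatFunc ℂ` carries the involution `f ↦ f^*`, so that the conjugate transpose of a
rational matrix is its para-Hermitian conjugate, and unitarity on the imaginary axis is the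
identity `T * Tᴴ = 1` of rational matrices.
-/

set_option linter.unusedSectionVars false

/-! ### Para-Hermitian conjugation and values of rational functions -/

/-- The para-Hermitian conjugate of a polynomial, `p ↦ conj (p (-conj s))`. -/
noncomputable def polyParaConj : ℂ[X] →+* ℂ[X] :=
  Polynomial.eval₂RingHom (Polynomial.C.comp (starRingEnd ℂ)) (-Polynomial.X)

theorem polyParaConj_C (a : ℂ) : polyParaConj (Polynomial.C a) = Polynomial.C (star a) := by
  simp [polyParaConj]

theorem polyParaConj_X : polyParaConj Polynomial.X = -Polynomial.X := by
  simp [polyParaConj]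

theorem polyParaConj_polyParaConj (p : ℂ[X]) : polyParaConj (polyParaConj p) = p := by
  have h : polyParaConj.comp polyParaConj = RingHom.id _ := by
    apply Polynomial.ringHom_ext
    · intro a
      simp [polyParaConj_C]
    · simp [polyParaConj_X]
  exact congrArg (fun f : ℂ[X] →+* ℂ[X] => f p) h

theorem polyParaConj_injective : Function.Injective polyParaConj :=
  Function.LeftInverse.injective polyParaConj_polyParaConj

theorem polyParaConj_ne_zero {p : ℂ[X]} (hp : p ≠ 0) : polyParaConj p ≠ 0 := by
  rwa [Ne, map_eq_zero_iff _ polyParaConj_injective]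

theorem eval_polyParaConj (p : ℂ[X]) (s : ℂ) :
    (polyParaConj p).eval s = star (p.eval (-star s)) := by
  have h : (Polynomial.evalRingHom s).comp polyParaConj =
      (starRingEnd ℂ).comp (Polynomial.evalRingHom (-star s)) := by
    apply Polynomial.ringHom_ext
    · intro a
      simp [polyParaConj_C]
    · simp [polyParaConj_X]
  exact congrArg (fun f : ℂ[X] →+* ℂ => f p) h

/-- The para-Hermitian conjugate of a rational function, `f ↦ conj (f (-conj s))`. -/
noncomputable def ratParaConj : RatFunc ℂ →+* RatFunc ℂ :=
  RatFunc.liftRingHom ((algebraMap ℂ[X] (RatFunc ℂ)).comp polyParaConj) (by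
    intro p hp
    simp only [Submonoid.mem_comap, mem_nonZeroDivisors_iff_ne_zero] at hp ⊢
    simpa using polyParaConj_ne_zero hp)

theorem ratParaConj_algebraMap (p : ℂ[X]) :
    ratParaConj (algebraMap ℂ[X] (RatFunc ℂ) p) = algebraMap ℂ[X] (RatFunc ℂ) (polyParaConj p) := by
  simp [ratParaConj]

/-- The field of rational functions with the involution `f ↦ conj (f (-conj s))`. With it, the
conjugate transpose of a rational matrix `T` is `s ↦ T(-conj s)^*`, which agrees with the pointwise
conjugate transpose on the imaginary axis. -/
noncomputable instance instStarRingRatFunc : StarRing (RatFunc ℂ) where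
  star := ratParaConj
  star_involutive f := by
    have h : ratParaConj.comp ratParaConj = RingHom.id _ := by
      apply IsFractionRing.injective_comp_algebraMap (A := ℂ[X])
      refine RingHom.ext fun p => ?_
      simp only [RingHom.comp_apply, ratParaConj_algebraMap, polyParaConj_polyParaConj,
        RingHom.id_apply]
    exact congrArg (fun g : RatFunc ℂ →+* RatFunc ℂ => g f) h
  star_mul f g := by rw [mul_comm, map_mul]
  star_add := map_add _

theorem star_algebraMap (p : ℂ[X]) :
    star (algebraMap ℂ[X] (RatFunc ℂ) p) = algebraMap ℂ[X] (RatFunc ℂ) (polyParaConj p) :=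
  ratParaConj_algebraMap p

theorem star_ratFuncC (a : ℂ) : star (RatFunc.C a) = RatFunc.C (star a) := by
  rw [← RatFunc.algebraMap_C, star_algebraMap, polyParaConj_C, RatFunc.algebraMap_C]

theorem star_ratFuncX : star (RatFunc.X : RatFunc ℂ) = -RatFunc.X := by
  rw [← RatFunc.algebraMap_X, star_algebraMap, polyParaConj_X, map_neg]

/-- `f.HasValue s v`: the rational function `f` is regular at `s`, with value `v` there. -/
def RatFunc.HasValue (f : RatFunc ℂ) (s v : ℂ) : Prop :=
  ∃ p q : ℂ[X], q.eval s ≠ 0 ∧ f = algebraMap ℂ[X] (RatFunc ℂ) p / algebraMap ℂ[X] (RatFunc ℂ) q ∧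
    v = p.eval s / q.eval s

namespace RatFunc.HasValue

variable {f g : RatFunc ℂ} {s v w : ℂ}

theorem ne_zero_of_eval_ne {q : ℂ[X]} (hq : q.eval s ≠ 0) :
    algebraMap ℂ[X] (RatFunc ℂ) q ≠ 0 := by
  intro h
  rw [map_eq_zero_iff _ (RatFunc.algebraMap_injective ℂ)] at h
  simp [h] at hq

theorem algebraMap (p : ℂ[X]) : HasValue (algebraMap ℂ[X] (RatFunc ℂ) p) s (p.eval s) :=
  ⟨p, 1, by simp⟩

theorem const (a : ℂ) : HasValue (RatFunc.C a) s a := by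
  simpa using algebraMap (s := s) (Polynomial.C a)

theorem X : HasValue RatFunc.X s s := by
  simpa using algebraMap (s := s) Polynomial.X

theorem zero : HasValue 0 s 0 := by simpa using const (s := s) 0

theorem one : HasValue 1 s 1 := by simpa using const (s := s) 1

theorem add (hf : HasValue f s v) (hg : HasValue g s w) : HasValue (f + g) s (v + w) := by
  obtain ⟨p, q, hq, rfl, rfl⟩ := hf
  obtain ⟨p', q', hq', rfl, rfl⟩ := hg
  refine ⟨p * q' + q * p', q * q', by simp [hq, hq'], ?_, ?_⟩
  · have := ne_zero_of_eval_ne hq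
    have := ne_zero_of_eval_ne hq'
    simp only [map_add, map_mul]
    field_simp
  · simp only [Polynomial.eval_add, Polynomial.eval_mul]
    field_simp

theorem mul (hf : HasValue f s v) (hg : HasValue g s w) : HasValue (f * g) s (v * w) := by
  obtain ⟨p, q, hq, rfl, rfl⟩ := hf
  obtain ⟨p', q', hq', rfl, rfl⟩ := hg
  refine ⟨p * p', q * q', by simp [hq, hq'], ?_, ?_⟩
  · simp only [map_mul]
    rw [div_mul_div_comm]
  · simp only [Polynomial.eval_mul]
    rw [div_mul_div_comm]

theorem neg (hf : HasValue f s v) : HasValue (-f) s (-v) := by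
  simpa using (const (s := s) (-1)).mul hf

theorem sub (hf : HasValue f s v) (hg : HasValue g s w) : HasValue (f - g) s (v - w) := by
  simpa [sub_eq_add_neg] using hf.add hg.neg

theorem sum {ι : Type*} (t : Finset ι) {f : ι → RatFunc ℂ} {v : ι → ℂ}
    (h : ∀ i ∈ t, HasValue (f i) s (v i)) : HasValue (∑ i ∈ t, f i) s (∑ i ∈ t, v i) := by
  classical
  induction t using Finset.induction_on with
  | empty => simpa using zero
  | insert a t ha ih =>
    rw [Finset.sum_insert ha, Finset.sum_insert ha]
    exact (h a (by simp)).add (ih fun i hi => h i (by simp [hi]))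

theorem star (hf : HasValue f s v) : HasValue (star f) (-star s) (star v) := by
  obtain ⟨p, q, hq, rfl, rfl⟩ := hf
  refine ⟨polyParaConj p, polyParaConj q, ?_, ?_, ?_⟩
  · simpa [eval_polyParaConj] using hq
  · rw [star_div₀, star_algebraMap, star_algebraMap]
  · simp [eval_polyParaConj]

theorem eval_denom_ne_zero (hf : HasValue f s v) : f.denom.eval s ≠ 0 := by
  obtain ⟨p, q, hq, rfl, rfl⟩ := hf
  have hq0 : q ≠ 0 := by rintro rfl; simp at hq
  obtain ⟨c, hc⟩ := RatFunc.denom_div_dvd p q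
  intro h
  apply hq
  rw [hc, Polynomial.eval_mul, h, zero_mul]

theorem of_eval_denom_ne_zero (h : f.denom.eval s ≠ 0) :
    HasValue f s (f.eval (RingHom.id ℂ) s) :=
  ⟨f.num, f.denom, h, (RatFunc.num_div_denom f).symm, by
    simp [RatFunc.eval, Polynomial.eval₂_id]⟩

theorem unique (hf : HasValue f s v) (hf' : HasValue f s w) : v = w := by
  have h := hf.sub hf'
  rw [sub_self] at h
  obtain ⟨p, q, hq, h0, h1⟩ := h
  have hp : p = 0 := by
    have := ne_zero_of_eval_ne hq
    rw [eq_comm, div_eq_zero_iff, or_iff_left this,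
      map_eq_zero_iff _ (RatFunc.algebraMap_injective ℂ)] at h0
    exact h0
  rw [hp] at h1
  simpa [sub_eq_zero] using h1

theorem eval_eq (hf : HasValue f s v) : f.eval (RingHom.id ℂ) s = v :=
  (of_eval_denom_ne_zero hf.eval_denom_ne_zero).unique hf

end RatFunc.HasValue

theorem RatFunc.finite_not_hasValue (f : RatFunc ℂ) :
    {s : ℂ | ¬ f.HasValue s (f.eval (RingHom.id ℂ) s)}.Finite := by
  refine (Polynomial.finite_setOfPred_isRoot (RatFunc.denom_ne_zero f)).subset fun s hs => ?_
  by_contra h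
  exact hs (RatFunc.HasValue.of_eval_denom_ne_zero h)

theorem RatFunc.eq_zero_of_infinite {f : RatFunc ℂ} {Z : Set ℂ} (hZ : Z.Infinite)
    (h : ∀ s ∈ Z, f.HasValue s 0) : f = 0 := by
  rw [← RatFunc.num_eq_zero_iff]
  refine Polynomial.eq_zero_of_infinite_isRoot _ (hZ.mono fun s hs => ?_)
  have h1 := (h s hs).eval_eq
  have h2 := (h s hs).eval_denom_ne_zero
  simp only [RatFunc.eval, Polynomial.eval₂_id, div_eq_zero_iff] at h1
  exact h1.resolve_right h2

namespace RationalMatrix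

/-- `M.HasValue s V`: the rational matrix `M` is regular at `s`, with value `V` there. -/
def HasValue {m k : Type*} (M : RationalMatrix m k) (s : ℂ) (V : Matrix m k ℂ) : Prop :=
  ∀ i j, (M i j).HasValue s (V i j)

namespace HasValue

variable {m k l : Type*} {M M' : RationalMatrix m k} {N : RationalMatrix k l}
  {V V' : Matrix m k ℂ} {W : Matrix k l ℂ} {s : ℂ}

theorem const (V : Matrix m k ℂ) (s : ℂ) : HasValue (V.map RatFunc.C) s V :=
  fun _ _ => RatFunc.HasValue.const _

theorem one [DecidableEq m] : HasValue (1 : RationalMatrix m m) s 1 := by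
  intro i j
  rcases eq_or_ne i j with rfl | h
  · simpa using RatFunc.HasValue.one
  · simpa [h] using RatFunc.HasValue.zero

theorem add (h : M.HasValue s V) (h' : M'.HasValue s V') : HasValue (M + M') s (V + V') :=
  fun i j => (h i j).add (h' i j)

theorem sub (h : M.HasValue s V) (h' : M'.HasValue s V') : HasValue (M - M') s (V - V') :=
  fun i j => (h i j).sub (h' i j)

theorem mul [Fintype k] (h : M.HasValue s V) (h' : N.HasValue s W) :
    HasValue (M * N) s (V * W) :=
  fun i j => RatFunc.HasValue.sum _ fun r _ => (h i r).mul (h' r j)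

theorem conjTranspose (h : M.HasValue s V) : HasValue M.conjTranspose (-star s) V.conjTranspose :=
  fun i j => (h j i).star

theorem unique (h : M.HasValue s V) (h' : M.HasValue s V') : V = V' := by
  ext i j
  exact (h i j).unique (h' i j)

theorem eval_eq (h : M.HasValue s V) : M.eval s = V := by
  ext i j
  exact (h i j).eval_eq

theorem not_isPole (h : M.HasValue s V) : ¬ M.IsPole s := by
  rintro ⟨i, j, hij⟩
  exact (h i j).eval_denom_ne_zero hij

end HasValue

theorem hasValue_eval {m k : Type*} {M : RationalMatrix m k} {s : ℂ} (h : ¬ M.IsPole s) :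
    M.HasValue s (M.eval s) := by
  intro i j
  apply RatFunc.HasValue.of_eval_denom_ne_zero
  intro h0
  exact h ⟨i, j, h0⟩

theorem finite_isPole {m k : Type*} [Finite m] [Finite k] (M : RationalMatrix m k) :
    {s | M.IsPole s}.Finite := by
  have : {s | M.IsPole s} = ⋃ i, ⋃ j, {s | (M i j).denom.IsRoot s} := by
    ext s
    simp [IsPole]
  rw [this]
  exact Set.finite_iUnion fun i => Set.finite_iUnion fun j =>
    Polynomial.finite_setOfPred_isRoot (RatFunc.denom_ne_zero _)

theorem eq_of_infinite {m k : Type*} {M N : RationalMatrix m k} {Z : Set ℂ} (hZ : Z.Infinite)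
    (h : ∀ s ∈ Z, ∃ V, M.HasValue s V ∧ N.HasValue s V) : M = N := by
  ext i j
  rw [← sub_eq_zero]
  refine RatFunc.eq_zero_of_infinite hZ fun s hs => ?_
  obtain ⟨V, h1, h2⟩ := h s hs
  simpa using (h1 i j).sub (h2 i j)

end RationalMatrix

/-! ### State spaces: resolvents, free responses, and intertwining -/

section StateSpace

open Matrix

variable {ι ι' m k : Type*} [Fintype ι] [DecidableEq ι] [Fintype ι'] [DecidableEq ι']

/-- The pencil `s I - A` as a matrix over the field of rational functions. -/
noncomputable def pencil (A : Matrix ι ι ℂ) : Matrix ι ι (RatFunc ℂ) :=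
  Matrix.scalar ι RatFunc.X - A.map RatFunc.C

/-- The resolvent `(s I - A)⁻¹` as a matrix of rational functions. -/
noncomputable def ratResolvent (A : Matrix ι ι ℂ) : Matrix ι ι (RatFunc ℂ) := (pencil A)⁻¹

/-- The transfer function `C (s I - A)⁻¹ B + D`, for a state space indexed by any finite type. -/
noncomputable def transferFunction (A : Matrix ι ι ℂ) (B : Matrix ι k ℂ) (C : Matrix m ι ℂ)
    (D : Matrix m k ℂ) : RationalMatrix m k :=
  C.map RatFunc.C * ratResolvent A * B.map RatFunc.C + D.map RatFunc.C

theorem pencil_eq_map_charmatrix (A : Matrix ι ι ℂ) :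
    pencil A = (algebraMap ℂ[X] (RatFunc ℂ)).mapMatrix (charmatrix A) := by
  ext i j
  rcases eq_or_ne i j with rfl | h
  · simp [pencil]
  · simp [pencil, charmatrix_apply_ne _ _ _ h, Matrix.diagonal_apply_ne _ h]

theorem det_pencil (A : Matrix ι ι ℂ) :
    (pencil A).det = algebraMap ℂ[X] (RatFunc ℂ) A.charpoly := by
  rw [pencil_eq_map_charmatrix, ← RingHom.map_det, Matrix.charpoly]

theorem isUnit_det_pencil (A : Matrix ι ι ℂ) : IsUnit (pencil A).det := by
  rw [det_pencil, isUnit_iff_ne_zero, Ne, map_eq_zero_iff _ (RatFunc.algebraMap_injective ℂ)]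
  exact (charpoly_monic A).ne_zero

theorem pencil_mul_ratResolvent (A : Matrix ι ι ℂ) : pencil A * ratResolvent A = 1 :=
  mul_nonsing_inv _ (isUnit_det_pencil A)

theorem ratResolvent_mul_pencil (A : Matrix ι ι ℂ) : ratResolvent A * pencil A = 1 :=
  nonsing_inv_mul _ (isUnit_det_pencil A)

theorem map_mul_ratResolvent {A : Matrix ι ι ℂ} {A' : Matrix ι' ι' ℂ} {M : Matrix ι' ι ℂ}
    (h : M * A = A' * M) :
    M.map RatFunc.C * ratResolvent A = ratResolvent A' * M.map RatFunc.C := by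
  have h1 : pencil A' * M.map RatFunc.C = M.map RatFunc.C * pencil A := by
    rw [pencil, pencil, Matrix.sub_mul, Matrix.mul_sub, ← Matrix.map_mul, ← Matrix.map_mul, h]
    congr 1
    ext i j
    simp [Matrix.scalar_apply, mul_comm]
  calc M.map RatFunc.C * ratResolvent A
      = ratResolvent A' * (pencil A' * M.map RatFunc.C) * ratResolvent A := by
        rw [← Matrix.mul_assoc, ratResolvent_mul_pencil, Matrix.one_mul]
    _ = ratResolvent A' * M.map RatFunc.C := by
        rw [h1, Matrix.mul_assoc, Matrix.mul_assoc, pencil_mul_ratResolvent, Matrix.mul_one]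

/-- The formal resolvent takes the values of the resolvent away from the spectrum. -/
theorem hasValue_ratResolvent {A : Matrix ι ι ℂ} {s : ℂ} (hs : A.charpoly.eval s ≠ 0) :
    RationalMatrix.HasValue (ratResolvent A) s (Matrix.scalar ι s - A)⁻¹ := by
  intro i j
  have h1 : ratResolvent A i j = algebraMap ℂ[X] (RatFunc ℂ) (adjugate (charmatrix A) i j) /
      algebraMap ℂ[X] (RatFunc ℂ) A.charpoly := by
    rw [ratResolvent, Matrix.inv_def, det_pencil, pencil_eq_map_charmatrix,
      ← RingHom.map_adjugate]
    simp [div_eq_mul_inv, mul_comm]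
  have h2 : (Matrix.scalar ι s - A) = (Polynomial.evalRingHom s).mapMatrix (charmatrix A) := by
    ext i j
    rcases eq_or_ne i j with rfl | h
    · simp
    · simp [charmatrix_apply_ne _ _ _ h, Matrix.diagonal_apply_ne _ h]
  refine ⟨_, _, hs, h1, ?_⟩
  rw [Matrix.inv_def, h2, ← RingHom.map_det, ← RingHom.map_adjugate]
  simp [div_eq_mul_inv, mul_comm, Matrix.charpoly]

theorem hasValue_transferFunction [Fintype k] {A : Matrix ι ι ℂ} {s : ℂ}
    (hs : A.charpoly.eval s ≠ 0) (B : Matrix ι k ℂ) (C : Matrix m ι ℂ) (D : Matrix m k ℂ) :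
    (transferFunction A B C D).HasValue s (C * (Matrix.scalar ι s - A)⁻¹ * B + D) :=
  (((RationalMatrix.HasValue.const C s).mul (hasValue_ratResolvent hs)).mul
    (RationalMatrix.HasValue.const B s)).add (RationalMatrix.HasValue.const D s)

theorem tendsto_resolvent_cocompact (A : Matrix ι ι ℂ) :
    Tendsto (fun s : ℂ => (Matrix.scalar ι s - A)⁻¹) (cocompact ℂ) (𝓝 0) := by
  let := Matrix.linftyOpNormedRing (n := ι) (α := ℂ)
  let := Matrix.linftyOpNormedAlgebra (n := ι) (R := ℂ) (α := ℂ)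
  have h := spectrum.resolvent_tendsto_cobounded (𝕜 := ℂ) A
  rw [Metric.cobounded_eq_cocompact] at h
  refine h.congr fun s => ?_
  rw [resolvent, Matrix.nonsing_inv_eq_ringInverse]
  rfl

theorem eventually_charpoly_eval_ne_zero (A : Matrix ι ι ℂ) :
    ∀ᶠ s in cocompact ℂ, A.charpoly.eval s ≠ 0 := by
  have h := (Polynomial.finite_setOfPred_isRoot (charpoly_monic A).ne_zero).isCompact
  filter_upwards [h.compl_mem_cocompact] with s hs h0
  exact hs h0

theorem tendsto_eval_transferFunction [Fintype k] (A : Matrix ι ι ℂ) (B : Matrix ι k ℂ)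
    (C : Matrix m ι ℂ) (D : Matrix m k ℂ) :
    Tendsto (transferFunction A B C D).eval (cocompact ℂ) (𝓝 D) := by
  have h1 : Tendsto (fun s : ℂ => C * (Matrix.scalar ι s - A)⁻¹ * B + D) (cocompact ℂ)
      (𝓝 (C * (0 : Matrix ι ι ℂ) * B + D)) := by
    have hc : Continuous fun M : Matrix ι ι ℂ => C * M * B + D := by fun_prop
    exact (hc.tendsto 0).comp (tendsto_resolvent_cocompact A)
  rw [Matrix.mul_zero, Matrix.zero_mul, zero_add] at h1
  refine h1.congr' ?_
  filter_upwards [eventually_charpoly_eval_ne_zero A] with s hs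
  exact (hasValue_transferFunction hs B C D).eval_eq.symm

/-- The response `C (s I - A)⁻¹ x` to the initial state `x`. -/
noncomputable def freeResponse (A : Matrix ι ι ℂ) (C : Matrix m ι ℂ) :
    (ι → ℂ) →ₗ[ℂ] (m → RatFunc ℂ) where
  toFun x := (C.map RatFunc.C * ratResolvent A) *ᵥ (RatFunc.C ∘ x)
  map_add' x y := by
    rw [← Matrix.mulVec_add]
    congr 1
    ext i
    simp
  map_smul' a x := by
    rw [RingHom.id_apply, ← Matrix.mulVec_smul]
    congr 1
    ext i
    simp [RatFunc.smul_eq_C_mul]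

theorem freeResponse_apply (A : Matrix ι ι ℂ) (C : Matrix m ι ℂ) (x : ι → ℂ) :
    freeResponse A C x = (C.map RatFunc.C * ratResolvent A) *ᵥ (RatFunc.C ∘ x) := rfl

theorem map_mulVec_ratFuncC {l : Type*} [Fintype l] (M : Matrix m l ℂ) (x : l → ℂ) :
    M.map RatFunc.C *ᵥ (RatFunc.C ∘ x) = RatFunc.C ∘ (M *ᵥ x) := by
  ext i
  simp [Matrix.mulVec, dotProduct]

theorem ratResolvent_mul_map (A : Matrix ι ι ℂ) :
    ratResolvent A * A.map RatFunc.C = (RatFunc.X : RatFunc ℂ) • ratResolvent A - 1 := by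
  have h := ratResolvent_mul_pencil A
  rw [pencil, Matrix.mul_sub] at h
  rw [← h]
  have : ratResolvent A * (Matrix.scalar ι) (RatFunc.X : RatFunc ℂ)
      = (RatFunc.X : RatFunc ℂ) • ratResolvent A := by
    ext i j
    simp [Matrix.scalar_apply, mul_comm]
  rw [this]
  abel

/-- The free response of the shifted state `A x`: multiply by `s` and drop the constant term. -/
theorem freeResponse_mulVec (A : Matrix ι ι ℂ) (C : Matrix m ι ℂ) (x : ι → ℂ) :
    freeResponse A C (A *ᵥ x) =
      (RatFunc.X : RatFunc ℂ) • freeResponse A C x - RatFunc.C ∘ (C *ᵥ x) := by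
  rw [freeResponse_apply, freeResponse_apply, ← map_mulVec_ratFuncC, Matrix.mulVec_mulVec,
    Matrix.mul_assoc, ratResolvent_mul_map, Matrix.mul_sub, Matrix.sub_mulVec, Matrix.mul_one,
    map_mulVec_ratFuncC, Matrix.mul_smul, Matrix.smul_mulVec]

theorem freeResponse_eq_transferFunction (A : Matrix ι ι ℂ) (C : Matrix m ι ℂ) (x : ι → ℂ)
    (i : m) :
    freeResponse A C x i = transferFunction A (Matrix.of fun i (_ : Unit) => x i) C 0 i () := by
  rw [transferFunction, freeResponse_apply]
  simp [Matrix.mulVec, dotProduct, Matrix.mul_apply]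

/-- Strict properness: a free response determines the initial output. -/
theorem mulVec_eq_of_freeResponse_eq {A : Matrix ι ι ℂ} {A' : Matrix ι' ι' ℂ}
    {C : Matrix m ι ℂ} {C' : Matrix m ι' ℂ} {x : ι → ℂ} {x' : ι' → ℂ}
    (h : freeResponse A C x = freeResponse A' C' x') : C *ᵥ x = C' *ᵥ x' := by
  ext i
  -- `C x = s R x - R (A x)` for the free response `R`, where `R (A x)` vanishes at infinity
  have h1 := congrFun (freeResponse_mulVec A C x) i
  have h2 := congrFun (freeResponse_mulVec A' C' x') i
  rw [h] at h1
  simp only [Pi.sub_apply, Function.comp_apply] at h1 h2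
  rw [freeResponse_eq_transferFunction] at h1 h2
  set T := transferFunction A (Matrix.of fun i (_ : Unit) => (A *ᵥ x) i) C 0 with hT
  set T' := transferFunction A' (Matrix.of fun i (_ : Unit) => (A' *ᵥ x') i) C' 0 with hT'
  have h3 : RatFunc.C ((C *ᵥ x) i) - RatFunc.C ((C' *ᵥ x') i) = T' i () - T i () := by
    rw [h1, h2]; ring
  have ht : Tendsto (fun s => T'.eval s i () - T.eval s i ()) (cocompact ℂ) (𝓝 0) := by
    have e1 := tendsto_eval_transferFunction A (Matrix.of fun i (_ : Unit) => (A *ᵥ x) i) C 0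
    have e2 := tendsto_eval_transferFunction A' (Matrix.of fun i (_ : Unit) => (A' *ᵥ x') i) C' 0
    have e1 := tendsto_pi_nhds.1 (tendsto_pi_nhds.1 e1 i) ()
    have e2 := tendsto_pi_nhds.1 (tendsto_pi_nhds.1 e2 i) ()
    simpa using e2.sub e1
  have hc : Tendsto (fun _ : ℂ => (C *ᵥ x) i - (C' *ᵥ x') i) (cocompact ℂ) (𝓝 0) := by
    refine ht.congr' ?_
    filter_upwards [eventually_charpoly_eval_ne_zero A, eventually_charpoly_eval_ne_zero A']
      with s hs hs'
    have v1 := hasValue_transferFunction hs (Matrix.of fun i (_ : Unit) => (A *ᵥ x) i) C 0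
    have v2 := hasValue_transferFunction hs' (Matrix.of fun i (_ : Unit) => (A' *ᵥ x') i) C' 0
    have v3 := (v2 i ()).sub (v1 i ())
    rw [← v1.eval_eq, ← v2.eval_eq, ← hT, ← hT', ← h3] at v3
    exact v3.unique ((RatFunc.HasValue.const _).sub (RatFunc.HasValue.const _))
  exact sub_eq_zero.1 (tendsto_nhds_unique tendsto_const_nhds hc)

/-- Observability of `(A, C)`, in the form of the Popov–Belevitch–Hautus criterion: no eigenvector
of `A` is in the kernel of `C`. -/
def IsObservable (A : Matrix ι ι ℂ) (C : Matrix m ι ℂ) : Prop :=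
  ∀ (μ : ℂ) (w : ι → ℂ), A *ᵥ w = μ • w → C *ᵥ w = 0 → w = 0

/-- Reachability of `(A, B)`: observability of the transposed pair. -/
def IsReachable (A : Matrix ι ι ℂ) (B : Matrix ι k ℂ) : Prop := IsObservable Aᵀ Bᵀ

/-- A nonzero invariant subspace contains an eigenvector. -/
theorem exists_eigenvector_mem {A : Matrix ι ι ℂ} {V : Submodule ℂ (ι → ℂ)}
    (hA : ∀ x ∈ V, A *ᵥ x ∈ V) (hV : V ≠ ⊥) : ∃ (μ : ℂ) (w : ι → ℂ), w ∈ V ∧ w ≠ 0 ∧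
      A *ᵥ w = μ • w := by
  have : Nontrivial V := (Submodule.nontrivial_iff_ne_bot).2 hV
  let f : Module.End ℂ V := (Matrix.mulVecLin A).restrict hA
  obtain ⟨μ, hμ⟩ := Module.End.exists_eigenvalue f
  obtain ⟨w, hw⟩ := hμ.exists_hasEigenvector
  refine ⟨μ, w, w.2, fun h => hw.2 (Subtype.ext h), ?_⟩
  exact congrArg Subtype.val hw.apply_eq_smul

theorem IsObservable.eq_bot {A : Matrix ι ι ℂ} {C : Matrix m ι ℂ} (h : IsObservable A C)
    {V : Submodule ℂ (ι → ℂ)} (hA : ∀ x ∈ V, A *ᵥ x ∈ V) (hC : ∀ x ∈ V, C *ᵥ x = 0) : V = ⊥ := by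
  by_contra hV
  obtain ⟨μ, w, hw, hw0, hμ⟩ := exists_eigenvector_mem hA hV
  exact hw0 (h μ w hμ (hC w hw))

/-- A proper subspace that is invariant under `A` is annihilated by a left eigenvector of `A`. -/
theorem exists_left_eigenvector {A : Matrix ι ι ℂ} {V : Submodule ℂ (ι → ℂ)}
    (hA : ∀ x ∈ V, A *ᵥ x ∈ V) (hV : V ≠ ⊤) : ∃ (μ : ℂ) (y : ι → ℂ), y ≠ 0 ∧
      Aᵀ *ᵥ y = μ • y ∧ ∀ x ∈ V, y ⬝ᵥ x = 0 := by
  let V' : Submodule ℂ (ι → ℂ) :=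
    { carrier := {y | ∀ x ∈ V, y ⬝ᵥ x = 0}
      add_mem' := fun {a b} ha hb x hx => by rw [add_dotProduct, ha x hx, hb x hx, add_zero]
      zero_mem' := fun x _ => zero_dotProduct x
      smul_mem' := fun c y hy x hx => by rw [smul_dotProduct, hy x hx, smul_zero] }
  have h1 : ∀ y ∈ V', Aᵀ *ᵥ y ∈ V' := by
    intro y hy x hx
    rw [Matrix.mulVec_transpose, ← Matrix.dotProduct_mulVec]
    exact hy _ (hA x hx)
  have h2 : V' ≠ ⊥ := by
    obtain ⟨f, hf, hfV⟩ := Submodule.exists_le_ker_of_lt_top V (lt_top_iff_ne_top.2 hV)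
    have hfx : ∀ x, f x = (fun i => f (Pi.single i 1)) ⬝ᵥ x := by
      intro x
      conv_lhs => rw [pi_eq_sum_univ' x, map_sum]
      simp [dotProduct, mul_comm]
    intro h
    have h3 : (fun i => f (Pi.single i 1)) ∈ V' := by
      intro x hx
      rw [← hfx]
      exact hfV hx
    rw [h, Submodule.mem_bot] at h3
    apply hf
    refine LinearMap.ext fun x => ?_
    rw [hfx, h3, zero_dotProduct, LinearMap.zero_apply]
  obtain ⟨μ, y, hy, hy0, hμ⟩ := exists_eigenvector_mem h1 h2
  exact ⟨μ, y, hy0, hμ, hy⟩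

theorem IsReachable.eq_top {A : Matrix ι ι ℂ} {B : Matrix ι k ℂ} [Fintype k]
    (h : IsReachable A B) {V : Submodule ℂ (ι → ℂ)} (hA : ∀ x ∈ V, A *ᵥ x ∈ V)
    (hB : ∀ u, B *ᵥ u ∈ V) : V = ⊤ := by
  by_contra hV
  obtain ⟨μ, y, hy0, hμ, hy⟩ := exists_left_eigenvector hA hV
  refine hy0 (h μ y hμ ?_)
  rw [Matrix.mulVec_transpose]
  refine dotProduct_eq _ _ fun u => ?_
  rw [← Matrix.dotProduct_mulVec, hy _ (hB u), zero_dotProduct]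

theorem IsObservable.freeResponse_injective {A : Matrix ι ι ℂ} {C : Matrix m ι ℂ}
    (h : IsObservable A C) : Function.Injective (freeResponse A C) := by
  have h0 : ∀ x, freeResponse A C x = 0 → C *ᵥ x = 0 := by
    intro x hx
    have := mulVec_eq_of_freeResponse_eq (A := A) (A' := A) (C := C) (C' := C) (x := x) (x' := 0)
      (by rw [hx, map_zero])
    rwa [Matrix.mulVec_zero] at this
  rw [← LinearMap.ker_eq_bot]
  refine h.eq_bot (fun x hx => ?_) fun x hx => h0 x hx
  rw [LinearMap.mem_ker] at hx ⊢
  rw [freeResponse_mulVec, hx, h0 x hx]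
  ext i
  simp

theorem freeResponse_mulVec_input [Fintype k] (A : Matrix ι ι ℂ) (B : Matrix ι k ℂ)
    (C : Matrix m ι ℂ) (u : k → ℂ) :
    freeResponse A C (B *ᵥ u) =
      (C.map RatFunc.C * ratResolvent A * B.map RatFunc.C) *ᵥ (RatFunc.C ∘ u) := by
  rw [freeResponse_apply, ← map_mulVec_ratFuncC, Matrix.mulVec_mulVec]

/-- Two state spaces with the same transfer function are intertwined as soon as the second one is
observable and the first one is spanned by its reachable and its unobservable states. -/
theorem exists_intertwiner [Fintype k] {A : Matrix ι ι ℂ} {B : Matrix ι k ℂ} {C : Matrix m ι ℂ}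
    {A' : Matrix ι' ι' ℂ} {B' : Matrix ι' k ℂ} {C' : Matrix m ι' ℂ}
    (hT : C.map RatFunc.C * ratResolvent A * B.map RatFunc.C =
      C'.map RatFunc.C * ratResolvent A' * B'.map RatFunc.C)
    (hobs : IsObservable A' C')
    (hreach : ∀ V : Submodule ℂ (ι → ℂ), (∀ x ∈ V, A *ᵥ x ∈ V) → (∀ u, B *ᵥ u ∈ V) →
      (∀ x, freeResponse A C x = 0 → x ∈ V) → V = ⊤) :
    ∃ M : Matrix ι' ι ℂ, M * A = A' * M ∧ M * B = B' ∧ C' * M = C ∧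
      ∀ x, M *ᵥ x = 0 ↔ freeResponse A C x = 0 := by
  have hinj := hobs.freeResponse_injective
  have hBB : ∀ u, freeResponse A' C' (B' *ᵥ u) = freeResponse A C (B *ᵥ u) := by
    intro u
    rw [freeResponse_mulVec_input, freeResponse_mulVec_input, hT]
  -- the states of the first system whose free response is one of the second system
  have hdom : (LinearMap.range (freeResponse A' C')).comap (freeResponse A C) = ⊤ := by
    apply hreach
    · rintro x ⟨x', hx'⟩
      refine ⟨A' *ᵥ x', ?_⟩
      rw [freeResponse_mulVec, freeResponse_mulVec, hx', mulVec_eq_of_freeResponse_eq hx']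
    · intro u
      exact ⟨B' *ᵥ u, hBB u⟩
    · intro x hx
      exact ⟨0, by rw [map_zero, hx]⟩
  have hmem : ∀ x, freeResponse A C x ∈ LinearMap.range (freeResponse A' C') := by
    intro x
    have : x ∈ (LinearMap.range (freeResponse A' C')).comap (freeResponse A C) := by
      rw [hdom]; trivial
    exact this
  let f : (ι → ℂ) →ₗ[ℂ] (ι' → ℂ) :=
    (LinearEquiv.ofInjective (freeResponse A' C') hinj).symm.toLinearMap ∘ₗ
      (freeResponse A C).codRestrict _ hmem
  have hf : ∀ x, freeResponse A' C' (f x) = freeResponse A C x := by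
    intro x
    have := LinearEquiv.apply_symm_apply (LinearEquiv.ofInjective (freeResponse A' C') hinj)
      ((freeResponse A C).codRestrict _ hmem x)
    exact congrArg Subtype.val this
  have hM : ∀ x, LinearMap.toMatrix' f *ᵥ x = f x := fun x => LinearMap.toMatrix'_mulVec f x
  refine ⟨LinearMap.toMatrix' f, ?_, ?_, ?_, ?_⟩
  · refine Matrix.ext_of_mulVec_single fun i => ?_
    rw [← Matrix.mulVec_mulVec, ← Matrix.mulVec_mulVec, hM, hM]
    apply hinj
    rw [hf, freeResponse_mulVec, freeResponse_mulVec, hf, mulVec_eq_of_freeResponse_eq (hf _)]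
  · classical
    refine Matrix.ext_of_mulVec_single fun i => ?_
    rw [← Matrix.mulVec_mulVec, hM]
    apply hinj
    rw [hf, hBB]
  · refine Matrix.ext_of_mulVec_single fun i => ?_
    rw [← Matrix.mulVec_mulVec, hM, mulVec_eq_of_freeResponse_eq (hf _)]
  · intro x
    rw [hM, ← hf, map_eq_zero_iff _ hinj]

/-- An intertwiner of a reachable system is determined by its action on the input matrix. -/
theorem eq_of_intertwine [Fintype k] {A : Matrix ι ι ℂ} {B : Matrix ι k ℂ}
    {A' : Matrix ι' ι' ℂ} {B' : Matrix ι' k ℂ} (hreach : IsReachable A B) {M N : Matrix ι' ι ℂ}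
    (hMA : M * A = A' * M) (hMB : M * B = B') (hNA : N * A = A' * N) (hNB : N * B = B') :
    M = N := by
  have h : LinearMap.ker (M - N).mulVecLin = ⊤ := by
    apply hreach.eq_top
    · intro x hx
      rw [LinearMap.mem_ker, Matrix.mulVecLin_apply] at hx ⊢
      rw [Matrix.mulVec_mulVec, Matrix.sub_mul, hMA, hNA, ← Matrix.mul_sub,
        ← Matrix.mulVec_mulVec, hx, Matrix.mulVec_zero]
    · intro u
      rw [LinearMap.mem_ker, Matrix.mulVecLin_apply, Matrix.mulVec_mulVec, Matrix.sub_mul, hMB,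
        hNB, sub_self, Matrix.zero_mulVec]
  rw [← sub_eq_zero]
  refine Matrix.ext_of_mulVec_single fun i => ?_
  have : Pi.single i 1 ∈ LinearMap.ker (M - N).mulVecLin := by rw [h]; trivial
  rw [Matrix.zero_mulVec]
  exact this

/-- The state space isomorphism theorem, for state spaces of the same size. -/
theorem exists_isUnit_intertwiner [Fintype k] {A : Matrix ι ι ℂ} {B : Matrix ι k ℂ}
    {C : Matrix m ι ℂ} {A' : Matrix ι ι ℂ} {B' : Matrix ι k ℂ} {C' : Matrix m ι ℂ}
    (hT : C.map RatFunc.C * ratResolvent A * B.map RatFunc.C =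
      C'.map RatFunc.C * ratResolvent A' * B'.map RatFunc.C)
    (hobs : IsObservable A C) (hreach : IsReachable A B) (hobs' : IsObservable A' C') :
    ∃ M : Matrix ι ι ℂ, IsUnit M.det ∧ M * A = A' * M ∧ M * B = B' ∧ C' * M = C := by
  obtain ⟨M, h1, h2, h3, h4⟩ := exists_intertwiner hT hobs' fun V hA hB _ => hreach.eq_top hA hB
  refine ⟨M, ?_, h1, h2, h3⟩
  rw [← Matrix.isUnit_iff_isUnit_det, ← Matrix.mulVec_injective_iff_isUnit]
  refine (injective_iff_map_eq_zero M.mulVecLin).2 fun x hx => ?_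
  have := (h4 x).1 hx
  exact (map_eq_zero_iff _ hobs.freeResponse_injective).1 this

end StateSpace

/-! ### Inverses, determinants, and minimal and symmetric realizations -/

section Realizations

open Matrix

variable {ι m k : Type*} [Fintype ι] [DecidableEq ι]

theorem charpoly_eq_of_intertwine {A A' M : Matrix ι ι ℂ} (hM : IsUnit M.det)
    (h : M * A = A' * M) : A.charpoly = A'.charpoly := by
  have hM' : IsUnit M := (Matrix.isUnit_iff_isUnit_det M).2 hM
  obtain ⟨u, rfl⟩ := hM'
  rw [← Matrix.charpoly_units_conj u A, h, Matrix.mul_assoc, Matrix.mul_nonsing_inv _ hM,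
    Matrix.mul_one]

theorem pencil_transpose (A : Matrix ι ι ℂ) : (pencil A)ᵀ = pencil Aᵀ := by
  simp [pencil, Matrix.transpose_sub, Matrix.transpose_map]

theorem ratResolvent_transpose (A : Matrix ι ι ℂ) : (ratResolvent A)ᵀ = ratResolvent Aᵀ := by
  rw [ratResolvent, ratResolvent, Matrix.transpose_nonsing_inv, pencil_transpose]

theorem transferFunction_transpose [Fintype m] [Fintype k] (A : Matrix ι ι ℂ) (B : Matrix ι k ℂ)
    (C : Matrix m ι ℂ) (D : Matrix m k ℂ) :
    (transferFunction A B C D)ᵀ = transferFunction Aᵀ Cᵀ Bᵀ Dᵀ := by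
  simp only [transferFunction, Matrix.transpose_add, Matrix.transpose_mul, ratResolvent_transpose,
    Matrix.transpose_map, Matrix.mul_assoc]

theorem conjTranspose_map_ratFuncC (M : Matrix m k ℂ) :
    (M.map RatFunc.C)ᴴ = Mᴴ.map RatFunc.C := by
  ext i j
  simp [star_ratFuncC]

theorem pencil_conjTranspose (A : Matrix ι ι ℂ) : (pencil A)ᴴ = -pencil (-Aᴴ) := by
  ext i j
  rcases eq_or_ne i j with rfl | h
  · simp [pencil, star_ratFuncC, star_ratFuncX, sub_eq_add_neg, add_comm]
  · simp [pencil, star_ratFuncC, Matrix.diagonal_apply_ne _ h, Matrix.diagonal_apply_ne _ h.symm]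

theorem ratResolvent_conjTranspose (A : Matrix ι ι ℂ) :
    (ratResolvent A)ᴴ = -ratResolvent (-Aᴴ) := by
  have h : (-ratResolvent (-Aᴴ)) * (pencil A)ᴴ = 1 := by
    rw [pencil_conjTranspose, neg_mul_neg, ratResolvent_mul_pencil]
  rw [ratResolvent, Matrix.conjTranspose_nonsing_inv]
  exact Matrix.inv_eq_left_inv h

theorem transferFunction_conjTranspose [Fintype m] [Fintype k] (A : Matrix ι ι ℂ)
    (B : Matrix ι k ℂ) (C : Matrix m ι ℂ) (D : Matrix m k ℂ) :
    (transferFunction A B C D)ᴴ = transferFunction (-Aᴴ) Cᴴ (-Bᴴ) Dᴴ := by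
  simp only [transferFunction, Matrix.conjTranspose_add, Matrix.conjTranspose_mul,
    ratResolvent_conjTranspose, conjTranspose_map_ratFuncC, Matrix.mul_assoc]
  congr 1
  rw [Matrix.map_neg _ (map_neg _), Matrix.neg_mul, Matrix.neg_mul, Matrix.mul_neg]

theorem pencil_sub (A E : Matrix ι ι ℂ) : pencil (A - E) = pencil A + E.map RatFunc.C := by
  rw [pencil, pencil, Matrix.map_sub _ (map_sub _)]
  abel

theorem map_ratFuncC_mul_eq_one [Fintype m] [DecidableEq m] {D E : Matrix m m ℂ} (h : D * E = 1) :
    D.map RatFunc.C * E.map RatFunc.C = 1 := by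
  rw [← Matrix.map_mul, h, Matrix.map_one _ (map_zero _) (map_one _)]

/-- The inverse of a transfer function whose value at infinity is invertible. -/
theorem transferFunction_mul_inverse [Fintype m] [DecidableEq m] (A : Matrix ι ι ℂ)
    (B : Matrix ι m ℂ) (C : Matrix m ι ℂ) {D E : Matrix m m ℂ} (h : D * E = 1) :
    transferFunction A B C D * transferFunction (A - B * E * C) (B * E) (-(E * C)) E = 1 := by
  have hd := map_ratFuncC_mul_eq_one h
  -- the second resolvent identity
  have hr : ratResolvent A * (B * E * C).map RatFunc.C * ratResolvent (A - B * E * C) =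
      ratResolvent A - ratResolvent (A - B * E * C) := by
    have h1 : (B * E * C).map RatFunc.C = pencil (A - B * E * C) - pencil A := by
      rw [pencil_sub, add_sub_cancel_left]
    rw [h1, Matrix.mul_sub, Matrix.sub_mul, ratResolvent_mul_pencil, Matrix.mul_assoc,
      pencil_mul_ratResolvent, Matrix.mul_one, Matrix.one_mul]
  have hn : (-(E * C)).map RatFunc.C = -(E.map RatFunc.C * C.map RatFunc.C) := by
    rw [Matrix.map_neg _ (map_neg _), Matrix.map_mul]
  simp only [transferFunction, hn, Matrix.map_mul] at hr ⊢
  set a := ratResolvent A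
  set a' := ratResolvent (A - B * E * C)
  set b := B.map RatFunc.C
  set c := C.map RatFunc.C
  set d := D.map RatFunc.C
  set e := E.map RatFunc.C
  have e1 : c * a * b * (e * c * a' * (b * e)) = c * (a - a') * (b * e) := by
    rw [← hr]
    simp only [Matrix.mul_assoc]
  have e2 : d * (e * c * a' * (b * e)) = c * a' * (b * e) := by
    calc d * (e * c * a' * (b * e)) = d * e * (c * a' * (b * e)) := by
          simp only [Matrix.mul_assoc]
      _ = _ := by rw [hd, Matrix.one_mul]
  rw [Matrix.add_mul, Matrix.mul_add, Matrix.mul_add, Matrix.neg_mul, Matrix.neg_mul,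
    Matrix.mul_neg, Matrix.mul_neg, e1, e2, hd, Matrix.mul_sub, Matrix.sub_mul]
  simp only [Matrix.mul_assoc]
  abel

/-- The zeros of a transfer function are the poles of its inverse. Both sides are the determinant of
the system matrix `[[s I - A, -B], [C, D]]`, by the two Schur complement formulas. -/
theorem det_transferFunction [Fintype m] [DecidableEq m] (A : Matrix ι ι ℂ)
    (B : Matrix ι m ℂ) (C : Matrix m ι ℂ) {D E : Matrix m m ℂ} (h : D * E = 1) :
    (transferFunction A B C D).det * algebraMap ℂ[X] (RatFunc ℂ) A.charpoly =
      RatFunc.C D.det * algebraMap ℂ[X] (RatFunc ℂ) (A - B * E * C).charpoly := by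
  have hd := map_ratFuncC_mul_eq_one h
  have hd' := map_ratFuncC_mul_eq_one (mul_eq_one_comm.1 h)
  let i1 : Invertible (pencil A) :=
    ⟨ratResolvent A, ratResolvent_mul_pencil A, pencil_mul_ratResolvent A⟩
  let i2 : Invertible (D.map RatFunc.C) := ⟨E.map RatFunc.C, hd', hd⟩
  have h1 := Matrix.det_fromBlocks₁₁ (pencil A) (-(B.map RatFunc.C)) (C.map RatFunc.C)
    (D.map RatFunc.C)
  have h2 := Matrix.det_fromBlocks₂₂ (pencil A) (-(B.map RatFunc.C)) (C.map RatFunc.C)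
    (D.map RatFunc.C)
  rw [← det_pencil, ← det_pencil, mul_comm]
  have h3 : transferFunction A B C D = D.map RatFunc.C -
      C.map RatFunc.C * ⅟(pencil A) * -(B.map RatFunc.C) := by
    change _ = D.map RatFunc.C - C.map RatFunc.C * ratResolvent A * -(B.map RatFunc.C)
    rw [transferFunction, Matrix.mul_neg, sub_neg_eq_add, add_comm]
  have h4 : pencil (A - B * E * C) = pencil A -
      -(B.map RatFunc.C) * ⅟(D.map RatFunc.C) * C.map RatFunc.C := by
    change _ = pencil A - -(B.map RatFunc.C) * E.map RatFunc.C * C.map RatFunc.C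
    rw [pencil_sub, Matrix.neg_mul, Matrix.neg_mul, sub_neg_eq_add, Matrix.map_mul, Matrix.map_mul]
  have h5 : (D.map RatFunc.C).det = RatFunc.C D.det :=
    (RingHom.map_det RatFunc.C D).symm
  rw [h3, h4, ← h1, h2, h5]

/-- A realization with an unobservable eigenvector can be shortened. -/
theorem RationalMatrix.HasRealizationOfSize.of_not_isObservable [Fintype k] {n : ℕ}
    {A : Matrix (Fin n) (Fin n) ℂ} (B : Matrix (Fin n) k ℂ) {C : Matrix m (Fin n) ℂ}
    (D : Matrix m k ℂ) {μ : ℂ} {w : Fin n → ℂ} (hw : w ≠ 0) (hA : A *ᵥ w = μ • w)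
    (hC : C *ᵥ w = 0) :
    RationalMatrix.HasRealizationOfSize (transferFunction A B C D) (n - 1) := by
  classical
  have hdim : Module.finrank ℂ ((Fin n → ℂ) ⧸ Submodule.span ℂ {w}) =
      Module.finrank ℂ (Fin (n - 1) → ℂ) := by
    have := Submodule.finrank_quotient_add_finrank (Submodule.span ℂ {w})
    rw [finrank_span_singleton hw] at this
    simp only [Module.finrank_fin_fun] at this ⊢
    omega
  -- compress to the quotient of the state space by the line of `w`, with a section `σ`
  let e := LinearEquiv.ofFinrankEq _ _ hdim
  let π : (Fin n → ℂ) →ₗ[ℂ] (Fin (n - 1) → ℂ) := e.toLinearMap ∘ₗ (Submodule.span ℂ {w}).mkQ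
  have hπ : Function.Surjective π :=
    e.surjective.comp (Submodule.mkQ_surjective _)
  have hker : ∀ x, π x = 0 → ∃ c : ℂ, c • w = x := by
    intro x hx
    have : (Submodule.span ℂ {w}).mkQ x = 0 := by
      simpa [π] using hx
    rw [Submodule.mkQ_apply, Submodule.Quotient.mk_eq_zero] at this
    exact Submodule.mem_span_singleton.1 this
  have hπw : π w = 0 := by
    have : (Submodule.span ℂ {w}).mkQ w = 0 := by
      rw [Submodule.mkQ_apply, Submodule.Quotient.mk_eq_zero]
      exact Submodule.mem_span_singleton_self w
    simp [π, this]
  obtain ⟨σ, hσ⟩ := LinearMap.exists_rightInverse_of_surjective π (LinearMap.range_eq_top.2 hπ)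
  let P := LinearMap.toMatrix' π
  let J := LinearMap.toMatrix' σ
  have hP : ∀ x, P *ᵥ x = π x := LinearMap.toMatrix'_mulVec π
  have hJ : ∀ x, J *ᵥ x = σ x := LinearMap.toMatrix'_mulVec σ
  have hsub : ∀ x, ∃ c : ℂ, x = J *ᵥ (P *ᵥ x) + c • w := by
    intro x
    obtain ⟨c, hc⟩ := hker (x - J *ᵥ (P *ᵥ x)) (by
      rw [map_sub, hJ, hP, ← LinearMap.comp_apply, hσ, LinearMap.id_apply, sub_self])
    exact ⟨c, by rw [hc]; abel⟩
  have hPA : P * A = P * A * J * P := by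
    refine Matrix.ext_of_mulVec_single fun i => ?_
    obtain ⟨c, hc⟩ := hsub (Pi.single i 1)
    conv_lhs => rw [hc]
    rw [Matrix.mulVec_add, Matrix.mulVec_smul, ← Matrix.mulVec_mulVec w P A, hA,
      Matrix.mulVec_smul, hP w, hπw, smul_zero, smul_zero, add_zero]
    simp only [Matrix.mulVec_mulVec, Matrix.mul_assoc]
  have hCP : C = C * J * P := by
    refine Matrix.ext_of_mulVec_single fun i => ?_
    obtain ⟨c, hc⟩ := hsub (Pi.single i 1)
    conv_lhs => rw [hc]
    rw [Matrix.mulVec_add, Matrix.mulVec_smul, hC, smul_zero, add_zero]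
    simp only [Matrix.mulVec_mulVec, Matrix.mul_assoc]
  refine ⟨P * A * J, P * B, C * J, D, ?_⟩
  change transferFunction A B C D = transferFunction (P * A * J) (P * B) (C * J) D
  rw [transferFunction, transferFunction]
  congr 1
  conv_lhs => rw [hCP]
  rw [Matrix.map_mul (L := C * J) (M := P), Matrix.map_mul (L := P) (M := B),
    Matrix.mul_assoc ((C * J).map RatFunc.C), map_mul_ratResolvent hPA]
  simp only [Matrix.mul_assoc]

theorem RationalMatrix.HasRealizationOfSize.transpose [Fintype m] [Fintype k]
    {S : RationalMatrix m k} {n : ℕ} (h : S.HasRealizationOfSize n) :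
    RationalMatrix.HasRealizationOfSize Sᵀ n := by
  obtain ⟨A, B, C, D, h⟩ := h
  refine ⟨Aᵀ, Cᵀ, Bᵀ, Dᵀ, ?_⟩
  have h : S = transferFunction A B C D := h
  rw [h, transferFunction_transpose]
  rfl

namespace RationalMatrix.IsMinimalRealization

variable {S : RationalMatrix m k} {n : ℕ} {A : Matrix (Fin n) (Fin n) ℂ}
  {B : Matrix (Fin n) k ℂ} {C : Matrix m (Fin n) ℂ} {D : Matrix m k ℂ}

theorem eq_transferFunction (h : S.IsMinimalRealization A B C D) :
    S = transferFunction A B C D := h.1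

theorem isObservable [Fintype k] (h : S.IsMinimalRealization A B C D) : IsObservable A C := by
  intro μ w hA hC
  by_contra hw
  have h1 := h.2 _ (h.eq_transferFunction ▸
    RationalMatrix.HasRealizationOfSize.of_not_isObservable B D hw hA hC)
  have : n = 0 := by omega
  subst this
  exact hw (Subsingleton.elim _ _)

theorem transpose [Fintype m] [Fintype k] (h : S.IsMinimalRealization A B C D) :
    RationalMatrix.IsMinimalRealization Sᵀ Aᵀ Cᵀ Bᵀ Dᵀ := by
  refine ⟨?_, fun l hl => h.2 l ?_⟩
  · change Sᵀ = transferFunction Aᵀ Cᵀ Bᵀ Dᵀ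
    rw [h.eq_transferFunction, transferFunction_transpose]
  · simpa using hl.transpose

theorem isReachable [Fintype m] [Fintype k] (h : S.IsMinimalRealization A B C D) :
    IsReachable A B := h.transpose.isObservable

end RationalMatrix.IsMinimalRealization

/-- A transfer function determines its value at infinity and its strictly proper part. -/
theorem transferFunction_inj [Fintype k] {ι' : Type*} [Fintype ι'] [DecidableEq ι']
    {A : Matrix ι ι ℂ} {B : Matrix ι k ℂ} {C : Matrix m ι ℂ} {D : Matrix m k ℂ}
    {A' : Matrix ι' ι' ℂ} {B' : Matrix ι' k ℂ} {C' : Matrix m ι' ℂ} {D' : Matrix m k ℂ}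
    (h : transferFunction A B C D = transferFunction A' B' C' D') :
    D = D' ∧ C.map RatFunc.C * ratResolvent A * B.map RatFunc.C =
      C'.map RatFunc.C * ratResolvent A' * B'.map RatFunc.C := by
  have h1 := tendsto_eval_transferFunction A B C D
  rw [h] at h1
  have hD := tendsto_nhds_unique h1 (tendsto_eval_transferFunction A' B' C' D')
  refine ⟨hD, ?_⟩
  rw [transferFunction, transferFunction, hD] at h
  exact add_right_cancel h

/-- An invertible complex symmetric matrix `M` is of the form `Lᵀ L`. -/
theorem exists_transpose_mul_self_eq {M : Matrix ι ι ℂ} (hM : M.IsSymm) (hdet : IsUnit M.det) :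
    ∃ L : Matrix ι ι ℂ, Lᵀ * L = M := by
  let _ : Invertible (2 : ℂ) := invertibleOfNonzero two_ne_zero
  have hassoc : ∀ N : Matrix ι ι ℂ, N.IsSymm →
      QuadraticMap.associated (R := ℂ) N.toQuadraticForm' = Matrix.toLinearMap₂' ℂ N := by
    intro N hN
    refine QuadraticMap.associated_left_inverse ℂ fun x y => ?_
    rw [Matrix.toLinearMap₂'_apply', Matrix.toLinearMap₂'_apply', dotProduct_comm,
      ← Matrix.vecMul_transpose, hN.eq, Matrix.dotProduct_mulVec]
  have hsep : ∀ N : Matrix ι ι ℂ, N.IsSymm → IsUnit N.det →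
      (QuadraticMap.associated (R := ℂ) N.toQuadraticForm').SeparatingLeft := by
    intro N hN hdet
    rw [hassoc N hN]
    exact LinearMap.separatingLeft_toLinearMap₂'_of_det_ne_zero' hdet.ne_zero
  have hmat : ∀ N : Matrix ι ι ℂ, N.IsSymm → N.toQuadraticForm'.toMatrix' = N := by
    intro N hN
    rw [QuadraticForm.toMatrix', hassoc N hN, LinearMap.toMatrix'_toLinearMap₂']
  obtain ⟨e⟩ := QuadraticForm.equivalent_of_isAlgClosed M.toQuadraticForm'
    (1 : Matrix ι ι ℂ).toQuadraticForm' (hsep M hM hdet)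
    (hsep 1 Matrix.isSymm_one (by simp))
  have hcomp : M.toQuadraticForm' = (1 : Matrix ι ι ℂ).toQuadraticForm'.comp
      (e.toLinearEquiv : (ι → ℂ) →ₗ[ℂ] (ι → ℂ)) := by
    ext x
    exact (e.map_app x).symm
  have h := congrArg QuadraticForm.toMatrix' hcomp
  rw [QuadraticForm.toMatrix'_comp, hmat M hM, hmat 1 Matrix.isSymm_one, Matrix.mul_one] at h
  exact ⟨_, h.symm⟩

/-- A symmetric rational matrix that has a minimal realization has a symmetric one: the similarity
`M` from a minimal realization to its transpose is symmetric, and if `M = Lᵀ L`, then the change of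
coordinates `L` makes the realization symmetric. -/
theorem RationalMatrix.IsMinimalRealization.exists_symmetric [Fintype m] {S : RationalMatrix m m}
    (hS : S.IsSymm) {n : ℕ} {A : Matrix (Fin n) (Fin n) ℂ}
    {B : Matrix (Fin n) m ℂ} {C : Matrix m (Fin n) ℂ} {D : Matrix m m ℂ}
    (h : S.IsMinimalRealization A B C D) :
    ∃ (A : Matrix (Fin n) (Fin n) ℂ) (B : Matrix (Fin n) m ℂ) (C : Matrix m (Fin n) ℂ)
      (D : Matrix m m ℂ), S.IsMinimalRealization A B C D ∧ IsSymmetricRealization A B C D := by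
  have h' := h.transpose
  rw [hS.eq] at h'
  obtain ⟨hD, hT⟩ := transferFunction_inj (h.eq_transferFunction.symm.trans h'.eq_transferFunction)
  obtain ⟨M, hM, hMA, hMB, hMC⟩ := exists_isUnit_intertwiner hT h.isObservable h.isReachable
    h'.isObservable
  have hsymm : Mᵀ = M := by
    refine eq_of_intertwine h.isReachable (A' := Aᵀ) (B' := Cᵀ) ?_ ?_ hMA hMB
    · have := congrArg Matrix.transpose hMA
      rw [Matrix.transpose_mul, Matrix.transpose_mul, Matrix.transpose_transpose] at this
      exact this.symm
    · have := congrArg Matrix.transpose hMC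
      rwa [Matrix.transpose_mul, Matrix.transpose_transpose] at this
  obtain ⟨L, hL⟩ := exists_transpose_mul_self_eq hsymm hM
  have hLdet : IsUnit L.det := by
    rw [← hL, Matrix.det_mul] at hM
    exact isUnit_of_mul_isUnit_right hM
  have hLi : L * L⁻¹ = 1 := Matrix.mul_nonsing_inv _ hLdet
  have hLi' : L⁻¹ * L = 1 := Matrix.nonsing_inv_mul _ hLdet
  have hLti : (L⁻¹)ᵀ * Lᵀ = 1 := by rw [← Matrix.transpose_mul, hLi, Matrix.transpose_one]
  have hC : C * L⁻¹ = (L * B)ᵀ := by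
    rw [Matrix.transpose_mul, ← hMC, ← hL]
    simp only [Matrix.mul_assoc]
    rw [hLi, Matrix.mul_one]
  refine ⟨L * A * L⁻¹, L * B, C * L⁻¹, D, ⟨?_, h.2⟩, ?_, hC, hD.symm⟩
  · change S = transferFunction _ _ _ _
    rw [h.eq_transferFunction, transferFunction, transferFunction]
    have hint : L * A = (L * A * L⁻¹) * L := by
      rw [Matrix.mul_assoc, hLi', Matrix.mul_one]
    have h1 : C = C * L⁻¹ * L := by rw [Matrix.mul_assoc, hLi', Matrix.mul_one]
    congr 1
    conv_lhs => rw [h1]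
    rw [Matrix.map_mul (L := C * L⁻¹) (M := L), Matrix.map_mul (L := L) (M := B),
      Matrix.mul_assoc ((C * L⁻¹).map RatFunc.C), map_mul_ratResolvent hint]
    simp only [Matrix.mul_assoc]
  · rw [Matrix.IsSymm, Matrix.transpose_mul, Matrix.transpose_mul]
    have h1 : Aᵀ * (Lᵀ * L) = Lᵀ * L * A := by rw [hL, hMA]
    calc (L⁻¹)ᵀ * (Aᵀ * Lᵀ) = (L⁻¹)ᵀ * (Aᵀ * (Lᵀ * L)) * L⁻¹ := by
          simp only [Matrix.mul_assoc]
          rw [hLi, Matrix.mul_one]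
      _ = (L⁻¹)ᵀ * Lᵀ * (L * A * L⁻¹) := by
          rw [h1]
          simp only [Matrix.mul_assoc]
      _ = L * A * L⁻¹ := by rw [hLti, Matrix.one_mul]

end Realizations

/-! ### Fejér–Riesz and spectral factorization on the imaginary axis -/

section FejerRiesz

open Complex

theorem neg_star_I_mul (ω : ℝ) : -star (I * (ω : ℂ)) = I * ω := by
  simp

theorem I_mul_ofReal_injective : Function.Injective fun ω : ℝ => I * (ω : ℂ) := by
  intro a b h
  simpa using h

theorem RatFunc.eventually_hasValue_axis (f : RatFunc ℂ) :
    ∀ᶠ ω : ℝ in cofinite, f.HasValue (I * ω) (f.eval (RingHom.id ℂ) (I * ω)) :=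
  I_mul_ofReal_injective.tendsto_cofinite.eventually
    f.finite_not_hasValue.compl_mem_cofinite |>.mono fun _ h => not_not.1 h

theorem Polynomial.eventually_eval_axis_ne_zero {p : ℂ[X]} (hp : p ≠ 0) :
    ∀ᶠ ω : ℝ in cofinite, p.eval (I * ω) ≠ 0 :=
  I_mul_ofReal_injective.tendsto_cofinite.eventually
    (Polynomial.finite_setOfPred_isRoot hp).compl_mem_cofinite

theorem nonneg_of_ofReal_mul_nonneg {r : ℝ} (hr : 0 < r) {z : ℂ} (h : 0 ≤ (r : ℂ) * z) :
    0 ≤ z := by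
  rw [Complex.le_def] at h ⊢
  simp only [Complex.zero_re, Complex.re_ofReal_mul, Complex.zero_im, Complex.im_ofReal_mul] at h ⊢
  refine ⟨nonneg_of_mul_nonneg_right h.1 hr, ?_⟩
  rcases mul_eq_zero.1 h.2.symm with h0 | h0
  · exact absurd h0 hr.ne'
  · exact h0.symm

theorem dense_of_eventually_cofinite {P : ℝ → Prop} (h : ∀ᶠ ω in cofinite, P ω) :
    Dense {ω | P ω} := by
  have h1 : {ω | ¬ P ω}.Finite := h
  have h2 := h1.countable.dense_compl ℝ
  convert h2 using 1
  ext ω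
  simp

theorem continuous_eval_axis (p : ℂ[X]) : Continuous fun ω : ℝ => p.eval (I * (ω : ℂ)) :=
  p.continuous.comp (by fun_prop)

theorem nonneg_axis_of_eventually {p : ℂ[X]} (h : ∀ᶠ ω : ℝ in cofinite, 0 ≤ p.eval (I * ω))
    (ω : ℝ) : 0 ≤ p.eval (I * ω) := by
  have hc : IsClosed {ω : ℝ | 0 ≤ p.eval (I * ω)} :=
    isClosed_le continuous_const (continuous_eval_axis p)
  have := (dense_of_eventually_cofinite h).closure_eq
  rw [hc.closure_eq] at this
  have h2 : ω ∈ (Set.univ : Set ℝ) := trivial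
  rw [← this] at h2
  exact h2

theorem RatFunc.eq_of_axis {f g : RatFunc ℂ}
    (h : ∀ᶠ ω : ℝ in cofinite, ∃ v, f.HasValue (I * ω) v ∧ g.HasValue (I * ω) v) : f = g := by
  rw [← sub_eq_zero]
  have h1 : {ω : ℝ | ∃ v, f.HasValue (I * ω) v ∧ g.HasValue (I * ω) v}.Infinite := by
    intro hfin
    have := hfin.union h
    refine Set.infinite_univ (α := ℝ) (this.subset fun x _ => ?_)
    by_cases hx : ∃ v, f.HasValue (I * x) v ∧ g.HasValue (I * x) v
    · exact Or.inl hx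
    · exact Or.inr hx
  refine RatFunc.eq_zero_of_infinite (h1.image I_mul_ofReal_injective.injOn) ?_
  rintro _ ⟨ω, ⟨v, h1, h2⟩, rfl⟩
  simpa using h1.sub h2

theorem polyParaConj_eq_of_nonneg {p : ℂ[X]} (h : ∀ ω : ℝ, 0 ≤ p.eval (I * ω)) :
    polyParaConj p = p := by
  apply RatFunc.algebraMap_injective ℂ
  refine RatFunc.eq_of_axis
    (.of_forall fun ω => ⟨p.eval (I * ω), ?_, RatFunc.HasValue.algebraMap p⟩)
  have := RatFunc.HasValue.algebraMap (polyParaConj p) (s := I * ω)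
  rw [eval_polyParaConj, neg_star_I_mul] at this
  convert this using 1
  have := Complex.conj_eq_iff_im.2 (Complex.le_def.1 (h ω)).2.symm
  exact this.symm

/-- A root on the imaginary axis of a polynomial that is nonnegative there is a multiple root. -/
theorem eval_eq_zero_of_nonneg_axis {p q : ℂ[X]} {ω₀ : ℝ}
    (hpq : p = (Polynomial.X - Polynomial.C (I * (ω₀ : ℂ))) * q)
    (h : ∀ ω : ℝ, 0 ≤ p.eval (I * ω)) : q.eval (I * ω₀) = 0 := by
  have h1 : ∀ ω : ℝ, 0 ≤ ((ω - ω₀ : ℝ) : ℂ) * (I * q.eval (I * ω)) := by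
    intro ω
    have := h ω
    rw [hpq, Polynomial.eval_mul] at this
    convert this using 1
    simp
    ring
  have hc : Continuous fun ω : ℝ => I * q.eval (I * (ω : ℂ)) :=
    continuous_const.mul (continuous_eval_axis q)
  -- by `h1`, the continuous function `ω ↦ I * q (I ω)` is nonnegative to the right of `ω₀` and
  -- nonpositive to its left
  have hge : 0 ≤ I * q.eval (I * ω₀) := by
    have ht : Tendsto (fun ω : ℝ => I * q.eval (I * (ω : ℂ))) (𝓝[>] ω₀) (𝓝 (I * q.eval (I * ω₀))) :=
      hc.continuousAt.tendsto.mono_left nhdsWithin_le_nhds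
    refine ge_of_tendsto ht ?_
    filter_upwards [self_mem_nhdsWithin] with ω hω
    exact nonneg_of_ofReal_mul_nonneg (sub_pos.2 hω) (h1 ω)
  have hle : 0 ≤ -(I * q.eval (I * ω₀)) := by
    have ht : Tendsto (fun ω : ℝ => -(I * q.eval (I * (ω : ℂ)))) (𝓝[<] ω₀)
        (𝓝 (-(I * q.eval (I * ω₀)))) :=
      hc.neg.continuousAt.tendsto.mono_left nhdsWithin_le_nhds
    refine ge_of_tendsto ht ?_
    filter_upwards [self_mem_nhdsWithin] with ω hω
    refine nonneg_of_ofReal_mul_nonneg (sub_pos.2 hω) ?_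
    convert h1 ω using 1
    push_cast
    ring
  have h0 : I * q.eval (I * ω₀) = 0 := le_antisymm (neg_nonneg.1 hle) hge
  simpa using h0

/-- The Fejér–Riesz theorem: a polynomial that is nonnegative on the imaginary axis is of the form
`g g^*`. -/
theorem Polynomial.exists_eq_mul_polyParaConj {p : ℂ[X]} (h : ∀ ω : ℝ, 0 ≤ p.eval (I * ω)) :
    ∃ g : ℂ[X], p = g * polyParaConj g := by
  induction hn : p.natDegree using Nat.strong_induction_on generalizing p with
  | _ n ih =>
    rcases Nat.eq_zero_or_pos n with rfl | hpos
    · rw [Polynomial.natDegree_eq_zero] at hn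
      obtain ⟨c, rfl⟩ := hn
      have hc := h 0
      rw [Polynomial.eval_C] at hc
      obtain ⟨r, hr, rfl⟩ : ∃ r : ℝ, 0 ≤ r ∧ (r : ℂ) = c :=
        ⟨c.re, (Complex.le_def.1 hc).1, Complex.ext rfl (Complex.le_def.1 hc).2⟩
      refine ⟨Polynomial.C (Real.sqrt r : ℂ), ?_⟩
      rw [polyParaConj_C, ← Polynomial.C_mul]
      congr 1
      rw [Complex.star_def, Complex.conj_ofReal, ← Complex.ofReal_mul, Real.mul_self_sqrt hr]
    -- split off a root `r` together with its mirror image `-conj r`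
    · obtain ⟨r, hr⟩ := Complex.exists_root (f := p)
        (Polynomial.natDegree_pos_iff_degree_pos.1 (hn ▸ hpos))
      have hp0 : p ≠ 0 := by
        rintro rfl
        simp at hn
        omega
      obtain ⟨q, hq⟩ := Polynomial.dvd_iff_isRoot.2 hr
      have hroot : q.eval (-star r) = 0 := by
        by_cases hre : r.re = 0
        · have hrI : r = I * (r.im : ℂ) := by
            apply Complex.ext <;> simp [hre]
          have h1 := eval_eq_zero_of_nonneg_axis (ω₀ := r.im) (by rw [← hrI]; exact hq) h
          rwa [hrI, neg_star_I_mul]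
        · have h1 : p.eval (-star r) = 0 := by
            rw [← polyParaConj_eq_of_nonneg h, eval_polyParaConj, star_neg, star_star, neg_neg,
              hr, star_zero]
          rw [hq, Polynomial.eval_mul, mul_eq_zero] at h1
          refine h1.resolve_left fun h2 => hre ?_
          simp only [Polynomial.eval_sub, Polynomial.eval_X, Polynomial.eval_C] at h2
          have := congrArg Complex.re h2
          simp at this
          linarith
      obtain ⟨t, ht⟩ := Polynomial.dvd_iff_isRoot.2 hroot
      have hpt : p = (Polynomial.X - Polynomial.C r) *
          polyParaConj (Polynomial.X - Polynomial.C r) * (-t) := by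
        conv_lhs => rw [hq, ht]
        rw [map_sub, polyParaConj_X, polyParaConj_C, Polynomial.C_neg]
        ring
      have hnn : ∀ ω : ℝ, 0 ≤ (-t).eval (I * ω) := by
        apply nonneg_axis_of_eventually
        have hX := Polynomial.eventually_eval_axis_ne_zero (Polynomial.X_sub_C_ne_zero r)
        filter_upwards [hX] with ω hω
        have h1 := h ω
        rw [hpt, Polynomial.eval_mul, Polynomial.eval_mul, eval_polyParaConj, neg_star_I_mul,
          Complex.star_def, Complex.mul_conj] at h1
        exact nonneg_of_ofReal_mul_nonneg (Complex.normSq_pos.2 hω) h1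
      have hdeg : (-t).natDegree < n := by
        have hq0 : q ≠ 0 := by
          rintro rfl
          simp at hq
          exact hp0 hq
        have ht0 : t ≠ 0 := by
          rintro rfl
          simp at ht
          exact hq0 ht
        rw [Polynomial.natDegree_neg, ← hn, hq, ht,
          Polynomial.natDegree_mul (Polynomial.X_sub_C_ne_zero _)
            (mul_ne_zero (Polynomial.X_sub_C_ne_zero _) ht0),
          Polynomial.natDegree_mul (Polynomial.X_sub_C_ne_zero _) ht0,
          Polynomial.natDegree_X_sub_C, Polynomial.natDegree_X_sub_C]
        omega
      obtain ⟨g, hg⟩ := ih _ hdeg hnn rfl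
      refine ⟨(Polynomial.X - Polynomial.C r) * g, ?_⟩
      rw [hpt, hg, map_mul]
      ring

/-- The Fejér–Riesz theorem for rational functions: multiply by the norm of the denominator. -/
theorem RatFunc.exists_eq_mul_star {f : RatFunc ℂ}
    (h : ∀ᶠ ω : ℝ in cofinite, ∃ v, 0 ≤ v ∧ f.HasValue (I * ω) v) :
    ∃ g : RatFunc ℂ, f = g * star g := by
  obtain ⟨g, hg⟩ := Polynomial.exists_eq_mul_polyParaConj (p := f.num * polyParaConj f.denom) (by
    apply nonneg_axis_of_eventually
    filter_upwards [h, Polynomial.eventually_eval_axis_ne_zero f.denom_ne_zero]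
      with ω ⟨v, hv, hfv⟩ hd
    rw [Polynomial.eval_mul, eval_polyParaConj, neg_star_I_mul]
    have h1 := hfv.eval_eq
    rw [RatFunc.eval, Polynomial.eval₂_id, Polynomial.eval₂_id, div_eq_iff hd] at h1
    rw [h1, mul_assoc]
    exact mul_nonneg hv (mul_star_self_nonneg _))
  have hd : algebraMap ℂ[X] (RatFunc ℂ) f.denom ≠ 0 :=
    RatFunc.algebraMap_ne_zero f.denom_ne_zero
  have hd' : star (algebraMap ℂ[X] (RatFunc ℂ) f.denom) ≠ 0 := star_ne_zero.2 hd
  refine ⟨algebraMap ℂ[X] (RatFunc ℂ) g / algebraMap ℂ[X] (RatFunc ℂ) f.denom, ?_⟩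
  have h1 := congrArg (algebraMap ℂ[X] (RatFunc ℂ)) hg
  rw [map_mul, map_mul, ← star_algebraMap, ← star_algebraMap] at h1
  rw [star_div₀, div_mul_div_comm, ← h1, mul_div_mul_right _ _ hd', RatFunc.num_div_denom]

open Matrix in
/-- Over a field with involution, a Hermitian matrix all of whose nontrivial values are nonzero
norms `g * star g` has a Cholesky factorization: split off the first row and column, and apply
induction to the Schur complement. -/
theorem Matrix.exists_eq_mul_conjTranspose {F : Type*} [Field F] [StarRing F] {n : ℕ}
    {Φ : Matrix (Fin n) (Fin n) F} (hΦ : Φ.IsHermitian)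
    (h : ∀ x : Fin n → F, x ≠ 0 → ∃ g : F, g ≠ 0 ∧ star x ⬝ᵥ (Φ *ᵥ x) = g * star g) :
    ∃ R : Matrix (Fin n) (Fin n) F, Φ = R * Rᴴ := by
  induction n with
  | zero => exact ⟨0, Subsingleton.elim _ _⟩
  | succ n ih =>
    obtain ⟨g, hg, hg0⟩ := h (Pi.single 0 1) (by simp)
    have ha : Φ 0 0 = g * star g := by
      rw [← hg0]
      simp
    have hg' : star g ≠ 0 := star_ne_zero.2 hg
    let w : Fin n → F := fun i => Φ i.succ 0 / star g
    -- the Schur complement of the corner entry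
    let Ψ : Matrix (Fin n) (Fin n) F := Matrix.of fun i j => Φ i.succ j.succ - w i * star (w j)
    have hΦ' : ∀ i j, star (Φ j i) = Φ i j := fun i j => hΦ.apply i j
    have hw : ∀ j, star (w j) = Φ 0 j.succ / g := by
      intro j
      simp [w, hΦ']
    have hΨ : Ψ.IsHermitian := by
      refine Matrix.IsHermitian.ext fun i j => ?_
      simp [Ψ, hΦ', mul_comm]
    obtain ⟨R, hR⟩ := ih hΨ (by
      intro x hx
      -- the values of the Schur complement are values of `Φ`, at a suitably prolonged vector
      obtain ⟨c, hc, hcx⟩ := h (Fin.cons (-(∑ j, Φ 0 j.succ * x j) / Φ 0 0) x) (by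
        intro h0
        apply hx
        ext i
        simpa using congrFun h0 i.succ)
      refine ⟨c, hc, ?_⟩
      rw [← hcx]
      simp only [dotProduct, Matrix.mulVec, Fin.sum_univ_succ, Fin.cons_zero, Fin.cons_succ,
        Pi.star_apply]
      have h0 : Φ 0 0 * (-(∑ j, Φ 0 j.succ * x j) / Φ 0 0) + ∑ j, Φ 0 j.succ * x j = 0 := by
        have : Φ 0 0 ≠ 0 := by rw [ha]; exact mul_ne_zero hg hg'
        field_simp
        ring
      rw [h0, mul_zero, zero_add]
      refine Finset.sum_congr rfl fun i _ => ?_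
      congr 1
      have h1 : Φ i.succ 0 * (-(∑ j, Φ 0 j.succ * x j) / Φ 0 0) =
          ∑ j, -(w i * star (w j)) * x j := by
        rw [ha, ← Finset.sum_neg_distrib, Finset.sum_div, Finset.mul_sum]
        refine Finset.sum_congr rfl fun j _ => ?_
        rw [hw]
        simp only [w]
        field_simp
      rw [h1, ← Finset.sum_add_distrib]
      refine Finset.sum_congr rfl fun j _ => ?_
      simp only [Ψ, Matrix.of_apply]
      ring)
    refine ⟨Matrix.of (Fin.cons (Fin.cons g 0) fun i => Fin.cons (w i) (R i)), ?_⟩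
    have hR' : ∀ i j, Φ i.succ j.succ = w i * star (w j) + ∑ l, R i l * star (R j l) := by
      intro i j
      have := congrFun (congrFun hR i) j
      simp only [Ψ, Matrix.of_apply, Matrix.mul_apply, Matrix.conjTranspose_apply] at this
      rw [← this]
      ring
    ext i j
    simp only [Matrix.mul_apply, Matrix.conjTranspose_apply, Matrix.of_apply, Fin.sum_univ_succ]
    refine Fin.cases ?_ (fun i => ?_) i <;> refine Fin.cases ?_ (fun j => ?_) j
    · simp [ha]
    · simp [hw]
      field_simp
    · simp [w]
      field_simp
    · simp [hR']

open Matrix in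
/-- Spectral factorization: a rational matrix that is positive definite at all but finitely many
points of the imaginary axis is of the form `R R^*`. -/
theorem RationalMatrix.exists_eq_mul_conjTranspose {n : ℕ} {Φ : RationalMatrix (Fin n) (Fin n)}
    (h : ∀ᶠ ω : ℝ in cofinite, ∃ V, V.PosDef ∧ Φ.HasValue (I * ω) V) :
    ∃ R : RationalMatrix (Fin n) (Fin n), Φ = R * Rᴴ := by
  apply Matrix.exists_eq_mul_conjTranspose
  · ext i j
    refine RatFunc.eq_of_axis (h.mono fun ω ⟨V, hV, hΦV⟩ => ⟨V i j, ?_, hΦV i j⟩)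
    have := (hΦV j i).star
    rwa [neg_star_I_mul, hV.isHermitian.apply] at this
  · intro x hx
    obtain ⟨i, hi⟩ := Function.ne_iff.1 hx
    have hx0 : ∀ᶠ ω : ℝ in cofinite, (x i).eval (RingHom.id ℂ) (I * ω) ≠ 0 := by
      filter_upwards [RatFunc.eventually_hasValue_axis (x i),
        RatFunc.eventually_hasValue_axis (x i)⁻¹] with ω h1 h2 h0
      have h3 := h1.mul h2
      rw [mul_inv_cancel₀ hi, h0, zero_mul] at h3
      exact one_ne_zero (RatFunc.HasValue.one.unique h3)
    have hxv : ∀ᶠ ω : ℝ in cofinite, ∀ j,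
        (x j).HasValue (I * ω) ((x j).eval (RingHom.id ℂ) (I * ω)) :=
      eventually_all.2 fun j => RatFunc.eventually_hasValue_axis (x j)
    have hval : ∀ᶠ ω : ℝ in cofinite, ∃ v, 0 < v ∧ (star x ⬝ᵥ (Φ *ᵥ x)).HasValue (I * ω) v := by
      filter_upwards [h, hx0, hxv] with ω ⟨V, hV, hΦV⟩ h0 h1
      refine ⟨_, hV.dotProduct_mulVec_pos (x := fun j => (x j).eval (RingHom.id ℂ) (I * ω)) ?_, ?_⟩
      · intro h2
        exact h0 (congrFun h2 i)
      · have h2 : ∀ j, ((Φ *ᵥ x) j).HasValue (I * ω)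
            ((V *ᵥ fun j => (x j).eval (RingHom.id ℂ) (I * ω)) j) := fun j => by
          simp only [Matrix.mulVec, dotProduct]
          exact RatFunc.HasValue.sum _ fun l _ => (hΦV j l).mul (h1 l)
        refine RatFunc.HasValue.sum _ fun j _ => RatFunc.HasValue.mul ?_ (h2 j)
        have := (h1 j).star
        rwa [neg_star_I_mul] at this
    obtain ⟨g, hg⟩ := RatFunc.exists_eq_mul_star (hval.mono fun ω ⟨v, hv, hf⟩ => ⟨v, hv.le, hf⟩)
    refine ⟨g, ?_, hg⟩
    rintro rfl
    rw [zero_mul] at hg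
    obtain ⟨ω, v, hv, hf⟩ := hval.exists
    rw [hg] at hf
    exact hv.ne (RatFunc.HasValue.zero.unique hf)

end FejerRiesz

/-! ### Realizability of proper rational matrices -/

section Proper

open Matrix

variable {m k l : Type*}

/-- A rational matrix is realizable if it is a transfer function, with a state space indexed by
any finite type. -/
def IsRealizable (S : RationalMatrix m k) : Prop :=
  ∃ (ι : Type) (_ : Fintype ι) (_ : DecidableEq ι) (A : Matrix ι ι ℂ) (B : Matrix ι k ℂ)
    (C : Matrix m ι ℂ) (D : Matrix m k ℂ), S = transferFunction A B C D

theorem transferFunction_eq_of_pencil_mul {ι : Type*} [Fintype ι] [DecidableEq ι]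
    {A : Matrix ι ι ℂ} {B : Matrix ι k ℂ} {Y : Matrix ι k (RatFunc ℂ)}
    (h : pencil A * Y = B.map RatFunc.C) (C : Matrix m ι ℂ) (D : Matrix m k ℂ) :
    transferFunction A B C D = C.map RatFunc.C * Y + D.map RatFunc.C := by
  rw [transferFunction, ← h, Matrix.mul_assoc, ← Matrix.mul_assoc (ratResolvent A),
    ratResolvent_mul_pencil, Matrix.one_mul]

theorem IsRealizable.exists_hasRealizationOfSize {S : RationalMatrix m k} (h : IsRealizable S) :
    ∃ n, S.HasRealizationOfSize n := by
  obtain ⟨ι, _, _, A, B, C, D, rfl⟩ := h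
  let e := Fintype.equivFin ι
  refine ⟨Fintype.card ι, A.submatrix e.symm e.symm, B.submatrix e.symm id, C.submatrix id e.symm,
    D, ?_⟩
  change _ = transferFunction _ _ _ _
  have h1 : ratResolvent (A.submatrix e.symm e.symm) =
      (ratResolvent A).submatrix e.symm e.symm := by
    rw [ratResolvent, ratResolvent, ← Matrix.inv_submatrix_equiv]
    congr 1
    ext i j
    simp [pencil, Matrix.diagonal_apply]
  rw [transferFunction, transferFunction, h1]
  have h2 : (C.submatrix id e.symm).map RatFunc.C = (C.map RatFunc.C).submatrix id e.symm := rfl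
  have h3 : (B.submatrix e.symm id).map RatFunc.C = (B.map RatFunc.C).submatrix e.symm id := rfl
  rw [h2, h3, Matrix.submatrix_mul_equiv, Matrix.submatrix_mul_equiv, Matrix.submatrix_id_id]

theorem IsRealizable.const (D : Matrix m k ℂ) : IsRealizable (D.map RatFunc.C) :=
  ⟨Empty, inferInstance, inferInstance, 0, 0, 0, D, by
    rw [transferFunction]
    ext i j
    simp⟩

theorem pencil_fromBlocks {ι ι' : Type*} [Fintype ι] [DecidableEq ι] [Fintype ι']
    [DecidableEq ι'] (A : Matrix ι ι ℂ) (E : Matrix ι ι' ℂ) (F : Matrix ι' ι ℂ)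
    (A' : Matrix ι' ι' ℂ) :
    pencil (fromBlocks A E F A') =
      fromBlocks (pencil A) (-E.map RatFunc.C) (-F.map RatFunc.C) (pencil A') := by
  ext i j
  rcases i with i | i <;> rcases j with j | j <;> simp [pencil, Matrix.diagonal_apply]

theorem IsRealizable.add {S S' : RationalMatrix m k} (h : IsRealizable S)
    (h' : IsRealizable S') : IsRealizable (S + S') := by
  obtain ⟨ι, _, _, A, B, C, D, rfl⟩ := h
  obtain ⟨ι', _, _, A', B', C', D', rfl⟩ := h'
  refine ⟨ι ⊕ ι', inferInstance, inferInstance, fromBlocks A 0 0 A', fromRows B B',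
    fromCols C C', D + D', ?_⟩
  rw [transferFunction_eq_of_pencil_mul (Y := fromRows (ratResolvent A * B.map RatFunc.C)
    (ratResolvent A' * B'.map RatFunc.C))]
  · have h1 : (fromCols C C').map RatFunc.C = fromCols (C.map RatFunc.C) (C'.map RatFunc.C) := by
      ext i j
      rcases j with j | j <;> rfl
    rw [h1, fromCols_mul_fromRows, transferFunction, transferFunction,
      Matrix.map_add _ (map_add _), Matrix.mul_assoc, Matrix.mul_assoc]
    abel
  · have h1 : (fromRows B B').map RatFunc.C = fromRows (B.map RatFunc.C) (B'.map RatFunc.C) := by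
      ext i j
      rcases i with i | i <;> rfl
    rw [h1, pencil_fromBlocks, fromBlocks_mul_fromRows, ← Matrix.mul_assoc (pencil A),
      ← Matrix.mul_assoc (pencil A'), pencil_mul_ratResolvent, pencil_mul_ratResolvent]
    simp

/-- The cascade of two realizations. -/
theorem transferFunction_mul {ι ι' : Type*} [Fintype ι] [DecidableEq ι] [Fintype ι']
    [DecidableEq ι'] [Fintype k] (A : Matrix ι ι ℂ) (B : Matrix ι k ℂ) (C : Matrix m ι ℂ)
    (D : Matrix m k ℂ) (A' : Matrix ι' ι' ℂ) (B' : Matrix ι' l ℂ) (C' : Matrix k ι' ℂ)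
    (D' : Matrix k l ℂ) : transferFunction A B C D * transferFunction A' B' C' D' =
      transferFunction (fromBlocks A (B * C') 0 A') (fromRows (B * D') B')
        (fromCols C (D * C')) (D * D') := by
  rw [transferFunction_eq_of_pencil_mul (Y := fromRows
    (ratResolvent A * B.map RatFunc.C * transferFunction A' B' C' D')
    (ratResolvent A' * B'.map RatFunc.C))]
  · have h1 : (fromCols C (D * C')).map RatFunc.C =
        fromCols (C.map RatFunc.C) ((D * C').map RatFunc.C) := by
      ext i j
      rcases j with j | j <;> rfl
    rw [h1, fromCols_mul_fromRows, transferFunction, transferFunction,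
      Matrix.map_mul, Matrix.map_mul]
    simp only [Matrix.mul_add, Matrix.add_mul, Matrix.mul_assoc]
    abel
  · have h1 : (fromRows (B * D') B').map RatFunc.C =
        fromRows ((B * D').map RatFunc.C) (B'.map RatFunc.C) := by
      ext i j
      rcases i with i | i <;> rfl
    have h2 : pencil A * (ratResolvent A * B.map RatFunc.C * transferFunction A' B' C' D') =
        B.map RatFunc.C * transferFunction A' B' C' D' := by
      rw [← Matrix.mul_assoc, ← Matrix.mul_assoc, pencil_mul_ratResolvent, Matrix.one_mul]
    rw [h1, pencil_fromBlocks, fromBlocks_mul_fromRows, h2, ← Matrix.mul_assoc (pencil A'),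
      pencil_mul_ratResolvent, transferFunction]
    congr 1
    · rw [Matrix.map_mul, Matrix.map_mul]
      simp only [Matrix.mul_add, Matrix.neg_mul, Matrix.mul_assoc]
      abel
    · simp

theorem IsRealizable.mul [Fintype k] {S : RationalMatrix m k} {S' : RationalMatrix k l}
    (h : IsRealizable S) (h' : IsRealizable S') : IsRealizable (S * S') := by
  obtain ⟨ι, _, _, A, B, C, D, rfl⟩ := h
  obtain ⟨ι', _, _, A', B', C', D', rfl⟩ := h'
  exact ⟨ι ⊕ ι', inferInstance, inferInstance, _, _, _, _, transferFunction_mul _ _ _ _ _ _ _ _⟩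

theorem IsRealizable.sum {α : Type*} (t : Finset α) {S : α → RationalMatrix m k}
    (h : ∀ a ∈ t, IsRealizable (S a)) : IsRealizable (∑ a ∈ t, S a) := by
  classical
  induction t using Finset.induction_on with
  | empty =>
    have := IsRealizable.const (0 : Matrix m k ℂ)
    rwa [Matrix.map_zero _ (map_zero _)] at this
  | insert a t ha ih =>
    rw [Finset.sum_insert ha]
    exact (h a (by simp)).add (ih fun i hi => h i (by simp [hi]))

/-- A rational function, as a matrix of size one. -/
def RatFunc.toMatrixUnit (f : RatFunc ℂ) : RationalMatrix Unit Unit := Matrix.of fun _ _ => f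

theorem RatFunc.isRealizable_C (a : ℂ) : IsRealizable (RatFunc.C a).toMatrixUnit :=
  IsRealizable.const (Matrix.of fun _ _ => a)

theorem RatFunc.isRealizable_add {f g : RatFunc ℂ} (hf : IsRealizable f.toMatrixUnit)
    (hg : IsRealizable g.toMatrixUnit) : IsRealizable (f + g).toMatrixUnit := hf.add hg

theorem RatFunc.isRealizable_mul {f g : RatFunc ℂ} (hf : IsRealizable f.toMatrixUnit)
    (hg : IsRealizable g.toMatrixUnit) : IsRealizable (f * g).toMatrixUnit := by
  have := hf.mul hg
  convert this using 1
  ext i j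
  simp [RatFunc.toMatrixUnit, Matrix.mul_apply]

theorem RatFunc.X_sub_C_ne_zero (a : ℂ) : (RatFunc.X - RatFunc.C a : RatFunc ℂ) ≠ 0 := by
  rw [← RatFunc.algebraMap_X, ← RatFunc.algebraMap_C, ← map_sub]
  exact RatFunc.algebraMap_ne_zero (Polynomial.X_sub_C_ne_zero a)

theorem RatFunc.isRealizable_inv_X_sub_C (a : ℂ) :
    IsRealizable ((RatFunc.X - RatFunc.C a : RatFunc ℂ)⁻¹).toMatrixUnit := by
  refine ⟨Unit, inferInstance, inferInstance, Matrix.of fun _ _ => a, 1, 1, 0, ?_⟩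
  rw [transferFunction_eq_of_pencil_mul
    (Y := Matrix.of fun _ _ => (RatFunc.X - RatFunc.C a : RatFunc ℂ)⁻¹)]
  · ext i j
    simp [RatFunc.toMatrixUnit]
  · ext i j
    simp [pencil, Matrix.mul_apply, mul_inv_cancel₀ (RatFunc.X_sub_C_ne_zero a)]

/-- Proper rational functions are realizable: split off the poles one at a time. -/
theorem RatFunc.isRealizable_div_prod (t : Multiset ℂ) {p : ℂ[X]}
    (hp : p.natDegree ≤ Multiset.card t) :
    IsRealizable (algebraMap ℂ[X] (RatFunc ℂ) p /
      (t.map fun a => (RatFunc.X - RatFunc.C a : RatFunc ℂ)).prod).toMatrixUnit := by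
  induction t using Multiset.induction_on generalizing p with
  | empty =>
    rw [Multiset.card_zero, Nat.le_zero, Polynomial.natDegree_eq_zero] at hp
    obtain ⟨c, rfl⟩ := hp
    simpa using RatFunc.isRealizable_C c
  | cons a t ih =>
    have hone : IsRealizable (algebraMap ℂ[X] (RatFunc ℂ) (Polynomial.C (p.eval a)) /
        (t.map fun a => (RatFunc.X - RatFunc.C a : RatFunc ℂ)).prod).toMatrixUnit :=
      ih (by simp)
    have hq : (p /ₘ (Polynomial.X - Polynomial.C a)).natDegree ≤ Multiset.card t := by
      rw [Polynomial.natDegree_divByMonic _ (Polynomial.monic_X_sub_C a),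
        Polynomial.natDegree_X_sub_C]
      rw [Multiset.card_cons] at hp
      omega
    have hdiv := Polynomial.modByMonic_add_div p (Polynomial.X - Polynomial.C a)
    rw [Polynomial.modByMonic_X_sub_C_eq_C_eval] at hdiv
    have h1 := RatFunc.isRealizable_add (ih hq)
      (RatFunc.isRealizable_mul (RatFunc.isRealizable_inv_X_sub_C a) hone)
    convert h1 using 2
    have hX := RatFunc.X_sub_C_ne_zero a
    have hP : (t.map fun a => (RatFunc.X - RatFunc.C a : RatFunc ℂ)).prod ≠ 0 := by
      rw [Ne, Multiset.prod_eq_zero_iff, Multiset.mem_map]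
      rintro ⟨b, _, hb⟩
      exact RatFunc.X_sub_C_ne_zero b hb
    conv_lhs => rw [← hdiv]
    simp only [Multiset.map_cons, Multiset.prod_cons, map_add, map_mul, map_sub,
      RatFunc.algebraMap_X, RatFunc.algebraMap_C]
    field_simp
    ring

theorem RatFunc.isRealizable_div {p q : ℂ[X]} (h : p.natDegree ≤ q.natDegree) :
    IsRealizable (algebraMap ℂ[X] (RatFunc ℂ) p / algebraMap ℂ[X] (RatFunc ℂ) q).toMatrixUnit := by
  have hs := IsAlgClosed.splits q
  have h1 := RatFunc.isRealizable_mul (RatFunc.isRealizable_C q.leadingCoeff⁻¹)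
    (RatFunc.isRealizable_div_prod q.roots (p := p) (by rwa [← hs.natDegree_eq_card_roots]))
  convert h1 using 2
  have h2 := congrArg (algebraMap ℂ[X] (RatFunc ℂ)) hs.eq_prod_roots
  rw [map_mul, map_multiset_prod, Multiset.map_map] at h2
  rw [h2, RatFunc.algebraMap_C, map_inv₀]
  have h3 : ((algebraMap ℂ[X] (RatFunc ℂ)) ∘ fun a => Polynomial.X - Polynomial.C a) =
      fun a => (RatFunc.X - RatFunc.C a : RatFunc ℂ) := by
    ext a
    simp
  rw [h3]
  field_simp

/-- A matrix with realizable entries is realizable, as the sum of its entries times matrix units. -/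
theorem isRealizable_of_entries [Fintype m] [Fintype k] {S : RationalMatrix m k}
    (h : ∀ i j, IsRealizable (S i j).toMatrixUnit) : IsRealizable S := by
  classical
  have hS : S = ∑ i, ∑ j, (Matrix.of fun i' (_ : Unit) => if i' = i then (1 : ℂ) else 0).map
      RatFunc.C * (S i j).toMatrixUnit *
      (Matrix.of fun (_ : Unit) j' => if j' = j then (1 : ℂ) else 0).map RatFunc.C := by
    ext i j
    simp [Matrix.sum_apply, Matrix.mul_apply, RatFunc.toMatrixUnit, apply_ite RatFunc.C]
  rw [hS]
  exact IsRealizable.sum _ fun i _ => IsRealizable.sum _ fun j _ =>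
    ((IsRealizable.const _).mul (h i j)).mul (IsRealizable.const _)

end Proper

section Bounds

open Complex

/-- A rational function whose reduced fraction satisfies `|num| ≤ c |denom|` at `s` has no pole
at `s`. -/
theorem RatFunc.eval_denom_ne_zero_of_norm_le {f : RatFunc ℂ} {s : ℂ} {c : ℝ}
    (h : ‖f.num.eval s‖ ≤ c * ‖f.denom.eval s‖) : f.denom.eval s ≠ 0 := by
  intro h0
  rw [h0, norm_zero, mul_zero, norm_le_zero_iff] at h
  obtain ⟨a, b, hab⟩ := RatFunc.isCoprime_num_denom f
  have := congrArg (Polynomial.eval s) hab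
  simp [h, h0] at this

theorem RatFunc.norm_num_le {f : RatFunc ℂ} {s v : ℂ} {c : ℝ} (hf : f.HasValue s v)
    (hv : ‖v‖ ≤ c) : ‖f.num.eval s‖ ≤ c * ‖f.denom.eval s‖ := by
  have h1 := hf.eval_eq
  rw [RatFunc.eval, Polynomial.eval₂_id, Polynomial.eval₂_id,
    div_eq_iff hf.eval_denom_ne_zero] at h1
  rw [h1, norm_mul]
  exact mul_le_mul_of_nonneg_right hv (norm_nonneg _)

theorem RatFunc.norm_num_le_axis {f : RatFunc ℂ} {c : ℝ}
    (h : ∀ᶠ ω : ℝ in cofinite, ∃ v, ‖v‖ ≤ c ∧ f.HasValue (I * ω) v) (ω : ℝ) :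
    ‖f.num.eval (I * ω)‖ ≤ c * ‖f.denom.eval (I * ω)‖ := by
  have hc : IsClosed {ω : ℝ | ‖f.num.eval (I * ω)‖ ≤ c * ‖f.denom.eval (I * ω)‖} :=
    isClosed_le (continuous_eval_axis _).norm (continuous_const.mul (continuous_eval_axis _).norm)
  have hd := (dense_of_eventually_cofinite (h.mono fun ω ⟨v, hv, hf⟩ =>
    RatFunc.norm_num_le hf hv)).closure_eq
  rw [hc.closure_eq] at hd
  have h2 : ω ∈ (Set.univ : Set ℝ) := trivial
  rwa [← hd] at h2

theorem tendsto_axis_cocompact : Tendsto (fun ω : ℝ => I * (ω : ℂ)) atTop (cocompact ℂ) := by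
  rw [← Metric.cobounded_eq_cocompact, ← tendsto_norm_atTop_iff_cobounded]
  simpa using tendsto_abs_atTop_atTop

/-- A rational function that is bounded on the imaginary axis is proper. -/
theorem RatFunc.natDegree_num_le {f : RatFunc ℂ} {c : ℝ}
    (h : ∀ ω : ℝ, ‖f.num.eval (I * ω)‖ ≤ c * ‖f.denom.eval (I * ω)‖) :
    f.num.natDegree ≤ f.denom.natDegree := by
  by_contra! hlt
  -- otherwise the polynomial part `p / q` is not constant, hence unbounded on the axis
  set p := f.num
  set q := f.denom
  have hq : q ≠ 0 := f.denom_ne_zero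
  have hdiv : q * (p / q) + p % q = p := EuclideanDomain.div_add_mod p q
  have hr : (p % q).natDegree ≤ q.natDegree := by
    by_cases h0 : p % q = 0
    · rw [h0]; simp
    · exact Polynomial.natDegree_le_natDegree (Polynomial.degree_mod_lt p hq).le
  have hu : 0 < (p / q).degree := by
    rw [← Polynomial.natDegree_pos_iff_degree_pos]
    by_contra! h0
    have h1 : p.natDegree ≤ q.natDegree := by
      rw [← hdiv]
      refine (Polynomial.natDegree_add_le _ _).trans (max_le ?_ hr)
      exact Polynomial.natDegree_mul_le.trans (by omega)
    omega
  obtain ⟨n, A, B, C, D, hR⟩ := (RatFunc.isRealizable_div hr).exists_hasRealizationOfSize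
  have hR : _ = transferFunction A B C D := hR
  have hT := tendsto_eval_transferFunction A B C D
  rw [← hR] at hT
  have hT := (tendsto_pi_nhds.1 (tendsto_pi_nhds.1 hT ()) ()).comp tendsto_axis_cocompact
  have hbd := hT.norm.add_const c
  have hinf := Polynomial.tendsto_norm_atTop (p / q) hu
    (tendsto_norm_cocompact_atTop.comp tendsto_axis_cocompact)
  have hq0 : ∀ᶠ ω : ℝ in atTop, q.eval (I * ω) ≠ 0 :=
    (Polynomial.eventually_eval_axis_ne_zero hq).filter_mono atTop_le_cofinite
  have hle : ∀ᶠ ω : ℝ in atTop, ‖(p / q).eval (I * ω)‖ ≤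
      ‖(RatFunc.toMatrixUnit (algebraMap ℂ[X] (RatFunc ℂ) (p % q) /
        algebraMap ℂ[X] (RatFunc ℂ) q) : RationalMatrix Unit Unit).eval (I * ω) () ()‖ + c := by
    filter_upwards [hq0] with ω hω
    have hv : (algebraMap ℂ[X] (RatFunc ℂ) (p % q) /
        algebraMap ℂ[X] (RatFunc ℂ) q).HasValue (I * ω) ((p % q).eval (I * ω) / q.eval (I * ω)) :=
      ⟨_, _, hω, rfl, rfl⟩
    have hv' : (RatFunc.toMatrixUnit (algebraMap ℂ[X] (RatFunc ℂ) (p % q) /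
        algebraMap ℂ[X] (RatFunc ℂ) q) : RationalMatrix Unit Unit).eval (I * ω) () () =
        (p % q).eval (I * ω) / q.eval (I * ω) := hv.eval_eq
    rw [hv']
    have h1 : (p / q).eval (I * ω) = p.eval (I * ω) / q.eval (I * ω) -
        (p % q).eval (I * ω) / q.eval (I * ω) := by
      have h2 := congrArg (Polynomial.eval (I * (ω : ℂ))) hdiv
      rw [Polynomial.eval_add, Polynomial.eval_mul] at h2
      rw [← h2]
      field_simp
      ring
    rw [h1]
    refine (norm_sub_le _ _).trans ?_
    rw [add_comm]
    gcongr
    rw [norm_div, div_le_iff₀ (norm_pos_iff.2 hω)]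
    exact h ω
  exact not_tendsto_nhds_of_tendsto_atTop (tendsto_atTop_mono' _ hle hinf) _ hbd

end Bounds

/-! ### Inner functions -/

section Inner

open Matrix Complex

variable {m k : Type*} [Fintype m] [DecidableEq m] [Fintype k] [DecidableEq k]

theorem not_isPole_iff_entry {M : RationalMatrix m k} {s : ℂ} :
    ¬ M.IsPole s ↔ ∀ i j, (M i j).denom.eval s ≠ 0 := by
  simp [RationalMatrix.IsPole]

/-- The matrix is unitary at all but finitely many points of the imaginary axis. -/
theorem eventually_unitary_axis {T : RationalMatrix m m} (hT : T * Tᴴ = 1) :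
    ∀ᶠ ω : ℝ in cofinite, ∃ V : Matrix m m ℂ, V * Vᴴ = 1 ∧ T.HasValue (I * ω) V := by
  have h : ∀ᶠ ω : ℝ in cofinite, ¬ T.IsPole (I * ω) :=
    I_mul_ofReal_injective.tendsto_cofinite.eventually T.finite_isPole.compl_mem_cofinite
  refine h.mono fun ω hω => ?_
  have hv := RationalMatrix.hasValue_eval hω
  have hv' := hv.conjTranspose
  rw [neg_star_I_mul] at hv'
  have h1 := hv.mul hv'
  rw [hT] at h1
  exact ⟨_, h1.unique RationalMatrix.HasValue.one, hv⟩

theorem norm_entry_le_one_of_unitary {V : Matrix m m ℂ} (hV : V * Vᴴ = 1) (i j : m) :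
    ‖V i j‖ ≤ 1 :=
  entry_norm_bound_of_unitary (Matrix.mem_unitaryGroup_iff.2 hV) i j

/-- A rational matrix that is unitary on the imaginary axis has no pole there. -/
theorem not_isPole_axis_of_mul_conjTranspose_eq_one {T : RationalMatrix m m} (hT : T * Tᴴ = 1)
    (ω : ℝ) : ¬ T.IsPole (I * ω) :=
  not_isPole_iff_entry.2 fun i j => RatFunc.eval_denom_ne_zero_of_norm_le <|
    RatFunc.norm_num_le_axis ((eventually_unitary_axis hT).mono fun _ ⟨V, hV, h⟩ =>
      ⟨V i j, norm_entry_le_one_of_unitary hV i j, h i j⟩) ω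

/-- A rational matrix that is unitary on the imaginary axis has a realization. -/
theorem exists_hasRealizationOfSize_of_mul_conjTranspose_eq_one {T : RationalMatrix m m}
    (hT : T * Tᴴ = 1) : ∃ n, T.HasRealizationOfSize n := by
  refine (isRealizable_of_entries fun i j => ?_).exists_hasRealizationOfSize
  have h := RatFunc.natDegree_num_le (f := T i j) (RatFunc.norm_num_le_axis
    ((eventually_unitary_axis hT).mono fun _ ⟨V, hV, h⟩ =>
      ⟨V i j, norm_entry_le_one_of_unitary hV i j, h i j⟩))
  have h1 := RatFunc.isRealizable_div h
  rwa [RatFunc.num_div_denom] at h1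

theorem RatFunc.differentiableAt_eval {f : RatFunc ℂ} {s : ℂ} (h : f.denom.eval s ≠ 0) :
    DifferentiableAt ℂ (fun z => f.eval (RingHom.id ℂ) z) s := by
  have h2 : (fun z => f.eval (RingHom.id ℂ) z) = fun z => f.num.eval z / f.denom.eval z := by
    ext z
    simp [RatFunc.eval, Polynomial.eval₂_id]
  rw [h2]
  exact (Polynomial.differentiable _ s).div (Polynomial.differentiable _ s) h

theorem norm_toEuclideanCLM_le_one_of_unitary {V : Matrix m m ℂ} (hV : V * Vᴴ = 1) :
    ‖Matrix.toEuclideanCLM (n := m) (𝕜 := ℂ) V‖ ≤ 1 := by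
  have h1 := CStarRing.norm_self_mul_star (x := Matrix.toEuclideanCLM (n := m) (𝕜 := ℂ) V)
  rw [← map_star, ← map_mul, Matrix.star_eq_conjTranspose, hV, map_one] at h1
  have h2 : ‖(1 : EuclideanSpace ℂ m →L[ℂ] EuclideanSpace ℂ m)‖ ≤ 1 :=
    ContinuousLinearMap.norm_id_le
  nlinarith [norm_nonneg (Matrix.toEuclideanCLM (n := m) (𝕜 := ℂ) V)]

theorem norm_sq_toLp (x : m → ℂ) : ((‖WithLp.toLp 2 x‖ ^ 2 : ℝ) : ℂ) = star x ⬝ᵥ x := by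
  rw [EuclideanSpace.norm_sq_eq]
  simp [dotProduct, Complex.conj_mul']

theorem posSemidef_one_sub_of_norm_le_one {V : Matrix m m ℂ}
    (h : ‖Matrix.toEuclideanCLM (n := m) (𝕜 := ℂ) V‖ ≤ 1) : (1 - V * Vᴴ).PosSemidef := by
  refine PosSemidef.of_dotProduct_mulVec_nonneg ?_ fun x => ?_
  · exact Matrix.isHermitian_one.sub (Matrix.isHermitian_mul_conjTranspose_self V)
  · have h1 : star x ⬝ᵥ (V * Vᴴ) *ᵥ x = star (Vᴴ *ᵥ x) ⬝ᵥ (Vᴴ *ᵥ x) := by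
      rw [← Matrix.mulVec_mulVec, Matrix.dotProduct_mulVec, Matrix.star_mulVec,
        Matrix.conjTranspose_conjTranspose]
    rw [Matrix.sub_mulVec, dotProduct_sub, h1, Matrix.one_mulVec, ← norm_sq_toLp, ← norm_sq_toLp,
      ← Complex.ofReal_sub]
    have h2 : ‖WithLp.toLp 2 (Vᴴ *ᵥ x)‖ ≤ ‖WithLp.toLp 2 x‖ := by
      have h3 : WithLp.toLp 2 (Vᴴ *ᵥ x) =
          star (Matrix.toEuclideanCLM (n := m) (𝕜 := ℂ) V) (WithLp.toLp 2 x) := by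
        rw [← map_star]
        rfl
      rw [h3]
      refine (ContinuousLinearMap.le_opNorm _ _).trans ?_
      have h5 : ‖star (Matrix.toEuclideanCLM (n := m) (𝕜 := ℂ) V)‖ ≤ 1 := by
        rw [ContinuousLinearMap.star_eq_adjoint, LinearIsometryEquiv.norm_map]
        exact h
      exact mul_le_of_le_one_left (norm_nonneg _) h5
    have h4 : 0 ≤ ‖WithLp.toLp 2 x‖ ^ 2 - ‖WithLp.toLp 2 (Vᴴ *ᵥ x)‖ ^ 2 := by
      have := norm_nonneg (WithLp.toLp 2 (Vᴴ *ᵥ x))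
      nlinarith
    exact_mod_cast h4

/-- A rational matrix that is unitary on the imaginary axis and holomorphic in the open right
half-plane is inner: contractivity follows from the Phragmén–Lindelöf principle. -/
theorem isInner_of_mul_conjTranspose_eq_one {T : RationalMatrix m m} (hT : T * Tᴴ = 1)
    (hol : ∀ s : ℂ, 0 < s.re → ¬ T.IsPole s) : T.IsInner := by
  have hol' : ∀ s : ℂ, 0 ≤ s.re → ¬ T.IsPole s := by
    intro s hs
    rcases hs.lt_or_eq with h | h
    · exact hol s h
    · have : s = I * (s.im : ℂ) := by
        apply Complex.ext <;> simp [← h]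
      rw [this]
      exact not_isPole_axis_of_mul_conjTranspose_eq_one hT _
  have hunit : ∀ ω : ℝ, T.eval (I * ω) * (T.eval (I * ω))ᴴ = 1 := by
    intro ω
    have hv := RationalMatrix.hasValue_eval
      (not_isPole_axis_of_mul_conjTranspose_eq_one hT ω)
    have hv' := hv.conjTranspose
    rw [neg_star_I_mul] at hv'
    have h1 := hv.mul hv'
    rw [hT] at h1
    exact h1.unique RationalMatrix.HasValue.one
  refine ⟨⟨hol, fun s hs => posSemidef_one_sub_of_norm_le_one ?_⟩, hunit⟩
  obtain ⟨n, A, B, C, D, hR⟩ := exists_hasRealizationOfSize_of_mul_conjTranspose_eq_one hT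
  have hR : T = transferFunction A B C D := hR
  have hlim := tendsto_eval_transferFunction A B C D
  rw [← hR] at hlim
  -- the Phragmén–Lindelöf principle, for the operator-valued function `s ↦ T(s)`
  let Λ : Matrix m m ℂ →L[ℂ] (EuclideanSpace ℂ m →L[ℂ] EuclideanSpace ℂ m) :=
    LinearMap.toContinuousLinearMap
      (Matrix.toEuclideanCLM (n := m) (𝕜 := ℂ)).toAlgEquiv.toLinearMap
  have hΛ : ∀ V, Λ V = Matrix.toEuclideanCLM (n := m) (𝕜 := ℂ) V := fun V => rfl
  let f : ℂ → (EuclideanSpace ℂ m →L[ℂ] EuclideanSpace ℂ m) := fun z => Λ (T.eval z)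
  have hflim : Tendsto f (cocompact ℂ) (𝓝 (Λ D)) := (Λ.continuous.tendsto D).comp hlim
  have hdiff : DiffContOnCl ℂ f {z | 0 < z.re} := by
    apply DifferentiableOn.diffContOnCl
    intro z hz
    rw [Complex.closure_setOfPred_lt_re] at hz
    have h1 : f = fun z => ∑ i, ∑ j, (T i j).eval (RingHom.id ℂ) z •
        Λ (Matrix.single i j 1) := by
      ext1 z
      simp only [f]
      conv_lhs => rw [Matrix.matrix_eq_sum_single (T.eval z)]
      rw [map_sum]
      refine Finset.sum_congr rfl fun i _ => ?_
      rw [map_sum]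
      refine Finset.sum_congr rfl fun j _ => ?_
      rw [← map_smul, Matrix.smul_single, smul_eq_mul, mul_one]
      rfl
    rw [h1]
    refine DifferentiableAt.differentiableWithinAt ?_
    refine DifferentiableAt.fun_sum fun i _ => DifferentiableAt.fun_sum fun j _ => ?_
    exact (RatFunc.differentiableAt_eval (not_isPole_iff_entry.1 (hol' z hz) i j)).smul_const _
  refine PhragmenLindelof.right_half_plane_of_bounded_on_real (f := f) hdiff ⟨0, by norm_num, 0, ?_⟩
    ?_ (fun x => ?_) hs.le
  · have h1 : f =O[Bornology.cobounded ℂ] fun _ => (1 : ℝ) := by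
      rw [Metric.cobounded_eq_cocompact]
      exact hflim.isBigO_one ℝ
    refine (h1.mono inf_le_left).congr_right fun z => ?_
    simp
  · have h1 : Tendsto (fun x : ℝ => (x : ℂ)) atTop (cocompact ℂ) := by
      rw [← Metric.cobounded_eq_cocompact, ← tendsto_norm_atTop_iff_cobounded]
      simpa using tendsto_abs_atTop_atTop
    exact (hflim.comp h1).norm.isBoundedUnder_le
  · rw [mul_comm]
    exact norm_toEuclideanCLM_le_one_of_unitary (hunit x)

theorem norm_entry_le_one_of_posSemidef {V : Matrix m k ℂ} (h : (1 - V * Vᴴ).PosSemidef)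
    (i : m) (j : k) : ‖V i j‖ ≤ 1 := by
  have h1 := h.diag_nonneg (i := i)
  rw [Matrix.sub_apply, Matrix.one_apply_eq, Matrix.mul_apply] at h1
  have h2 : ∑ j, V i j * Vᴴ j i = ((∑ j, ‖V i j‖ ^ 2 : ℝ) : ℂ) := by
    push_cast
    refine Finset.sum_congr rfl fun j _ => ?_
    rw [Matrix.conjTranspose_apply, Complex.star_def, Complex.mul_conj']
  rw [h2] at h1
  have h3 : 0 ≤ 1 - ∑ j, ‖V i j‖ ^ 2 := by exact_mod_cast h1
  have h4 : ‖V i j‖ ^ 2 ≤ ∑ j, ‖V i j‖ ^ 2 :=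
    Finset.single_le_sum (f := fun j => ‖V i j‖ ^ 2) (fun _ _ => by positivity) (Finset.mem_univ j)
  have h5 := norm_nonneg (V i j)
  nlinarith

/-- A Schur function has no pole in the closed right half-plane. -/
theorem RationalMatrix.IsSchur.not_isPole {S : RationalMatrix m k} (hS : S.IsSchur) {s : ℂ}
    (hs : 0 ≤ s.re) : ¬ S.IsPole s := by
  refine not_isPole_iff_entry.2 fun i j => ?_
  apply RatFunc.eval_denom_ne_zero_of_norm_le (c := 1)
  have hc : IsClosed {z : ℂ | ‖(S i j).num.eval z‖ ≤ 1 * ‖(S i j).denom.eval z‖} :=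
    isClosed_le (Polynomial.continuous _).norm
      (continuous_const.mul (Polynomial.continuous _).norm)
  have hsub : {z : ℂ | 0 < z.re} ⊆
      {z : ℂ | ‖(S i j).num.eval z‖ ≤ 1 * ‖(S i j).denom.eval z‖} := by
    intro z hz
    have hv := RationalMatrix.hasValue_eval (hS.holomorphic z hz)
    exact RatFunc.norm_num_le (hv i j) (norm_entry_le_one_of_posSemidef (hS.contractive z hz) i j)
  have h1 := hc.closure_subset_iff.2 hsub
  rw [Complex.closure_setOfPred_lt_re] at h1
  exact h1 hs

theorem RationalMatrix.IsInner.mul_conjTranspose {T : RationalMatrix m m} (hT : T.IsInner) :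
    T * Tᴴ = 1 := by
  have hZ : (Set.range fun ω : ℝ => I * (ω : ℂ)).Infinite :=
    Set.infinite_range_of_injective I_mul_ofReal_injective
  refine RationalMatrix.eq_of_infinite hZ ?_
  rintro _ ⟨ω, rfl⟩
  have hv := RationalMatrix.hasValue_eval (hT.schur.not_isPole (s := I * ω) (by simp))
  have hv' := hv.conjTranspose
  rw [neg_star_I_mul] at hv'
  have h1 := hv.mul hv'
  rw [hT.unitary ω] at h1
  exact ⟨1, h1, RationalMatrix.HasValue.one⟩

/-- Every eigenvalue of the state matrix of a reachable and observable realization is a pole of the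
transfer function: at a regular point `μ` all free responses are regular, whereas that of an
eigenvector `w` is `(s - μ)⁻¹ C w`. -/
theorem charpoly_eval_ne_zero_of_not_isPole {ι : Type*} [Fintype ι] [DecidableEq ι]
    {A : Matrix ι ι ℂ} {B : Matrix ι k ℂ} {C : Matrix m ι ℂ} {D : Matrix m k ℂ}
    (hobs : IsObservable A C) (hreach : IsReachable A B) {μ : ℂ}
    (hμ : ¬ (transferFunction A B C D).IsPole μ) : A.charpoly.eval μ ≠ 0 := by
  intro h0
  have hev : Module.End.HasEigenvalue (Matrix.toLin' A) μ := by
    rw [Module.End.hasEigenvalue_iff_isRoot_charpoly, Matrix.charpoly_toLin']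
    exact h0
  obtain ⟨w, hw⟩ := hev.exists_hasEigenvector
  have hAw : A *ᵥ w = μ • w := by simpa using hw.apply_eq_smul
  -- the states whose free response is regular at `μ`
  let V : Submodule ℂ (ι → ℂ) :=
    { carrier := {x | ∀ i, ∃ v, (freeResponse A C x i).HasValue μ v}
      add_mem' := fun {a b} ha hb i => by
        obtain ⟨v, hv⟩ := ha i
        obtain ⟨v', hv'⟩ := hb i
        exact ⟨v + v', by rw [map_add]; exact hv.add hv'⟩
      zero_mem' := fun i => ⟨0, by rw [map_zero]; exact RatFunc.HasValue.zero⟩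
      smul_mem' := fun c x hx i => by
        obtain ⟨v, hv⟩ := hx i
        refine ⟨c * v, ?_⟩
        rw [map_smul, Pi.smul_apply, RatFunc.smul_eq_C_mul]
        exact (RatFunc.HasValue.const c).mul hv }
  have hV : V = ⊤ := by
    apply hreach.eq_top
    · intro x hx i
      obtain ⟨v, hv⟩ := hx i
      refine ⟨μ * v - (C *ᵥ x) i, ?_⟩
      rw [freeResponse_mulVec]
      exact (RatFunc.HasValue.X.mul hv).sub (RatFunc.HasValue.const _)
    · intro u i
      have h1 : C.map RatFunc.C * ratResolvent A * B.map RatFunc.C =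
          transferFunction A B C D - D.map RatFunc.C := by
        rw [transferFunction, add_sub_cancel_right]
      have h2 := (RationalMatrix.hasValue_eval hμ).sub (RationalMatrix.HasValue.const D μ)
      rw [← h1] at h2
      rw [freeResponse_mulVec_input]
      simp only [Matrix.mulVec, dotProduct]
      exact ⟨_, RatFunc.HasValue.sum _ fun j _ => (h2 i j).mul (RatFunc.HasValue.const (u j))⟩
  have hwV : w ∈ V := by rw [hV]; trivial
  refine hw.2 (hobs μ w hAw ?_)
  ext i
  obtain ⟨v, hv⟩ := hwV i
  have h1 := congrFun (freeResponse_mulVec A C w) i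
  rw [hAw, map_smul, Pi.smul_apply, RatFunc.smul_eq_C_mul] at h1
  have h2 : RatFunc.C ((C *ᵥ w) i) =
      (RatFunc.X - RatFunc.C μ) * freeResponse A C w i := by
    rw [sub_mul, h1]
    simp
  have h3 := (RatFunc.HasValue.X.sub (RatFunc.HasValue.const μ)).mul hv
  rw [← h2, sub_self, zero_mul] at h3
  exact (RatFunc.HasValue.const _).unique h3

end Inner

/-! ### The Hamiltonian matrix, and existence of symmetric inner extensions -/

section Hamilton

open Matrix

variable {n : ℕ} {m : Type*} [Fintype m] [DecidableEq m]

/-- The determinant of `I - S S^*` in terms of the Hamiltonian matrix: the cascade realization of `I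
- S S^*` has the spectrum of `A` and `-A^*`, and that of its inverse has a state matrix similar to
the Hamiltonian matrix. -/
theorem det_one_sub_mul_conjTranspose (A : Matrix (Fin n) (Fin n) ℂ) (B : Matrix (Fin n) m ℂ)
    (C : Matrix m (Fin n) ℂ) {D : Matrix m m ℂ} (hD : IsUnit (1 - D * Dᴴ).det) :
    (1 - transferFunction A B C D * (transferFunction A B C D)ᴴ).det *
      (algebraMap ℂ[X] (RatFunc ℂ) A.charpoly * algebraMap ℂ[X] (RatFunc ℂ) (-Aᴴ).charpoly) =
    RatFunc.C (1 - D * Dᴴ).det *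
      algebraMap ℂ[X] (RatFunc ℂ) (hamiltonianMatrix A B C D).charpoly := by
  set E := (1 - D * Dᴴ)⁻¹ with hE
  have hE1 : (1 - D * Dᴴ) * E = 1 := Matrix.mul_nonsing_inv _ hD
  have hEh : Eᴴ = E := by
    rw [hE, Matrix.conjTranspose_nonsing_inv]
    simp
  -- the push-through identity
  have hF : (1 - Dᴴ * D)⁻¹ = 1 + Dᴴ * E * D := by
    apply Matrix.inv_eq_right_inv
    have : (1 - Dᴴ * D) * (1 + Dᴴ * E * D) = 1 - Dᴴ * D + Dᴴ * ((1 - D * Dᴴ) * E) * D := by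
      simp only [Matrix.mul_add, Matrix.sub_mul, Matrix.one_mul, Matrix.mul_one,
        Matrix.mul_sub, Matrix.mul_assoc]
    rw [this, hE1, Matrix.mul_one, sub_add_cancel]
  have hS : 1 - transferFunction A B C D * (transferFunction A B C D)ᴴ =
      transferFunction (fromBlocks A (B * -Bᴴ) 0 (-Aᴴ)) (fromRows (B * Dᴴ) Cᴴ)
        (-fromCols C (D * -Bᴴ)) (1 - D * Dᴴ) := by
    rw [transferFunction_conjTranspose, transferFunction_mul, transferFunction, transferFunction,
      Matrix.map_sub _ (map_sub _), Matrix.map_one _ (map_zero _) (map_one _),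
      Matrix.map_neg _ (map_neg _), Matrix.neg_mul, Matrix.neg_mul]
    abel
  have hdet := det_transferFunction (fromBlocks A (B * -Bᴴ) 0 (-Aᴴ)) (fromRows (B * Dᴴ) Cᴴ)
    (-fromCols C (D * -Bᴴ)) hE1
  rw [← hS, Matrix.charpoly_fromBlocks_zero₂₁, map_mul] at hdet
  rw [hdet]
  congr 2
  -- swapping the two halves of the state space turns the state matrix into the Hamiltonian matrix
  have hJ : (fromBlocks 0 (-1) 1 0 : Matrix (Fin n ⊕ Fin n) (Fin n ⊕ Fin n) ℂ) *
      fromBlocks 0 1 (-1) 0 = 1 := by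
    rw [fromBlocks_multiply]
    simp
  refine charpoly_eq_of_intertwine (M := fromBlocks 0 (-1) 1 0)
    (Matrix.isUnit_det_of_right_inverse hJ) ?_
  rw [Matrix.mul_neg _ (fromCols C (D * -Bᴴ)), sub_neg_eq_add, fromRows_mul,
    fromRows_mul_fromCols, fromBlocks_add,
    hamiltonianMatrix, hatA, ← hE, hF, fromBlocks_multiply, fromBlocks_multiply]
  simp only [Matrix.zero_mul, Matrix.mul_zero, Matrix.neg_mul, Matrix.mul_neg, Matrix.one_mul,
    Matrix.mul_one, zero_add, add_zero, neg_zero, Matrix.conjTranspose_add,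
    Matrix.conjTranspose_mul, hEh,
    Matrix.conjTranspose_conjTranspose, Matrix.mul_add, Matrix.add_mul, Matrix.mul_assoc, neg_add,
    neg_neg]

theorem isUnit_det_one_sub_mul_conjTranspose {D : Matrix m m ℂ}
    (h : ‖Matrix.toEuclideanCLM (n := m) (𝕜 := ℂ) D‖ < 1) : IsUnit (1 - D * Dᴴ).det := by
  rw [← Matrix.isUnit_iff_isUnit_det]
  set Λ := Matrix.toEuclideanCLM (n := m) (𝕜 := ℂ)
  have h1 : ‖Λ D * star (Λ D)‖ < 1 := by
    have h0 := CStarRing.norm_self_mul_star (x := Λ D)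
    rw [h0]
    nlinarith [norm_nonneg (Λ D)]
  have h2 := isUnit_one_sub_of_norm_lt_one h1
  have h3 : Λ (1 - D * Dᴴ) = 1 - Λ D * star (Λ D) := by
    rw [map_sub, map_one, map_mul, ← map_star]
    rfl
  rw [← h3] at h2
  have h4 := h2.map Λ.symm
  rwa [StarAlgEquiv.symm_apply_apply] at h4

end Hamilton

section Extension

open Matrix Complex

/-- The Darlington completion: from a spectral factor `R` of `I - S S^*` one obtains a symmetric
matrix that is unitary for the involution (on the imaginary axis, for rational functions). The
remaining block is `V = -Rᵀ S^* (R^*)⁻¹`, and `S = Sᵀ` makes it symmetric. -/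
theorem exists_symmetric_unitary_completion {F m : Type*} [Field F] [StarRing F] [Fintype m]
    [DecidableEq m] {S R : Matrix m m F} (hS : S.IsSymm) (hR : R * Rᴴ + S * Sᴴ = 1)
    (hdet : IsUnit R.det) : ∃ V : Matrix m m F, V.IsSymm ∧
      fromBlocks V Rᵀ R S * (fromBlocks V Rᵀ R S)ᴴ = 1 := by
  have hdet' : IsUnit Rᴴ.det := by
    rw [Matrix.det_conjTranspose]
    exact hdet.star
  have hYdet : IsUnit (Rᵀᴴ).det := by
    rw [Matrix.det_conjTranspose, Matrix.det_transpose]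
    exact hdet.star
  have hcomm : ∀ M : Matrix m m F, (Mᴴ)ᵀ = (Mᵀ)ᴴ := fun _ => rfl
  have hSh : (Sᴴ)ᵀ = Sᴴ := by
    rw [hcomm, hS.eq]
  have hYR : Rᵀᴴ * Rᵀ = 1 - Sᴴ * S := by
    have h1 := congrArg Matrix.transpose hR
    rw [Matrix.transpose_add, Matrix.transpose_mul, Matrix.transpose_mul, Matrix.transpose_one,
      hSh, hS.eq, hcomm] at h1
    rw [← h1, add_sub_cancel_right]
  have hRR : R * Rᴴ = 1 - S * Sᴴ := by rw [← hR, add_sub_cancel_right]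
  obtain ⟨V, hV⟩ : ∃ V : Matrix m m F, V * Rᴴ = -(Rᵀ * Sᴴ) := ⟨-(Rᵀ * Sᴴ) * (Rᴴ)⁻¹, by
    rw [Matrix.mul_assoc, Matrix.nonsing_inv_mul _ hdet', Matrix.mul_one]⟩
  have hcancel : ∀ X Z : Matrix m m F, X * Rᴴ = Z * Rᴴ → X = Z := by
    intro X Z h
    have := congrArg (· * (Rᴴ)⁻¹) h
    simpa only [Matrix.mul_assoc, Matrix.mul_nonsing_inv _ hdet', Matrix.mul_one] using this
  have hYV : Rᵀᴴ * V = -(Sᴴ * R) := by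
    apply hcancel
    rw [Matrix.mul_assoc, hV, Matrix.mul_neg, ← Matrix.mul_assoc, hYR, Matrix.neg_mul,
      Matrix.mul_assoc, hRR, Matrix.sub_mul, Matrix.mul_sub, Matrix.one_mul, Matrix.mul_one,
      Matrix.mul_assoc]
  have hVs : Vᵀ = V := by
    apply hcancel
    rw [hV]
    have h1 := congrArg Matrix.transpose hYV
    rw [Matrix.transpose_mul, Matrix.transpose_neg, Matrix.transpose_mul, hSh,
      hcomm, Matrix.transpose_transpose] at h1
    exact h1
  have hVh : R * Vᴴ = -(S * Rᵀᴴ) := by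
    have h1 := congrArg Matrix.conjTranspose hV
    rwa [Matrix.conjTranspose_mul, Matrix.conjTranspose_conjTranspose, Matrix.conjTranspose_neg,
      Matrix.conjTranspose_mul, Matrix.conjTranspose_conjTranspose] at h1
  have h11 : V * Vᴴ + Rᵀ * Rᵀᴴ = 1 := by
    have h1 : Rᵀᴴ * (V * Vᴴ + Rᵀ * Rᵀᴴ) = Rᵀᴴ * 1 := by
      rw [Matrix.mul_add, ← Matrix.mul_assoc, hYV, Matrix.neg_mul, Matrix.mul_assoc, hVh,
        ← Matrix.mul_assoc (Rᵀᴴ), hYR, Matrix.sub_mul, Matrix.mul_neg, neg_neg, Matrix.one_mul,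
        Matrix.mul_one, Matrix.mul_assoc, add_sub_cancel]
    have := congrArg ((Rᵀᴴ)⁻¹ * ·) h1
    simpa only [← Matrix.mul_assoc, Matrix.nonsing_inv_mul _ hYdet, Matrix.one_mul] using this
  refine ⟨V, hVs, ?_⟩
  rw [fromBlocks_conjTranspose, fromBlocks_multiply, h11, hV, hVh, hR, neg_add_cancel,
    neg_add_cancel, fromBlocks_one]

/-- A scalar Blaschke product cancels the poles in the open right half-plane of all fractions with
a given denominator: `b = d / d^*`, where `d` collects the roots there. -/
theorem exists_blaschke {q : ℂ[X]} (hq : q ≠ 0) : ∃ b : RatFunc ℂ, b * star b = 1 ∧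
    (∀ s : ℂ, 0 < s.re → ∃ v, b.HasValue s v) ∧ ∀ (p : ℂ[X]) (s : ℂ), 0 < s.re →
      ∃ v, (b * (algebraMap ℂ[X] (RatFunc ℂ) p / algebraMap ℂ[X] (RatFunc ℂ) q)).HasValue s v := by
  classical
  have hs := (IsAlgClosed.splits q).eq_prod_roots
  rw [← Multiset.filter_add_not (fun a : ℂ => 0 < a.re) q.roots, Multiset.map_add,
    Multiset.prod_add] at hs
  set d := ((q.roots.filter fun a : ℂ => 0 < a.re).map fun a =>
    Polynomial.X - Polynomial.C a).prod with hd
  set e := ((q.roots.filter fun a : ℂ => ¬ 0 < a.re).map fun a =>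
    Polynomial.X - Polynomial.C a).prod with he
  have hprod : ∀ (t : Multiset ℂ) (s : ℂ),
      ((t.map fun a => Polynomial.X - Polynomial.C a).prod).eval s = 0 → s ∈ t := by
    intro t s h
    rw [Polynomial.eval_multiset_prod, Multiset.prod_eq_zero_iff, Multiset.map_map,
      Multiset.mem_map] at h
    obtain ⟨a, ha, h0⟩ := h
    simp only [Function.comp_apply, Polynomial.eval_sub, Polynomial.eval_X, Polynomial.eval_C,
      sub_eq_zero] at h0
    rwa [h0]
  have hd0 : d ≠ 0 := by
    rintro h
    rw [h] at hs
    simp at hs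
    exact hq hs
  have hds : ∀ s : ℂ, 0 < s.re → (polyParaConj d).eval s ≠ 0 := by
    intro s hre h
    rw [eval_polyParaConj, star_eq_zero] at h
    have := (Multiset.mem_filter.1 (hprod _ _ h)).2
    simp at this
    linarith
  have hes : ∀ s : ℂ, 0 < s.re → e.eval s ≠ 0 := fun s hre h =>
    (Multiset.mem_filter.1 (hprod _ _ h)).2 hre
  have hda : algebraMap ℂ[X] (RatFunc ℂ) d ≠ 0 := RatFunc.algebraMap_ne_zero hd0
  have hda' : algebraMap ℂ[X] (RatFunc ℂ) (polyParaConj d) ≠ 0 :=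
    RatFunc.algebraMap_ne_zero (polyParaConj_ne_zero hd0)
  have hlc : q.leadingCoeff ≠ 0 := Polynomial.leadingCoeff_ne_zero.2 hq
  refine ⟨algebraMap ℂ[X] (RatFunc ℂ) d / algebraMap ℂ[X] (RatFunc ℂ) (polyParaConj d), ?_,
    fun s hre => ⟨_, d, polyParaConj d, hds s hre, rfl, rfl⟩, fun p s hre => ?_⟩
  · rw [star_div₀, star_algebraMap, star_algebraMap, polyParaConj_polyParaConj]
    field_simp
  · refine ⟨_, p, polyParaConj d * (Polynomial.C q.leadingCoeff * e), ?_, ?_, rfl⟩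
    · simp only [Polynomial.eval_mul, Polynomial.eval_C]
      exact mul_ne_zero (hds s hre) (mul_ne_zero hlc (hes s hre))
    · have he0 : algebraMap ℂ[X] (RatFunc ℂ) e ≠ 0 := by
        refine RatFunc.algebraMap_ne_zero ?_
        rintro h
        exact hes 1 (by simp) (by rw [h, Polynomial.eval_zero])
      have hc0 : algebraMap ℂ[X] (RatFunc ℂ) (Polynomial.C q.leadingCoeff) ≠ 0 :=
        RatFunc.algebraMap_ne_zero (Polynomial.C_ne_zero.2 hlc)
      have hqe : algebraMap ℂ[X] (RatFunc ℂ) q =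
          algebraMap ℂ[X] (RatFunc ℂ) (Polynomial.C q.leadingCoeff) *
            (algebraMap ℂ[X] (RatFunc ℂ) d * algebraMap ℂ[X] (RatFunc ℂ) e) := by
        rw [← map_mul, ← map_mul, ← hs]
      rw [hqe]
      simp only [map_mul]
      field_simp

/-- On the imaginary axis a Schur function is contractive, by continuity. -/
theorem RationalMatrix.IsSchur.posSemidef_axis {m : Type*} [Fintype m] [DecidableEq m]
    {S : RationalMatrix m m} (hS : S.IsSchur) (ω : ℝ) :
    (1 - S.eval (I * ω) * (S.eval (I * ω))ᴴ).PosSemidef := by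
  refine PosSemidef.of_dotProduct_mulVec_nonneg ?_ fun x => ?_
  · exact Matrix.isHermitian_one.sub (Matrix.isHermitian_mul_conjTranspose_self _)
  have hc : ContinuousAt (fun s => S.eval s) (I * ω) := by
    refine continuousAt_pi.2 fun i => continuousAt_pi.2 fun j => ?_
    exact (RatFunc.differentiableAt_eval
      (not_isPole_iff_entry.1 (hS.not_isPole (s := I * ω) (by simp)) i j)).continuousAt
  have hg : Continuous fun V : Matrix m m ℂ => star x ⬝ᵥ ((1 - V * Vᴴ) *ᵥ x) := by fun_prop
  have hlim := (hg.continuousAt.comp hc).tendsto.mono_left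
    (nhdsWithin_le_nhds (s := {z : ℂ | 0 < z.re}))
  have hne : (𝓝[{z : ℂ | 0 < z.re}] (I * (ω : ℂ))).NeBot := by
    rw [← mem_closure_iff_nhdsWithin_neBot, Complex.closure_setOfPred_lt_re]
    simp
  refine ge_of_tendsto hlim ?_
  filter_upwards [self_mem_nhdsWithin] with s hs
  exact (hS.contractive s hs).dotProduct_mulVec_nonneg x

/-- Every symmetric Schur function with `det (I - S S^*) ≠ 0` has a symmetric inner extension: a
Darlington completion `T₀`, multiplied on both sides by `diag (b I, I)` with a scalar Blaschke
product `b`, which removes the poles in the right half-plane and keeps the block `S`. -/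
theorem exists_isSymmetricInnerExtension {p : ℕ} {S : RationalMatrix (Fin p) (Fin p)}
    (hS : S.IsSchur) (hsymm : S.IsSymm) (hdet : (1 - S * Sᴴ).det ≠ 0) :
    ∃ T, S.IsSymmetricInnerExtension T := by
  have hval : ∀ ω : ℝ, (1 - S * Sᴴ).HasValue (I * ω)
      (1 - S.eval (I * ω) * (S.eval (I * ω))ᴴ) := by
    intro ω
    have hv := RationalMatrix.hasValue_eval (hS.not_isPole (s := I * ω) (by simp))
    have hv' := hv.conjTranspose
    rw [neg_star_I_mul] at hv'
    exact RationalMatrix.HasValue.one.sub (hv.mul hv')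
  have hdetv : ∀ᶠ ω : ℝ in cofinite, (1 - S.eval (I * ω) * (S.eval (I * ω))ᴴ).det ≠ 0 := by
    have h1 : ∀ᶠ ω : ℝ in cofinite, ¬ (RationalMatrix.IsPole (1 - S * Sᴴ)⁻¹ (I * ω)) :=
      I_mul_ofReal_injective.tendsto_cofinite.eventually
        (RationalMatrix.finite_isPole _).compl_mem_cofinite
    filter_upwards [h1] with ω hω
    have h2 := (hval ω).mul (RationalMatrix.hasValue_eval hω)
    rw [Matrix.mul_nonsing_inv _ hdet.isUnit] at h2
    exact (Matrix.isUnit_det_of_right_inverse (h2.unique RationalMatrix.HasValue.one)).ne_zero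
  obtain ⟨R, hR⟩ := RationalMatrix.exists_eq_mul_conjTranspose (Φ := 1 - S * Sᴴ) (by
    filter_upwards [hdetv] with ω hω
    refine ⟨_, ?_, hval ω⟩
    exact ((hS.posSemidef_axis ω).posDef_iff_isUnit).2
      ((Matrix.isUnit_iff_isUnit_det _).2 hω.isUnit))
  have hRdet : IsUnit R.det := by
    rw [isUnit_iff_ne_zero]
    intro h0
    rw [hR, Matrix.det_mul, h0, zero_mul] at hdet
    exact hdet rfl
  obtain ⟨V, hVs, hV⟩ := exists_symmetric_unitary_completion hsymm
    (by rw [← hR, sub_add_cancel]) hRdet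
  set T₀ : RationalMatrix (Fin p ⊕ Fin p) (Fin p ⊕ Fin p) := fromBlocks V Rᵀ R S with hT₀
  -- a common denominator
  let q : ℂ[X] := ∏ i, ∏ j, (T₀ i j).denom
  have hq : q ≠ 0 := Finset.prod_ne_zero_iff.2 fun i _ => Finset.prod_ne_zero_iff.2 fun j _ =>
    RatFunc.denom_ne_zero _
  obtain ⟨b, hb, hbv, hbq⟩ := exists_blaschke hq
  have hbT : ∀ i j (s : ℂ), 0 < s.re → ∃ v, (b * T₀ i j).HasValue s v := by
    intro i j s hs
    obtain ⟨r, hr⟩ : (T₀ i j).denom ∣ q :=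
      (Finset.dvd_prod_of_mem (fun j => (T₀ i j).denom) (Finset.mem_univ j)).trans
        (Finset.dvd_prod_of_mem (fun i => ∏ j, (T₀ i j).denom) (Finset.mem_univ i))
    have hr0 : r ≠ 0 := by
      rintro rfl
      rw [mul_zero] at hr
      exact hq hr
    obtain ⟨v, hv⟩ := hbq ((T₀ i j).num * r) s hs
    refine ⟨v, ?_⟩
    rwa [hr, map_mul, map_mul, mul_div_mul_right _ _ (RatFunc.algebraMap_ne_zero hr0),
      RatFunc.num_div_denom] at hv
  let Δ : RationalMatrix (Fin p ⊕ Fin p) (Fin p ⊕ Fin p) :=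
    fromBlocks (b • (1 : Matrix (Fin p) (Fin p) (RatFunc ℂ))) 0 0 1
  have hΔ : Δ * Δᴴ = 1 := by
    rw [fromBlocks_conjTranspose, fromBlocks_multiply]
    simp [smul_smul, mul_comm (star b) b, hb]
  have hT : Δ * T₀ * Δ = fromBlocks (b • (b • V)) (b • Rᵀ) (b • R) S := by
    rw [hT₀, fromBlocks_multiply, fromBlocks_multiply]
    simp
  have hTT : Δ * T₀ * Δ * (Δ * T₀ * Δ)ᴴ = 1 := by
    rw [Matrix.conjTranspose_mul, Matrix.mul_assoc (Δ * T₀), ← Matrix.mul_assoc Δ Δᴴ, hΔ,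
      Matrix.one_mul, Matrix.conjTranspose_mul, Matrix.mul_assoc, ← Matrix.mul_assoc T₀, hV,
      Matrix.one_mul, hΔ]
  refine ⟨Δ * T₀ * Δ, isInner_of_mul_conjTranspose_eq_one hTT fun s hs => ?_, ?_, ?_⟩
  · rw [hT]
    refine not_isPole_iff_entry.2 fun i j => ?_
    obtain ⟨w, hw⟩ := hbv s hs
    rcases i with i | i <;> rcases j with j | j
    · obtain ⟨v, hv⟩ := hbT (Sum.inl i) (Sum.inl j) s hs
      exact (hw.mul hv).eval_denom_ne_zero
    · obtain ⟨v, hv⟩ := hbT (Sum.inl i) (Sum.inr j) s hs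
      exact hv.eval_denom_ne_zero
    · obtain ⟨v, hv⟩ := hbT (Sum.inr i) (Sum.inl j) s hs
      exact hv.eval_denom_ne_zero
    · exact not_isPole_iff_entry.1 (hS.holomorphic s hs) i j
  · rw [hT, Matrix.IsSymm, fromBlocks_transpose]
    simp [hVs.eq, hsymm.eq]
  · rw [hT, toBlocks_fromBlocks₂₂]

end Extension

/-! ### Lossless state spaces and Blaschke–Potapov factors -/

section Lossless

open Matrix

variable {ι m : Type*} [Fintype ι] [DecidableEq ι] [Fintype m] [DecidableEq m]

theorem one_eq_transferFunction : (1 : RationalMatrix m m) =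
    transferFunction (0 : Matrix Empty Empty ℂ) 0 0 1 := by
  rw [transferFunction, Matrix.map_one _ (map_zero _) (map_one _)]
  ext i j
  simp

/-- The value at infinity of a rational matrix that is unitary on the imaginary axis is unitary. -/
theorem mul_conjTranspose_eq_one_of_transferFunction {A : Matrix ι ι ℂ} {B : Matrix ι m ℂ}
    {C : Matrix m ι ℂ} {D : Matrix m m ℂ}
    (hT : transferFunction A B C D * (transferFunction A B C D)ᴴ = 1) : D * Dᴴ = 1 := by
  rw [transferFunction_conjTranspose, transferFunction_mul, one_eq_transferFunction] at hT
  exact (transferFunction_inj hT).1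

/-- The lossless state space: the inverse and the para-Hermitian conjugate of `T` are equal, so
that their minimal realizations are similar. -/
theorem exists_lossless_intertwiner {A : Matrix ι ι ℂ} {B : Matrix ι m ℂ} {C : Matrix m ι ℂ}
    {D : Matrix m m ℂ} (hobs : IsObservable A C) (hreach : IsReachable A B)
    (hT : transferFunction A B C D * (transferFunction A B C D)ᴴ = 1) :
    ∃ M : Matrix ι ι ℂ, IsUnit M.det ∧ M * (A - B * Dᴴ * C) = -Aᴴ * M ∧ M * (B * Dᴴ) = Cᴴ ∧
      Bᴴ * M = Dᴴ * C ∧ IsReachable (A - B * Dᴴ * C) (B * Dᴴ) := by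
  have hD := mul_conjTranspose_eq_one_of_transferFunction hT
  have hinv : transferFunction (A - B * Dᴴ * C) (B * Dᴴ) (-(Dᴴ * C)) Dᴴ =
      transferFunction (-Aᴴ) Cᴴ (-Bᴴ) Dᴴ := by
    rw [← transferFunction_conjTranspose]
    have h1 := transferFunction_mul_inverse A B C hD
    calc _ = (transferFunction A B C D)ᴴ * transferFunction A B C D *
          transferFunction (A - B * Dᴴ * C) (B * Dᴴ) (-(Dᴴ * C)) Dᴴ := by
            rw [mul_eq_one_comm.1 hT, Matrix.one_mul]
      _ = _ := by rw [Matrix.mul_assoc, h1, Matrix.mul_one]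
  have hobs' : IsObservable (A - B * Dᴴ * C) (-(Dᴴ * C)) := by
    intro μ w hA hC
    have h1 : C *ᵥ w = 0 := by
      rw [Matrix.neg_mulVec, neg_eq_zero, ← Matrix.mulVec_mulVec] at hC
      rw [← Matrix.one_mulVec (C *ᵥ w), ← hD, ← Matrix.mulVec_mulVec, hC, Matrix.mulVec_zero]
    refine hobs μ w ?_ h1
    rwa [Matrix.sub_mulVec, ← Matrix.mulVec_mulVec, h1, Matrix.mulVec_zero, sub_zero] at hA
  have hreach' : IsReachable (A - B * Dᴴ * C) (B * Dᴴ) := by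
    intro μ w hA hB
    have h1 : Bᵀ *ᵥ w = 0 := by
      rw [Matrix.transpose_mul, ← Matrix.mulVec_mulVec] at hB
      have hDt : Dᵀ * Dᴴᵀ = 1 := by
        rw [← Matrix.transpose_mul, mul_eq_one_comm.1 hD, Matrix.transpose_one]
      rw [← Matrix.one_mulVec (Bᵀ *ᵥ w), ← hDt, ← Matrix.mulVec_mulVec, hB, Matrix.mulVec_zero]
    refine hreach μ w ?_ h1
    rwa [Matrix.transpose_sub, Matrix.sub_mulVec, Matrix.transpose_mul, Matrix.transpose_mul,
      ← Matrix.mulVec_mulVec, ← Matrix.mulVec_mulVec, h1, Matrix.mulVec_zero, Matrix.mulVec_zero,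
      sub_zero] at hA
  have hobs'' : IsObservable (-Aᴴ) (-Bᴴ) := by
    intro μ w hA hB
    have h1 : Bᵀ *ᵥ star w = 0 := by
      rw [Matrix.neg_mulVec, neg_eq_zero] at hB
      have := congrArg star hB
      rwa [Matrix.star_mulVec, Matrix.conjTranspose_conjTranspose, star_zero,
        ← Matrix.mulVec_transpose] at this
    have h2 : Aᵀ *ᵥ star w = (-star μ) • star w := by
      rw [Matrix.neg_mulVec, neg_eq_iff_eq_neg] at hA
      have := congrArg star hA
      rw [Matrix.star_mulVec, Matrix.conjTranspose_conjTranspose,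
        ← Matrix.mulVec_transpose] at this
      rw [this, star_neg, star_smul, neg_smul]
    exact star_eq_zero.1 (hreach _ _ h2 h1)
  obtain ⟨M, hM, h1, h2, h3⟩ :=
    exists_isUnit_intertwiner (transferFunction_inj hinv).2 hobs' hreach' hobs''
  refine ⟨M, hM, h1, h2, ?_, hreach'⟩
  rwa [Matrix.neg_mul, neg_inj] at h3

/-- For a symmetric realization the lossless intertwiner is complex orthogonal. -/
theorem lossless_intertwiner_transpose_mul_self {A : Matrix ι ι ℂ} {B : Matrix ι m ℂ}
    {C : Matrix m ι ℂ} {D : Matrix m m ℂ} (hA : A.IsSymm) (hC : C = Bᵀ) (hD : D.IsSymm)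
    {M : Matrix ι ι ℂ} (hM : IsUnit M.det)
    (hMA : M * (A - B * Dᴴ * C) = -Aᴴ * M) (hMB : M * (B * Dᴴ) = Cᴴ) (hMC : Bᴴ * M = Dᴴ * C)
    (hreach : IsReachable (A - B * Dᴴ * C) (B * Dᴴ)) : Mᵀ * M = 1 := by
  have hMt : IsUnit (Mᵀ).det := by rwa [Matrix.det_transpose]
  have hN : (Mᵀ)⁻¹ * Mᵀ = 1 := Matrix.nonsing_inv_mul _ hMt
  have hN' : Mᵀ * (Mᵀ)⁻¹ = 1 := Matrix.mul_nonsing_inv _ hMt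
  have hDh : (Dᴴ)ᵀ = Dᴴ := by
    rw [show (Dᴴ)ᵀ = (Dᵀ)ᴴ from rfl, hD.eq]
  have hAh : (Aᴴ)ᵀ = Aᴴ := by
    rw [show (Aᴴ)ᵀ = (Aᵀ)ᴴ from rfl, hA.eq]
  have hCt : Cᵀ = B := by rw [hC, Matrix.transpose_transpose]
  have h1 : (A - B * Dᴴ * C) * Mᵀ = Mᵀ * -Aᴴ := by
    have := congrArg Matrix.transpose hMA
    rw [Matrix.transpose_mul, Matrix.transpose_mul, Matrix.transpose_neg, hAh,
      Matrix.transpose_sub, Matrix.transpose_mul, Matrix.transpose_mul, hDh, hCt, ← hC, hA.eq,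
      ← Matrix.mul_assoc] at this
    exact this
  have h2 : Mᵀ * Cᴴ = B * Dᴴ := by
    have := congrArg Matrix.transpose hMC
    rw [Matrix.transpose_mul, Matrix.transpose_mul, hDh, hCt,
      show (Bᴴ)ᵀ = (Bᵀ)ᴴ from rfl, ← hC] at this
    exact this
  have h3 : M = (Mᵀ)⁻¹ := by
    refine eq_of_intertwine hreach hMA hMB ?_ ?_
    · calc (Mᵀ)⁻¹ * (A - B * Dᴴ * C) = (Mᵀ)⁻¹ * ((A - B * Dᴴ * C) * Mᵀ) * (Mᵀ)⁻¹ := by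
            rw [← Matrix.mul_assoc, Matrix.mul_assoc _ Mᵀ, hN', Matrix.mul_one]
        _ = -Aᴴ * (Mᵀ)⁻¹ := by
            rw [h1, ← Matrix.mul_assoc, hN, Matrix.one_mul]
    · rw [← h2, ← Matrix.mul_assoc, hN, Matrix.one_mul]
  calc Mᵀ * M = Mᵀ * (Mᵀ)⁻¹ := by rw [← h3]
    _ = 1 := hN'

theorem map_mul_ratResolvent_left (A : Matrix ι ι ℂ) :
    A.map RatFunc.C * ratResolvent A = (RatFunc.X : RatFunc ℂ) • ratResolvent A - 1 := by
  rw [map_mul_ratResolvent (M := A) (A' := A) rfl, ratResolvent_mul_map]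

theorem map_ratFuncC_smul {k l : Type*} (c : ℂ) (M : Matrix k l ℂ) :
    (c • M).map RatFunc.C = RatFunc.C c • M.map RatFunc.C := by
  ext i j
  simp

/-- The elementary Blaschke–Potapov factor `I + α (s + conj μ)⁻¹ e e^*`. The vector `e` is a matrix
with one column, and is not normalized. -/
noncomputable def blaschkePotapov (μ α : ℂ) (e : Matrix m Unit ℂ) : RationalMatrix m m :=
  1 + (RatFunc.C α / (RatFunc.X + RatFunc.C (star μ))) • (e * eᴴ).map RatFunc.C

theorem X_add_C_ne_zero (a : ℂ) : (RatFunc.X + RatFunc.C a : RatFunc ℂ) ≠ 0 := by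
  simpa using RatFunc.X_sub_C_ne_zero (-a)

/-- A Blaschke–Potapov factor is unitary on the imaginary axis if `α = -(μ + conj μ) / (e^* e)`. -/
theorem blaschkePotapov_mul_conjTranspose {μ α ε : ℂ} {e : Matrix m Unit ℂ}
    (he : eᴴ * e = ε • 1) (hα : star α = α) (hαε : (μ + star μ) + α * ε = 0) :
    blaschkePotapov μ α e * (blaschkePotapov μ α e)ᴴ = 1 := by
  set P := (e * eᴴ).map RatFunc.C with hP
  have hPh : Pᴴ = P := by
    rw [hP, conjTranspose_map_ratFuncC, Matrix.conjTranspose_mul,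
      Matrix.conjTranspose_conjTranspose]
  have hPP : P * P = RatFunc.C ε • P := by
    rw [hP, ← Matrix.map_mul, ← map_ratFuncC_smul]
    congr 1
    rw [Matrix.mul_assoc, ← Matrix.mul_assoc eᴴ, he, Matrix.smul_mul, Matrix.one_mul,
      Matrix.mul_smul]
  have h1 := X_add_C_ne_zero (star μ)
  have h2 : (-RatFunc.X + RatFunc.C μ : RatFunc ℂ) ≠ 0 := by
    rw [← neg_ne_zero]
    simpa [sub_eq_add_neg, add_comm] using RatFunc.X_sub_C_ne_zero μ
  set a := RatFunc.C α / (RatFunc.X + RatFunc.C (star μ)) with ha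
  have hstar : star a = RatFunc.C α / (-RatFunc.X + RatFunc.C μ) := by
    rw [ha, star_div₀, star_add, star_ratFuncX, star_ratFuncC, star_ratFuncC, hα, star_star]
  have hsum : star a + a + a * star a * RatFunc.C ε = 0 := by
    rw [hstar, ha]
    have h3 := congrArg (RatFunc.C : ℂ → RatFunc ℂ) hαε
    rw [map_add, map_add, map_mul, map_zero] at h3
    field_simp
    linear_combination RatFunc.C α * h3
  rw [blaschkePotapov, ← hP, ← ha, Matrix.conjTranspose_add, Matrix.conjTranspose_one,
    Matrix.conjTranspose_smul, hPh, Matrix.mul_add, Matrix.mul_one, Matrix.add_mul, Matrix.one_mul,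
    Matrix.smul_mul, Matrix.mul_smul, hPP, smul_smul, smul_smul, add_assoc, ← add_smul, ← add_smul]
  rw [show a + (star a + a * star a * RatFunc.C ε) = star a + a + a * star a * RatFunc.C ε by
    ring, hsum, zero_smul, add_zero]

/-- Dividing a symmetric lossless transfer function on both sides by a Blaschke–Potapov factor: if
the factor belongs to an isotropic eigenvector `W` of `A`, the state space can be kept, and `W`
becomes unobservable. -/
theorem blaschkePotapov_mul_transferFunction_mul {A : Matrix ι ι ℂ} {B : Matrix ι m ℂ}
    {C : Matrix m ι ℂ} {D : Matrix m m ℂ} (hA : A.IsSymm) (hC : C = Bᵀ) (hD : D.IsSymm)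
    {Q : Matrix ι ι ℂ} (hQA : Q * A + Aᴴ * Q + Cᴴ * C = 0) (hQB : Q * B + Cᴴ * D = 0)
    (hQQ : Q * Qᵀ = 1) {W : Matrix ι Unit ℂ} {μ : ℂ} (hW : A * W = μ • W) (hiso : Wᵀ * W = 0)
    (α : ℂ) :
    blaschkePotapov μ α (C * W) * transferFunction A B C D * (blaschkePotapov μ α (C * W))ᵀ =
      transferFunction A (C - α • (C * W * (Wᴴ * Q)))ᵀ (C - α • (C * W * (Wᴴ * Q))) D := by
  obtain ⟨e, he⟩ : ∃ e, e = C * W := ⟨_, rfl⟩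
  obtain ⟨g, hg⟩ : ∃ g, g = Wᴴ * Q := ⟨_, rfl⟩
  rw [← he, ← hg]
  have hCt : Cᵀ = B := by rw [hC, Matrix.transpose_transpose]
  have heC : eᴴ * C = -(g * A + star μ • g) := by
    have h1 := congrArg (Wᴴ * ·) hQA
    simp only [Matrix.mul_add, Matrix.mul_zero] at h1
    have h2 : Wᴴ * Aᴴ = star μ • Wᴴ := by
      rw [← Matrix.conjTranspose_mul, hW, Matrix.conjTranspose_smul]
    rw [← Matrix.mul_assoc, ← Matrix.mul_assoc, h2, Matrix.smul_mul, ← hg,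
      ← Matrix.mul_assoc, ← Matrix.conjTranspose_mul, ← he] at h1
    exact eq_neg_of_add_eq_zero_right h1
  have heD : eᴴ * D = -(g * B) := by
    have h1 := congrArg (Wᴴ * ·) hQB
    simp only [Matrix.mul_add, Matrix.mul_zero] at h1
    rw [← Matrix.mul_assoc, ← Matrix.mul_assoc, ← hg, ← Matrix.conjTranspose_mul, ← he] at h1
    exact eq_neg_of_add_eq_zero_right h1
  have hgg : g * gᵀ = 0 := by
    rw [hg, Matrix.transpose_mul, Matrix.mul_assoc, ← Matrix.mul_assoc Q, hQQ, Matrix.one_mul,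
      show (Wᴴ)ᵀ = (Wᵀ)ᴴ from rfl, ← Matrix.conjTranspose_mul, hiso, Matrix.conjTranspose_zero]
  have hBe : B * (eᴴ)ᵀ = -(A * gᵀ + star μ • gᵀ) := by
    have h1 := congrArg Matrix.transpose heC
    rwa [Matrix.transpose_mul, hCt, Matrix.transpose_neg, Matrix.transpose_add,
      Matrix.transpose_mul, hA.eq, Matrix.transpose_smul] at h1
  have hDe : D * (eᴴ)ᵀ = -(C * gᵀ) := by
    have h1 := congrArg Matrix.transpose heD
    rwa [Matrix.transpose_mul, hD.eq, Matrix.transpose_neg, Matrix.transpose_mul, ← hC] at h1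
  obtain ⟨C', hC'⟩ : ∃ C', C' = C - α • (e * g) := ⟨_, rfl⟩
  rw [← hC']
  have hC'g : C' * gᵀ = C * gᵀ := by
    rw [hC', Matrix.sub_mul, Matrix.smul_mul, Matrix.mul_assoc, hgg, Matrix.mul_zero, smul_zero,
      sub_zero]
  have hC't : C'ᵀ = B - α • (gᵀ * eᵀ) := by
    rw [hC', Matrix.transpose_sub, hCt, Matrix.transpose_smul, Matrix.transpose_mul]
  obtain ⟨x, hx⟩ : ∃ x : RatFunc ℂ, x = RatFunc.X + RatFunc.C (star μ) := ⟨_, rfl⟩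
  have hx0 : x ≠ 0 := hx ▸ X_add_C_ne_zero _
  -- the left factor
  have hleft : blaschkePotapov μ α e * transferFunction A B C D = transferFunction A B C' D := by
    have h1 : (eᴴ).map RatFunc.C * transferFunction A B C D =
        -(x • (g.map RatFunc.C * ratResolvent A * B.map RatFunc.C)) := by
      rw [transferFunction, Matrix.mul_add, ← Matrix.map_mul, heD, ← Matrix.mul_assoc,
        ← Matrix.mul_assoc, ← Matrix.map_mul, heC, Matrix.map_neg _ (map_neg _),
        Matrix.map_neg _ (map_neg _), Matrix.map_add _ (map_add _), map_ratFuncC_smul,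
        Matrix.map_mul, Matrix.map_mul, Matrix.neg_mul, Matrix.add_mul, Matrix.mul_assoc,
        map_mul_ratResolvent_left, hx, Matrix.mul_sub, Matrix.mul_one, Matrix.mul_smul,
        Matrix.smul_mul, add_smul, Matrix.neg_mul, Matrix.add_mul, Matrix.sub_mul,
        Matrix.smul_mul, Matrix.smul_mul]
      abel
    rw [blaschkePotapov, ← hx, Matrix.add_mul, Matrix.one_mul, Matrix.smul_mul, Matrix.map_mul,
      Matrix.mul_assoc, h1, Matrix.mul_neg, Matrix.mul_smul, smul_neg, smul_smul,
      div_mul_cancel₀ _ hx0, transferFunction, transferFunction, hC',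
      Matrix.map_sub _ (map_sub _), map_ratFuncC_smul, Matrix.map_mul, Matrix.sub_mul,
      Matrix.sub_mul, Matrix.smul_mul, Matrix.smul_mul]
    simp only [Matrix.mul_assoc]
    abel
  rw [hleft]
  -- the right factor; on the isotropic vector `g` the output matrices `C` and `C'` agree
  have h1 : transferFunction A B C' D * ((eᴴ)ᵀ).map RatFunc.C =
      -(x • (C'.map RatFunc.C * ratResolvent A * gᵀ.map RatFunc.C)) := by
    have h2 : ratResolvent A * (A.map RatFunc.C * gᵀ.map RatFunc.C) =
        (RatFunc.X : RatFunc ℂ) • (ratResolvent A * gᵀ.map RatFunc.C) - gᵀ.map RatFunc.C := by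
      rw [← Matrix.mul_assoc, ratResolvent_mul_map, Matrix.sub_mul, Matrix.one_mul,
        Matrix.smul_mul]
    rw [transferFunction, Matrix.add_mul, ← Matrix.map_mul, hDe, ← hC'g, Matrix.mul_assoc,
      ← Matrix.map_mul, hBe, Matrix.map_neg _ (map_neg _), Matrix.map_neg _ (map_neg _),
      Matrix.map_add _ (map_add _), map_ratFuncC_smul, Matrix.map_mul, Matrix.map_mul,
      Matrix.mul_neg, Matrix.mul_assoc, Matrix.mul_add (ratResolvent A), h2, Matrix.mul_smul,
      Matrix.mul_add,
      Matrix.mul_sub, Matrix.mul_smul, Matrix.mul_smul, hx, add_smul]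
    simp only [Matrix.mul_assoc]
    abel
  have h3 : (blaschkePotapov μ α e)ᵀ = 1 + (RatFunc.C α / x) •
      (((eᴴ)ᵀ).map RatFunc.C * eᵀ.map RatFunc.C) := by
    rw [blaschkePotapov, ← hx, Matrix.transpose_add, Matrix.transpose_one, Matrix.transpose_smul,
      ← Matrix.transpose_map, Matrix.transpose_mul, Matrix.map_mul]
  rw [h3, Matrix.mul_add, Matrix.mul_one, Matrix.mul_smul, ← Matrix.mul_assoc, h1, Matrix.neg_mul,
    Matrix.smul_mul, smul_neg, smul_smul, div_mul_cancel₀ _ hx0, transferFunction,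
    transferFunction, hC't, Matrix.map_sub _ (map_sub _), map_ratFuncC_smul, Matrix.map_mul,
    Matrix.mul_sub, Matrix.mul_smul]
  simp only [Matrix.mul_assoc]
  abel

end Lossless

/-! ### Degree reduction by an isotropic eigenvector -/

section Reduction

open Matrix

variable {p N : ℕ}

/-- The state matrix of a minimal realization of an inner function has no eigenvalue in the closed
right half-plane. -/
theorem RationalMatrix.IsInner.charpoly_eval_ne_zero {m : Type*} [Fintype m] [DecidableEq m]
    {T : RationalMatrix m m} (hT : T.IsInner) {A : Matrix (Fin N) (Fin N) ℂ}
    {B : Matrix (Fin N) m ℂ} {C : Matrix m (Fin N) ℂ} {D : Matrix m m ℂ}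
    (hmin : T.IsMinimalRealization A B C D) {s : ℂ} (hs : 0 ≤ s.re) : A.charpoly.eval s ≠ 0 := by
  refine charpoly_eval_ne_zero_of_not_isPole (D := D) hmin.isObservable hmin.isReachable ?_
  rw [← hmin.eq_transferFunction]
  exact hT.schur.not_isPole hs

/-- An eigenvector of the state matrix that is isotropic and invisible in the given block allows
to split off a Blaschke–Potapov factor, that is, to lower the degree of the extension. -/
theorem RationalMatrix.IsSymmetricInnerExtension.exists_smaller
    {S : RationalMatrix (Fin p) (Fin p)} {T : RationalMatrix (Fin p ⊕ Fin p) (Fin p ⊕ Fin p)}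
    (hT : S.IsSymmetricInnerExtension T) {A : Matrix (Fin N) (Fin N) ℂ}
    {B : Matrix (Fin N) (Fin p ⊕ Fin p) ℂ} {C : Matrix (Fin p ⊕ Fin p) (Fin N) ℂ}
    {D : Matrix (Fin p ⊕ Fin p) (Fin p ⊕ Fin p) ℂ} (hmin : T.IsMinimalRealization A B C D)
    (hsym : IsSymmetricRealization A B C D) {μ : ℂ} {w : Fin N → ℂ} (hw : w ≠ 0)
    (hA : A *ᵥ w = μ • w) (hC : ∀ j, (C *ᵥ w) (Sum.inr j) = 0) (hiso : w ⬝ᵥ w = 0) :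
    ∃ T', S.IsSymmetricInnerExtension T' ∧ T'.HasRealizationOfSize (N - 1) := by
  obtain ⟨hAs, hCB, hDs⟩ := hsym
  have hTT := hT.inner.mul_conjTranspose
  have htf := hmin.eq_transferFunction
  rw [htf] at hTT
  have hDD := mul_conjTranspose_eq_one_of_transferFunction hTT
  obtain ⟨M, hM, hMA, hMB, hMC, hr⟩ :=
    exists_lossless_intertwiner hmin.isObservable hmin.isReachable hTT
  have hMM := lossless_intertwiner_transpose_mul_self hAs hCB hDs hM hMA hMB hMC hr
  -- with `Q = -M`, the equations of a lossless system
  have hQA : -M * A + Aᴴ * -M + Cᴴ * C = 0 := by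
    rw [Matrix.mul_sub, ← Matrix.mul_assoc, hMB] at hMA
    rw [sub_eq_iff_eq_add.1 hMA |> congrArg Neg.neg |> (Matrix.neg_mul M A).trans, Matrix.mul_neg,
      Matrix.neg_mul]
    abel
  have hQB : -M * B + Cᴴ * D = 0 := by
    have h1 := congrArg (· * D) hMB
    simp only [Matrix.mul_assoc, mul_eq_one_comm.1 hDD, Matrix.mul_one] at h1
    rw [← h1, Matrix.neg_mul, neg_add_cancel]
  have hQQ : -M * (-M)ᵀ = 1 := by
    rw [Matrix.transpose_neg, neg_mul_neg, mul_eq_one_comm.1 hMM]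
  set W : Matrix (Fin N) Unit ℂ := Matrix.of fun i _ => w i with hWdef
  have hAW : A * W = μ • W := by
    ext i j
    simpa [Matrix.mul_apply, Matrix.mulVec, dotProduct, hWdef] using congrFun hA i
  have hWW : Wᵀ * W = 0 := by
    ext i j
    simpa [Matrix.mul_apply, dotProduct, hWdef] using hiso
  set ε : ℂ := star (C *ᵥ w) ⬝ᵥ (C *ᵥ w) with hε
  have hε0 : ε ≠ 0 := fun h => hw (hmin.isObservable μ w hA (dotProduct_star_self_eq_zero.1 h))
  have hεs : star ε = ε := by
    rw [hε, ← Matrix.star_dotProduct_star, star_star]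
  have heW : ∀ i j, (C * W) i j = (C *ᵥ w) i := fun i j => by
    simp [Matrix.mul_apply, Matrix.mulVec, dotProduct, hWdef]
  have hee : (C * W)ᴴ * (C * W) = ε • 1 := by
    ext i j
    rw [Matrix.mul_apply]
    simp only [Matrix.conjTranspose_apply, heW]
    simp [hε, dotProduct]
  set α : ℂ := -(μ + star μ) / ε with hα
  have hαs : star α = α := by
    rw [hα, star_div₀, hεs, star_neg, star_add, star_star, add_comm (star μ)]
  have hαε : (μ + star μ) + α * ε = 0 := by
    rw [hα, div_mul_cancel₀ _ hε0, add_neg_cancel]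
  have hF := blaschkePotapov_mul_conjTranspose hee hαs hαε
  have hprod := blaschkePotapov_mul_transferFunction_mul hAs hCB hDs hQA hQB hQQ hAW hWW α
  set F := blaschkePotapov μ α (C * W) with hFdef
  set C' := C - α • (C * W * (Wᴴ * -M)) with hC'
  -- the factor makes `w` unobservable
  have hgW : (μ + star μ) • (Wᴴ * -M * W) = -(ε • 1) := by
    have h1 := congrArg (fun X => Wᴴ * X * W) hQA
    simp only [Matrix.mul_add, Matrix.add_mul, Matrix.mul_zero, Matrix.zero_mul] at h1
    have h2 : Wᴴ * (-M * A) * W = μ • (Wᴴ * -M * W) := by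
      rw [Matrix.mul_assoc, Matrix.mul_assoc, hAW, Matrix.mul_smul, Matrix.mul_smul,
        ← Matrix.mul_assoc]
    have h3 : Wᴴ * (Aᴴ * -M) * W = star μ • (Wᴴ * -M * W) := by
      rw [← Matrix.mul_assoc, ← Matrix.conjTranspose_mul, hAW, Matrix.conjTranspose_smul,
        Matrix.smul_mul, Matrix.smul_mul]
    have h4 : Wᴴ * (Cᴴ * C) * W = ε • 1 := by
      rw [← hee, Matrix.conjTranspose_mul]
      simp only [Matrix.mul_assoc]
    rw [h2, h3, h4, ← add_smul] at h1
    exact eq_neg_of_add_eq_zero_left h1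
  have hC'W : C' * W = 0 := by
    have h1 : α • (Wᴴ * -M * W) = 1 := by
      rw [hα, neg_div, neg_smul, div_eq_inv_mul, mul_smul, hgW, smul_neg, neg_neg, smul_smul,
        inv_mul_cancel₀ hε0, one_smul]
    rw [hC', Matrix.sub_mul, Matrix.smul_mul, Matrix.mul_assoc _ _ W, ← Matrix.mul_smul, h1,
      Matrix.mul_one, sub_self]
  have hC'w : C' *ᵥ w = 0 := by
    ext i
    simpa [Matrix.mul_apply, Matrix.mulVec, dotProduct, hWdef] using congrFun (congrFun hC'W i) ()
  refine ⟨F * transferFunction A B C D * Fᵀ, ⟨?_, ?_, ?_⟩, ?_⟩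
  · apply isInner_of_mul_conjTranspose_eq_one
    · have h1 : Fᵀ * Fᵀᴴ = 1 := by
        rw [show Fᵀᴴ = Fᴴᵀ from rfl, ← Matrix.transpose_mul, mul_eq_one_comm.1 hF,
          Matrix.transpose_one]
      rw [Matrix.conjTranspose_mul, Matrix.conjTranspose_mul]
      calc _ = F * (transferFunction A B C D * (Fᵀ * Fᵀᴴ) * (transferFunction A B C D)ᴴ) * Fᴴ := by
            simp only [Matrix.mul_assoc]
        _ = 1 := by rw [h1, Matrix.mul_one, hTT, Matrix.mul_one, hF]
    · intro s hs
      rw [hprod]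
      exact (hasValue_transferFunction (hT.inner.charpoly_eval_ne_zero hmin hs.le) _ _ _).not_isPole
  · rw [hprod, Matrix.IsSymm, transferFunction_transpose, hAs.eq, hDs.eq,
      Matrix.transpose_transpose]
  -- the lower rows of the factor are those of the identity, as `C w` vanishes there
  · have hrow : ∀ i k, F (Sum.inr i) k = (1 : RationalMatrix (Fin p ⊕ Fin p) _) (Sum.inr i) k := by
      intro i k
      rw [hFdef, blaschkePotapov, Matrix.add_apply, Matrix.smul_apply, Matrix.map_apply,
        Matrix.mul_apply (M := C * W)]
      simp [heW, hC]
    rw [← hT.extends_block, htf]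
    ext i j
    simp [Matrix.toBlocks₂₂, Matrix.mul_apply, hrow, Matrix.one_apply]
  · rw [hprod]
    exact RationalMatrix.HasRealizationOfSize.of_not_isObservable _ _ hw hA hC'w

end Reduction

/-! ### Simplicity of the additional spectrum -/

section Multiplicity

open Matrix

theorem LinearMap.charpoly_eq_restrict_mul_mapQ {K V : Type*} [Field K] [Infinite K]
    [AddCommGroup V] [Module K V] [Module.Finite K V] {W : Submodule K V} (f : V →ₗ[K] V)
    (hf : W ≤ W.comap f) :
    f.charpoly = (f.restrict hf).charpoly * (W.mapQ W f hf).charpoly := by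
  refine Polynomial.funext fun t => ?_
  have ht : W ≤ W.comap (algebraMap K (Module.End K V) t - f) := fun x hx => by
    simpa [Module.algebraMap_end_apply] using W.sub_mem (W.smul_mem t hx) (hf hx)
  rw [Polynomial.eval_mul, LinearMap.eval_charpoly, LinearMap.eval_charpoly,
    LinearMap.eval_charpoly, LinearMap.det_eq_det_mul_det W _ ht]
  congr 2
  ext x
  simp [Module.algebraMap_end_apply]

variable {ι ι' m k : Type*} [Fintype ι] [DecidableEq ι] [Fintype ι'] [DecidableEq ι']

/-- A surjective intertwiner splits the characteristic polynomial. -/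
theorem charpoly_eq_restrict_ker_mul {A : Matrix ι ι ℂ} {A' : Matrix ι' ι' ℂ} {M : Matrix ι' ι ℂ}
    (h : M * A = A' * M) (hM : Function.Surjective (Matrix.mulVecLin M)) {W : Submodule ℂ (ι → ℂ)}
    (hW : W = LinearMap.ker (Matrix.mulVecLin M)) (hA : ∀ x ∈ W, Matrix.mulVecLin A x ∈ W) :
    A.charpoly = ((Matrix.mulVecLin A).restrict hA).charpoly * A'.charpoly := by
  subst hW
  have h1 := LinearMap.charpoly_eq_restrict_mul_mapQ (Matrix.mulVecLin A) hA
  have h2 := LinearEquiv.charpoly_conj ((Matrix.mulVecLin M).quotKerEquivOfSurjective hM)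
    (Submodule.mapQ _ _ (Matrix.mulVecLin A) hA)
  have h3 : ((Matrix.mulVecLin M).quotKerEquivOfSurjective hM).conj
      (Submodule.mapQ _ _ (Matrix.mulVecLin A) hA) = Matrix.mulVecLin A' := by
    refine LinearMap.ext fun y => ?_
    obtain ⟨x, rfl⟩ := hM y
    have h4 : ((Matrix.mulVecLin M).quotKerEquivOfSurjective hM).symm (Matrix.mulVecLin M x) =
        Submodule.Quotient.mk x := by
      rw [LinearEquiv.symm_apply_eq]
      rfl
    rw [LinearEquiv.conj_apply_apply, h4, Submodule.mapQ_apply]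
    change M *ᵥ (A *ᵥ x) = A' *ᵥ (M *ᵥ x)
    rw [Matrix.mulVec_mulVec, Matrix.mulVec_mulVec, h]
  rw [h3] at h2
  have h4 : (Matrix.mulVecLin A).charpoly = A.charpoly := Matrix.charpoly_toLin' A
  have h5 : (Matrix.mulVecLin A').charpoly = A'.charpoly := Matrix.charpoly_toLin' A'
  rw [h4] at h1
  rw [h5] at h2
  rw [h1, ← h2]

/-- A complex symmetric matrix without isotropic eigenvectors in an invariant subspace has only
simple eigenvalues there: two independent eigenvectors have an isotropic combination, and the
eigenvector at the bottom of a Jordan chain is isotropic. -/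
theorem rootMultiplicity_charpoly_restrict_le_one {A : Matrix ι ι ℂ} (hA : A.IsSymm)
    {W : Submodule ℂ (ι → ℂ)} (hW : ∀ x ∈ W, Matrix.mulVecLin A x ∈ W)
    (hiso : ∀ (μ : ℂ) (w : ι → ℂ), w ∈ W → A *ᵥ w = μ • w → w ⬝ᵥ w = 0 → w = 0) (μ : ℂ) :
    ((Matrix.mulVecLin A).restrict hW).charpoly.rootMultiplicity μ ≤ 1 := by
  set f : Module.End ℂ W := (Matrix.mulVecLin A).restrict hW with hf
  have hf' : ∀ x : W, ((f x : W) : ι → ℂ) = A *ᵥ x := fun x => rfl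
  have hsymm : ∀ x y : ι → ℂ, (A *ᵥ x) ⬝ᵥ y = x ⬝ᵥ (A *ᵥ y) := by
    intro x y
    rw [Matrix.dotProduct_mulVec, ← Matrix.mulVec_transpose, hA.eq]
  have h2 : ∀ x : W, (f - algebraMap ℂ _ μ) ((f - algebraMap ℂ _ μ) x) = 0 →
      (f - algebraMap ℂ _ μ) x = 0 := by
    intro x hx
    set y := (f - algebraMap ℂ _ μ) x with hy
    have hy1 : (y : ι → ℂ) = A *ᵥ x - μ • (x : ι → ℂ) := rfl
    have hy2 : A *ᵥ (y : ι → ℂ) = μ • (y : ι → ℂ) :=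
      sub_eq_zero.1 (congrArg Subtype.val hx)
    refine Subtype.ext (hiso μ y y.2 hy2 ?_)
    calc (y : ι → ℂ) ⬝ᵥ y = (A *ᵥ x - μ • (x : ι → ℂ)) ⬝ᵥ (y : ι → ℂ) := by rw [← hy1]
      _ = 0 := by
        rw [sub_dotProduct, hsymm, hy2, smul_dotProduct, dotProduct_smul, sub_self]
  have hpow : ∀ (l : ℕ) (x : W), ((f - algebraMap ℂ _ μ) ^ l) x = 0 →
      (f - algebraMap ℂ _ μ) x = 0 := by
    intro l
    induction l with
    | zero =>
      intro x hx
      rw [show x = 0 from hx, map_zero]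
    | succ l ih =>
      intro x hx
      rw [pow_succ] at hx
      exact h2 x (ih _ hx)
  have heig : ∀ x ∈ f.maxGenEigenspace μ, A *ᵥ (x : ι → ℂ) = μ • (x : ι → ℂ) := by
    intro x hx
    obtain ⟨l, hl⟩ := (Module.End.mem_maxGenEigenspace f μ x).1 hx
    exact sub_eq_zero.1 (congrArg Subtype.val (hpow l x hl))
  rw [← LinearMap.finrank_maxGenEigenspace_eq]
  by_cases h0 : ∀ x : f.maxGenEigenspace μ, x = 0
  · refine finrank_le_one 0 fun x => ⟨0, ?_⟩
    rw [h0 x, smul_zero]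
  push Not at h0
  obtain ⟨u, hu⟩ := h0
  have huu : ((u : W) : ι → ℂ) ⬝ᵥ ((u : W) : ι → ℂ) ≠ 0 := by
    intro h
    exact hu (Subtype.ext (Subtype.ext (hiso μ _ u.1.2 (heig _ u.2) h)))
  refine finrank_le_one u fun v => ?_
  set a := ((u : W) : ι → ℂ) with ha
  set b := ((v : W) : ι → ℂ) with hb
  obtain ⟨t, ht⟩ := exists_quadratic_eq_zero huu (b := 2 * (a ⬝ᵥ b)) (c := b ⬝ᵥ b)
    ⟨_, (IsAlgClosed.exists_pow_nat_eq _ two_pos).choose_spec.symm.trans (sq _)⟩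
  have hz : b + t • a = 0 := by
    have hmem : b + t • a ∈ W := W.add_mem v.1.2 (W.smul_mem t u.1.2)
    refine hiso μ _ hmem ?_ ?_
    · rw [Matrix.mulVec_add, Matrix.mulVec_smul, heig _ v.2, heig _ u.2, smul_add, smul_comm]
    · rw [add_dotProduct, dotProduct_add, dotProduct_add, smul_dotProduct, smul_dotProduct,
        dotProduct_smul, dotProduct_smul, dotProduct_comm b a]
      simp only [smul_eq_mul]
      linear_combination ht
  refine ⟨-t, Subtype.ext (Subtype.ext ?_)⟩
  change -t • a = b
  rw [neg_smul, eq_comm]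
  exact eq_neg_of_add_eq_zero_left hz

theorem freeResponse_eq_zero_of_eigenvector {A : Matrix ι ι ℂ} {C : Matrix m ι ℂ} {μ : ℂ}
    {w : ι → ℂ} (hA : A *ᵥ w = μ • w) (hC : C *ᵥ w = 0) : freeResponse A C w = 0 := by
  have h1 := freeResponse_mulVec A C w
  rw [hA, hC, map_smul] at h1
  ext i
  have h2 := congrFun h1 i
  simp only [Pi.smul_apply, Pi.sub_apply, Function.comp_apply, Pi.zero_apply, map_zero, sub_zero,
    smul_eq_mul] at h2
  have h3 : (RatFunc.X - RatFunc.C μ) * freeResponse A C w i = 0 := by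
    rw [sub_mul, sub_eq_zero, ← h2, RatFunc.smul_eq_C_mul]
  exact (mul_eq_zero.1 h3).resolve_left (RatFunc.X_sub_C_ne_zero μ)

/-- A symmetric state space without isotropic unobservable eigenvectors exceeds the minimal one by
a block with simple spectrum: every state is then a sum of a reachable and an unobservable one, so
that the minimal state space is the quotient by the unobservable states. -/
theorem exists_charpoly_eq_mul [Fintype m] {A : Matrix ι ι ℂ} {B : Matrix ι m ℂ} {C : Matrix m ι ℂ}
    {A' : Matrix ι' ι' ℂ} {B' : Matrix ι' m ℂ} {C' : Matrix m ι' ℂ} (hA : A.IsSymm) (hC : C = Bᵀ)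
    (hT : C.map RatFunc.C * ratResolvent A * B.map RatFunc.C =
      C'.map RatFunc.C * ratResolvent A' * B'.map RatFunc.C)
    (hobs : IsObservable A' C') (hreach : IsReachable A' B')
    (hiso : ∀ (μ : ℂ) (w : ι → ℂ), A *ᵥ w = μ • w → C *ᵥ w = 0 → w ⬝ᵥ w = 0 → w = 0) :
    ∃ q : ℂ[X], A.charpoly = q * A'.charpoly ∧ ∀ μ, q.rootMultiplicity μ ≤ 1 := by
  obtain ⟨M, hMA, hMB, hMC, hM0⟩ := exists_intertwiner hT hobs (by
    intro V hV hBV hkV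
    by_contra hne
    -- an annihilating left eigenvector is, by symmetry, an unobservable right eigenvector, hence
    -- in `V`, hence isotropic
    obtain ⟨μ, z, hz0, hz, hzV⟩ := exists_left_eigenvector hV hne
    rw [hA.eq] at hz
    have hCz : C *ᵥ z = 0 := by
      rw [hC, Matrix.mulVec_transpose]
      refine dotProduct_eq _ _ fun u => ?_
      rw [← Matrix.dotProduct_mulVec, hzV _ (hBV u), zero_dotProduct]
    exact hz0 (hiso μ z hz hCz (hzV z (hkV z (freeResponse_eq_zero_of_eigenvector hz hCz)))))
  have hsurj : Function.Surjective (Matrix.mulVecLin M) := by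
    rw [← LinearMap.range_eq_top]
    refine hreach.eq_top ?_ fun u => ⟨B *ᵥ u, ?_⟩
    · rintro _ ⟨x, rfl⟩
      refine ⟨A *ᵥ x, ?_⟩
      simp only [Matrix.mulVecLin_apply, Matrix.mulVec_mulVec, hMA]
    · rw [Matrix.mulVecLin_apply, Matrix.mulVec_mulVec, hMB]
  have hW : ∀ x ∈ LinearMap.ker (Matrix.mulVecLin M),
      Matrix.mulVecLin A x ∈ LinearMap.ker (Matrix.mulVecLin M) := by
    intro x hx
    rw [LinearMap.mem_ker, Matrix.mulVecLin_apply] at hx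
    rw [LinearMap.mem_ker, Matrix.mulVecLin_apply, Matrix.mulVecLin_apply, Matrix.mulVec_mulVec,
      hMA, ← Matrix.mulVec_mulVec, hx, Matrix.mulVec_zero]
  refine ⟨_, charpoly_eq_restrict_ker_mul hMA hsurj rfl hW,
    rootMultiplicity_charpoly_restrict_le_one hA hW fun μ w hw hAw hww => hiso μ w hAw ?_ hww⟩
  rw [LinearMap.mem_ker, Matrix.mulVecLin_apply] at hw
  rw [← hMC, ← Matrix.mulVec_mulVec, hw, Matrix.mulVec_zero]

end Multiplicity

/-! ### Counting odd roots -/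

section Count

open Matrix

theorem rootMultiplicity_polyParaConj_le_one {q : ℂ[X]} (hq0 : q ≠ 0)
    (hq : ∀ μ, q.rootMultiplicity μ ≤ 1) (s : ℂ) : (polyParaConj q).rootMultiplicity s ≤ 1 := by
  by_contra! h
  have h1 := (Polynomial.le_rootMultiplicity_iff (polyParaConj_ne_zero hq0)).1 h
  have h2 := map_dvd polyParaConj h1
  rw [polyParaConj_polyParaConj, map_pow, map_sub, polyParaConj_X, polyParaConj_C] at h2
  have h3 : (-Polynomial.X - Polynomial.C (star s) : ℂ[X]) =
      -(Polynomial.X - Polynomial.C (-star s)) := by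
    rw [Polynomial.C_neg]; ring
  rw [h3, neg_sq] at h2
  have := (Polynomial.le_rootMultiplicity_iff hq0).2 h2
  exact absurd (hq (-star s)) (by omega)

/-- If `q` has simple roots, all in the left half-plane, and `q^* q h` is a square, then the odd
roots of `h` in the right half-plane are the mirror images of the roots of `q`. -/
theorem numOddRootsRightHalfPlane_eq_natDegree {q h : ℂ[X]} (hq0 : q ≠ 0) (hh : h ≠ 0)
    (hq : ∀ μ, q.rootMultiplicity μ ≤ 1) (hroot : ∀ s, q.IsRoot s → s.re < 0) {c : ℂ}
    (hc : c ≠ 0) {g : RatFunc ℂ}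
    (hg : algebraMap ℂ[X] (RatFunc ℂ) (Polynomial.C c * polyParaConj q * q * h) = g ^ 2) :
    numOddRootsRightHalfPlane h = q.natDegree := by
  have hpoly : Polynomial.C c * polyParaConj q * q * h * g.denom ^ 2 = g.num ^ 2 := by
    apply RatFunc.algebraMap_injective ℂ
    have hd : algebraMap ℂ[X] (RatFunc ℂ) g.denom ≠ 0 := by simpa using g.denom_ne_zero
    rw [map_mul, hg, map_pow, map_pow, ← mul_pow]
    nth_rw 1 [← RatFunc.num_div_denom g]
    rw [div_mul_cancel₀ _ hd]
  have hqc := polyParaConj_ne_zero hq0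
  have hCc : Polynomial.C c ≠ 0 := Polynomial.C_ne_zero.2 hc
  have hd0 := g.denom_ne_zero
  have h1 := mul_ne_zero hCc hqc
  have h2 := mul_ne_zero h1 hq0
  have h3 := mul_ne_zero h2 hh
  have h4 := mul_ne_zero h3 (pow_ne_zero 2 hd0)
  have hqroot : ∀ s : ℂ, 0 ≤ s.re → q.rootMultiplicity s = 0 := fun s hs =>
    Polynomial.rootMultiplicity_eq_zero fun h => absurd (hroot s h) hs.not_gt
  -- at a point of the right half-plane `q` has no root, so that the multiplicities of `q^*` and
  -- `h` have an even sum
  have hpar : ∀ s : ℂ, 0 < s.re →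
      Even ((polyParaConj q).rootMultiplicity s + h.rootMultiplicity s) := by
    intro s hs
    have h5 := congrArg (Polynomial.rootMultiplicity s) hpoly
    have h6 : g.num ^ 2 ≠ 0 := hpoly ▸ h4
    rw [Polynomial.rootMultiplicity_mul h4, Polynomial.rootMultiplicity_mul h3,
      Polynomial.rootMultiplicity_mul h2, Polynomial.rootMultiplicity_mul h1,
      Polynomial.rootMultiplicity_C, hqroot s hs.le, sq, sq,
      Polynomial.rootMultiplicity_mul (mul_ne_zero hd0 hd0),
      Polynomial.rootMultiplicity_mul (by rwa [← sq])] at h5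
    rw [Nat.even_iff]
    omega
  have hset : {s : ℂ | h.IsRoot s ∧ 0 < s.re ∧ Odd (h.rootMultiplicity s)} =
      (fun s : ℂ => -star s) '' (q.roots.toFinset : Set ℂ) := by
    ext s
    simp only [Set.mem_ofPred_eq, Set.mem_image, Finset.mem_coe, Multiset.mem_toFinset,
      Polynomial.mem_roots hq0]
    constructor
    · rintro ⟨-, hs, hodd⟩
      refine ⟨-star s, ?_, by simp⟩
      have h5 := hpar s hs
      have h6 : (polyParaConj q).rootMultiplicity s ≠ 0 := by
        intro h0
        rw [h0, zero_add] at h5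
        exact (Nat.not_even_iff_odd.2 hodd) h5
      have h7 := (Polynomial.rootMultiplicity_pos hqc).1 (Nat.pos_of_ne_zero h6)
      rwa [Polynomial.IsRoot, eval_polyParaConj, star_eq_zero] at h7
    · rintro ⟨z, hz, rfl⟩
      have hre : 0 < (-star z).re := by simpa using hroot z hz
      have h7 : (polyParaConj q).IsRoot (-star z) := by
        rw [Polynomial.IsRoot, eval_polyParaConj, star_neg, star_star, neg_neg, hz, star_zero]
      have h8 := (Polynomial.rootMultiplicity_pos hqc).2 h7
      have h9 := rootMultiplicity_polyParaConj_le_one hq0 hq (-star z)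
      have h5 := hpar _ hre
      have hodd : Odd (h.rootMultiplicity (-star z)) := by
        rw [Nat.even_iff] at h5
        rw [Nat.odd_iff]
        omega
      exact ⟨(Polynomial.rootMultiplicity_pos hh).1 hodd.pos, hre, hodd⟩
  have hnodup : q.roots.Nodup := Multiset.nodup_iff_count_le_one.2 fun s => by
    rw [Polynomial.count_roots]
    exact hq s
  rw [numOddRootsRightHalfPlane, hset,
    Set.ncard_image_of_injective _ (fun a b hab => star_injective (neg_injective hab)),
    Set.ncard_coe_finset, Multiset.toFinset_card_of_nodup hnodup,
    (IsAlgClosed.splits q).natDegree_eq_card_roots]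

/-- The para-Hermitian conjugate of the characteristic polynomial of `A` is, up to sign, the
characteristic polynomial of `-A^*`. -/
theorem map_charpoly_neg_conjTranspose {ι : Type*} [Fintype ι] [DecidableEq ι] (A : Matrix ι ι ℂ) :
    algebraMap ℂ[X] (RatFunc ℂ) (polyParaConj A.charpoly) =
      (-1) ^ Fintype.card ι * algebraMap ℂ[X] (RatFunc ℂ) (-Aᴴ).charpoly := by
  rw [← star_algebraMap, ← det_pencil, ← det_pencil, ← Matrix.det_conjTranspose,
    pencil_conjTranspose, Matrix.det_neg]

/-- The identity of Jacobi for complementary minors of the unitary matrix `T`, with the symmetry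
`T₁₂ = T₂₁ᵀ`. -/
theorem det_mul_det_one_sub_block {p : ℕ} {T : RationalMatrix (Fin p ⊕ Fin p) (Fin p ⊕ Fin p)}
    (hT : T * Tᴴ = 1) (hsymm : T.IsSymm) : ∃ σ : ℂ, σ ≠ 0 ∧
      RatFunc.C σ * T.det * (1 - T.toBlocks₂₂ * T.toBlocks₂₂ᴴ).det = T.toBlocks₂₁.det ^ 2 := by
  obtain ⟨a, b, c, d, rfl⟩ : ∃ a b c d, T = Matrix.fromBlocks a b c d :=
    ⟨_, _, _, _, (Matrix.fromBlocks_toBlocks T).symm⟩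
  rw [Matrix.toBlocks_fromBlocks₂₁, Matrix.toBlocks_fromBlocks₂₂]
  have hb : b = cᵀ := by
    have h1 := hsymm.eq
    rw [Matrix.fromBlocks_transpose, Matrix.fromBlocks_inj] at h1
    exact h1.2.1.symm
  rw [Matrix.fromBlocks_conjTranspose, Matrix.fromBlocks_multiply, ← Matrix.fromBlocks_one,
    Matrix.fromBlocks_inj] at hT
  obtain ⟨-, h12, -, h22⟩ := hT
  -- the swap of the two blocks, of determinant `±1`
  set P : RationalMatrix (Fin p ⊕ Fin p) (Fin p ⊕ Fin p) := Matrix.fromBlocks 0 1 1 0 with hP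
  have hPP : P.det * P.det = 1 := by
    rw [← Matrix.det_mul, hP, Matrix.fromBlocks_multiply]
    simp
  obtain ⟨σ, hσ0, hσ⟩ : ∃ σ : ℂ, σ ≠ 0 ∧ P.det = RatFunc.C σ := by
    rcases mul_self_eq_one_iff.1 hPP with h | h
    · exact ⟨1, one_ne_zero, by rw [h, map_one]⟩
    · exact ⟨-1, neg_ne_zero.2 one_ne_zero, by rw [h, map_neg, map_one]⟩
  refine ⟨σ, hσ0, ?_⟩
  have h1 : Matrix.fromBlocks a b c d * (Matrix.fromBlocks cᴴ 0 dᴴ 1 * P) =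
      Matrix.fromBlocks b 0 d 1 := by
    rw [hP, Matrix.fromBlocks_multiply, Matrix.fromBlocks_multiply]
    simp only [Matrix.mul_zero, Matrix.mul_one, zero_add, add_zero]
    rw [h12, h22]
  have h2 := congrArg Matrix.det h1
  rw [Matrix.det_mul, Matrix.det_mul, Matrix.det_fromBlocks_zero₁₂, Matrix.det_fromBlocks_zero₁₂,
    Matrix.det_one, mul_one, mul_one, hb, Matrix.det_transpose, hσ] at h2
  have h3 : 1 - d * dᴴ = c * cᴴ := by rw [← h22, add_sub_cancel_right]
  rw [h3, Matrix.det_mul, hb]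
  linear_combination c.det * h2

/-- The McMillan degree of a symmetric inner extension without isotropic eigenvectors that are
invisible in the given block. Its state matrix has characteristic polynomial `q χ`, with `χ` that of
the state matrix of `S` and `q` with simple roots, and `q^* q` times the characteristic polynomial
of the Hamiltonian matrix is a square up to a constant. -/
theorem RationalMatrix.IsSymmetricInnerExtension.size_eq {p n N : ℕ}
    {S : RationalMatrix (Fin p) (Fin p)} {T : RationalMatrix (Fin p ⊕ Fin p) (Fin p ⊕ Fin p)}
    (hT : S.IsSymmetricInnerExtension T) {A : Matrix (Fin N) (Fin N) ℂ}
    {B : Matrix (Fin N) (Fin p ⊕ Fin p) ℂ} {C : Matrix (Fin p ⊕ Fin p) (Fin N) ℂ}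
    {D : Matrix (Fin p ⊕ Fin p) (Fin p ⊕ Fin p) ℂ} (hmin : T.IsMinimalRealization A B C D)
    (hsym : IsSymmetricRealization A B C D)
    (hiso : ∀ (μ : ℂ) (w : Fin N → ℂ), A *ᵥ w = μ • w → (∀ j, (C *ᵥ w) (Sum.inr j) = 0) →
      w ⬝ᵥ w = 0 → w = 0)
    {a : Matrix (Fin n) (Fin n) ℂ} {b : Matrix (Fin n) (Fin p) ℂ} {c : Matrix (Fin p) (Fin n) ℂ}
    {d : Matrix (Fin p) (Fin p) ℂ} (hS : S.IsMinimalRealization a b c d)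
    (hd : IsUnit (1 - d * dᴴ).det) :
    N = n + numOddRootsRightHalfPlane (hamiltonianMatrix a b c d).charpoly := by
  obtain ⟨hAs, hCB, hDs⟩ := hsym
  have htf := hmin.eq_transferFunction
  have hTT := hT.inner.mul_conjTranspose
  -- the lower right block of the realization of `T` realizes `S`
  have hblock : transferFunction A (B.submatrix id Sum.inr) (C.submatrix Sum.inr id)
      D.toBlocks₂₂ = transferFunction a b c d := by
    rw [← hS.eq_transferFunction, ← hT.extends_block, htf]
    ext i j
    simp [transferFunction, Matrix.toBlocks₂₂, Matrix.mul_apply]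
  obtain ⟨q, hq, hq1⟩ := exists_charpoly_eq_mul hAs (by rw [hCB, Matrix.transpose_submatrix])
    (transferFunction_inj hblock).2 hS.isObservable hS.isReachable
    fun μ w hA hC hw => hiso μ w hA (fun j => congrFun hC j) hw
  have hq0 : q ≠ 0 := by
    rintro rfl
    exact (Matrix.charpoly_monic A).ne_zero (by rw [hq, zero_mul])
  have ha0 := (Matrix.charpoly_monic a).ne_zero
  have hroot : ∀ s, q.IsRoot s → s.re < 0 := by
    intro s hs
    by_contra! h
    refine hT.inner.charpoly_eval_ne_zero hmin h ?_
    rw [hq, Polynomial.eval_mul, hs, zero_mul]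
  have hdeg : N = n + q.natDegree := by
    have h1 := congrArg Polynomial.natDegree hq
    rw [Polynomial.natDegree_mul hq0 ha0, Matrix.charpoly_natDegree_eq_dim,
      Matrix.charpoly_natDegree_eq_dim, Fintype.card_fin, Fintype.card_fin] at h1
    omega
  -- the determinant of `T`
  have hTT' := hTT
  rw [htf] at hTT'
  have hDD := mul_conjTranspose_eq_one_of_transferFunction hTT'
  obtain ⟨M, hM, hMA, -⟩ := exists_lossless_intertwiner hmin.isObservable hmin.isReachable hTT'
  have hdetT := det_transferFunction A B C hDD
  rw [charpoly_eq_of_intertwine hM hMA, ← htf] at hdetT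
  have hD0 : D.det ≠ 0 := fun h => by simpa [h] using congrArg Matrix.det hDD
  obtain ⟨σ, hσ0, hσ⟩ := det_mul_det_one_sub_block hTT hT.symm
  rw [hT.extends_block] at hσ
  have hH := det_one_sub_mul_conjTranspose a b c hd
  rw [← hS.eq_transferFunction] at hH
  have hA' := map_charpoly_neg_conjTranspose A
  have ha' := map_charpoly_neg_conjTranspose a
  rw [hq, map_mul, map_mul] at hA'
  rw [hq, map_mul] at hdetT
  rw [hdeg, Nat.add_left_cancel_iff, eq_comm]
  have hx0 : algebraMap ℂ[X] (RatFunc ℂ) (-aᴴ).charpoly ≠ 0 := by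
    rw [Ne, map_eq_zero_iff _ (RatFunc.algebraMap_injective ℂ)]
    exact (Matrix.charpoly_monic _).ne_zero
  refine numOddRootsRightHalfPlane_eq_natDegree (c := σ * D.det * (1 - d * dᴴ).det *
      ((-1) ^ N * (-1) ^ n))
    (g := T.toBlocks₂₁.det * algebraMap ℂ[X] (RatFunc ℂ) q * algebraMap ℂ[X] (RatFunc ℂ) a.charpoly)
    hq0 (Matrix.charpoly_monic _).ne_zero hq1 hroot ?_ ?_
  · refine mul_ne_zero (mul_ne_zero (mul_ne_zero hσ0 hD0) hd.ne_zero) ?_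
    exact mul_ne_zero (pow_ne_zero _ (by norm_num)) (pow_ne_zero _ (by norm_num))
  · refine mul_right_cancel₀ hx0 ?_
    simp only [Fintype.card_fin] at hA' ha'
    simp only [map_mul, RatFunc.algebraMap_C, map_pow, map_neg, map_one]
    have hs : ((-1 : RatFunc ℂ) ^ N) * (-1) ^ N = 1 := by
      rw [← mul_pow, neg_one_mul, neg_neg, one_pow]
    set y := algebraMap ℂ[X] (RatFunc ℂ) (-aᴴ).charpoly
    set z := algebraMap ℂ[X] (RatFunc ℂ) (-Aᴴ).charpoly
    have hQ : (-1) ^ N * (-1) ^ n * algebraMap ℂ[X] (RatFunc ℂ) (polyParaConj q) * y = z := by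
      linear_combination (-1) ^ N * hA' + z * hs -
        (-1) ^ N * algebraMap ℂ[X] (RatFunc ℂ) (polyParaConj q) * ha'
    set x := algebraMap ℂ[X] (RatFunc ℂ) q
    set w := algebraMap ℂ[X] (RatFunc ℂ) a.charpoly
    set h := algebraMap ℂ[X] (RatFunc ℂ) (hamiltonianMatrix a b c d).charpoly
    linear_combination
      RatFunc.C σ * RatFunc.C D.det * RatFunc.C (1 - d * dᴴ).det * x * h * hQ -
      RatFunc.C σ * RatFunc.C (1 - d * dᴴ).det * x * h * hdetT -
      RatFunc.C σ * T.det * x ^ 2 * w * hH + x ^ 2 * w ^ 2 * y * hσ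

end Count

/-! ### The least McMillan degree -/

section Degree

open Matrix

variable {m k : Type*}

namespace RationalMatrix

theorem le_mcMillanDegree {T : RationalMatrix m k} {N : ℕ}
    (h : ∀ l, T.HasRealizationOfSize l → N ≤ l) : (N : ℕ∞) ≤ T.mcMillanDegree :=
  le_iInf₂ fun l hl => Nat.cast_le.2 (h l hl)

theorem IsMinimalRealization.mcMillanDegree_eq {T : RationalMatrix m k} {N : ℕ}
    {A : Matrix (Fin N) (Fin N) ℂ} {B : Matrix (Fin N) k ℂ} {C : Matrix m (Fin N) ℂ}
    {D : Matrix m k ℂ} (h : T.IsMinimalRealization A B C D) : T.mcMillanDegree = N :=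
  le_antisymm (iInf₂_le N ⟨A, B, C, D, h.1⟩) (le_mcMillanDegree h.2)

theorem exists_isMinimalRealization {S : RationalMatrix m k} {n : ℕ}
    (h : S.mcMillanDegree = (n : ℕ∞)) : ∃ (A : Matrix (Fin n) (Fin n) ℂ) (B : Matrix (Fin n) k ℂ)
      (C : Matrix m (Fin n) ℂ) (D : Matrix m k ℂ), S.IsMinimalRealization A B C D := by
  classical
  have hne : ∃ l, S.HasRealizationOfSize l := by
    by_contra! hno
    refine ENat.natCast_ne_top n (h.symm.trans ?_)
    simp [mcMillanDegree, hno]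
  obtain ⟨A, B, C, D, hr⟩ := Nat.find_spec hne
  have hmin : S.IsMinimalRealization A B C D := ⟨hr, fun l hl => Nat.find_min' hne hl⟩
  have hn : Nat.find hne = n := by exact_mod_cast hmin.mcMillanDegree_eq.symm.trans h
  generalize Nat.find hne = N at hn A B C D hmin
  subst hn
  exact ⟨A, B, C, D, hmin⟩

end RationalMatrix

end Degree

theorem theorem5p1 (p n : ℕ) (S : RationalMatrix (Fin p) (Fin p))
    (hSchur : S.IsSchur) (hSymm : S.IsSymm)
    (hInfinity : S.IsStrictlyContractiveAtInfinity)
    (hDegree : S.mcMillanDegree = (n : ℕ∞)) :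
    (∃ (A : Matrix (Fin n) (Fin n) ℂ) (B : Matrix (Fin n) (Fin p) ℂ)
      (C : Matrix (Fin p) (Fin n) ℂ) (D : Matrix (Fin p) (Fin p) ℂ),
      S.IsMinimalRealization A B C D ∧ IsSymmetricRealization A B C D) ∧
    ∀ (A : Matrix (Fin n) (Fin n) ℂ) (B : Matrix (Fin n) (Fin p) ℂ)
      (C : Matrix (Fin p) (Fin n) ℂ) (D : Matrix (Fin p) (Fin p) ℂ),
      S.IsMinimalRealization A B C D → IsSymmetricRealization A B C D →
      ∀ κ : ℕ, κ = numOddRootsRightHalfPlane (hamiltonianMatrix A B C D).charpoly →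
        (∃ T : RationalMatrix (Fin p ⊕ Fin p) (Fin p ⊕ Fin p),
          S.IsSymmetricInnerExtension T ∧ T.mcMillanDegree = ((n + κ : ℕ) : ℕ∞)) ∧
        ∀ T : RationalMatrix (Fin p ⊕ Fin p) (Fin p ⊕ Fin p),
          S.IsSymmetricInnerExtension T → ((n + κ : ℕ) : ℕ∞) ≤ T.mcMillanDegree := by
  classical
  refine ⟨?_, ?_⟩
  · obtain ⟨A, B, C, D, h⟩ := RationalMatrix.exists_isMinimalRealization hDegree
    exact h.exists_symmetric hSymm
  intro A B C D hmin hsym κ hκ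
  have hD : IsUnit (1 - D * D.conjTranspose).det := by
    obtain ⟨D', hD', hnorm⟩ := hInfinity
    have h1 := tendsto_eval_transferFunction A B C D
    rw [← hmin.eq_transferFunction] at h1
    rw [tendsto_nhds_unique h1 hD']
    exact isUnit_det_one_sub_mul_conjTranspose hnorm
  have hdet : (1 - S * S.conjTranspose).det ≠ 0 := by
    intro h0
    have h1 := det_one_sub_mul_conjTranspose A B C hD
    rw [← hmin.eq_transferFunction, h0, zero_mul, eq_comm, mul_eq_zero, map_eq_zero,
      map_eq_zero_iff _ (RatFunc.algebraMap_injective ℂ)] at h1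
    exact h1.elim hD.ne_zero (Matrix.charpoly_monic _).ne_zero
  -- an extension of least degree among all symmetric inner extensions
  have hex : ∃ N, ∃ T, S.IsSymmetricInnerExtension T ∧ T.HasRealizationOfSize N := by
    obtain ⟨T, hT⟩ := exists_isSymmetricInnerExtension hSchur hSymm hdet
    obtain ⟨N, hN⟩ :=
      exists_hasRealizationOfSize_of_mul_conjTranspose_eq_one hT.inner.mul_conjTranspose
    exact ⟨N, T, hT, hN⟩
  obtain ⟨T, hT, A₀, B₀, C₀, D₀, hr⟩ := Nat.find_spec hex
  have hleast : ∀ T', S.IsSymmetricInnerExtension T' → ∀ l, T'.HasRealizationOfSize l →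
      Nat.find hex ≤ l := fun T' hT' l hl => Nat.find_min' hex ⟨T', hT', hl⟩
  generalize Nat.find hex = N at hleast A₀ B₀ C₀ hr
  obtain ⟨A₁, B₁, C₁, D₁, hmin₁, hsym₁⟩ :=
    RationalMatrix.IsMinimalRealization.exists_symmetric hT.symm ⟨hr, hleast T hT⟩
  have hN : N = n + κ := by
    rw [hκ]
    refine hT.size_eq hmin₁ hsym₁ (fun μ w hA hC hiso => ?_) hmin hD
    by_contra hw
    obtain ⟨T', hT', hr'⟩ := hT.exists_smaller hmin₁ hsym₁ hw hA hC hiso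
    have h1 := hleast T' hT' _ hr'
    have h2 : N = 0 := by omega
    subst h2
    exact hw (Subsingleton.elim _ _)
  subst hN
  exact ⟨⟨T, hT, hmin₁.mcMillanDegree_eq⟩,
    fun T' hT' => RationalMatrix.le_mcMillanDegree (hleast T' hT')⟩
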